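/- **Setting.** Let $\mathbf t_\nu=(t_{\nu,1},t_{\nu,2},\dots)$, $\nu=1,2$, be real times of which only finitely many are nonzero, let $U$ be an open set of times $(\mathbf t_1,\mathbf t_2)$ (open in the direct limit topology of the spaces $\mathbb R^n$), and let $\mathcal B(U)$ be the algebra of smooth complex functions on $U$ (smooth on every finite-dimensional affine slice). Put $\partial_\nu=\partial/\partial t_{\nu,1}$. Let $\mathcal E$ be the algebra of pseudo-differential operators $\sum_{i\le m}\sum_{j\le n}f_{ij}\partial_1^i\partial_2^j$ with $f_{ij}\in\mathcal B(U)$ and product $$f\partial_1^i\partial_2^j\cdot g\,\partial_1^p\partial_2^q=\sum_{r,s\ge0}\binom ir\binom js f\,\partial_1^r\partial_2^s(g)\,\partial_1^{i+p-r}\partial_2^{j+q-s},$$ with adjoint $(\sum f_{ij}\partial_1^i\partial_2^j)^*=\sum(-1)^{i+j}\partial_1^i\partial_2^jf_{ij}$, and for $D=\sum_{r,s\ge0} g_{rs}\partial_1^r\partial_2^s$ let $D\langle A\rangle$ be obtained by applying $D$ to every coefficient of $A$. For an operator $A$ in powers of $\partial_\nu$ only, $A_{\ge m}$ and $A_{<m}$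 denote its parts with powers $\ge m$ and $<m$ of $\partial_\nu$. Functions $\beta,a_{\nu,i}\in\mathcal B(U)$ ($\nu=1,2$, $i\ge1$) are a *solution of the KP-mKP hierarchy* if $$\Phi_1=1+\sum_{i\ge1}a_{1,i}\partial_1^{-i},\qquad \Phi_2=e^\beta\Big(1+\sum_{i\ge1}a_{2,i}\partial_2^{-i}\Big),\qquad P_\nu=\Phi_\nu\partial_\nu\Phi_\nu^{-1}$$ satisfy, for all $k\ge1$ (derivatives in $t_{\nu,k}$ being taken coefficientwise), $$\frac{\partial\Phi_1}{\partial t_{1,k}}=-(P_1^k)_{<0}\Phi_1,\quad \frac{\partial\Phi_2}{\partial t_{2,k}}=-(P_2^k)_{<1}\Phi_2,\quad \frac{\partial\Phi_1}{\partial t_{2,k}}=(P_2^k)_{\ge1}\langle\Phi_1\rangle,\quad \frac{\partial\Phi_2}{\partial t_{1,k}}=(P_1^k)_{\ge0}\langle\Phi_2\rangle,$$ $$e^\beta\partial_1e^{-\beta}\Phi_1\partial_2\Phi_1^{-1}=\partial_2\Phi_2\partial_1\Phi_2^{-1}.$$ Put $\xi(\mathbf t_\nu;z)=\sum_{k\ge1}t_{\nu,k}z^k$,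 and let operators act on exponentials by $\partial_\nu^ie^{\pm\xi(\mathbf t_\nu;z)}=(\pm z)^ie^{\pm\xi(\mathbf t_\nu;z)}$, $i\in\mathbb Z$. The (adjoint) Baker–Akhiezer functions are $$w_\nu=\Phi_\nu e^{\xi(\mathbf t_\nu;z)},\qquad w_1^\dagger=\big(\partial_1\Phi_1^{-1}e^\beta\partial_1^{-1}e^{-\beta}\big)^*e^{-\xi(\mathbf t_1;z)},\qquad w_2^\dagger=\big(\partial_2\Phi_2^{-1}\partial_2^{-1}\big)^*e^{-\xi(\mathbf t_2;z)};$$ they are formal products of a series in $z^{-1}$ with coefficients in $\mathcal B(U)$ and an exponential. Put $\phi_\nu(z)=w_\nu e^{-\xi(\mathbf t_\nu;z)}$, $N_\nu(z)=-\frac{\partial}{\partial z}+\sum_{k\ge1}z^{-k-1}\frac{\partial}{\partial t_{\nu,k}}$ and $$\eta=\sum_{\nu=1}^2\sum_{k\ge1}\eta_{\nu,k}\,dt_{\nu,k},\qquad \eta_{\nu,k}=-\operatorname{res}_z z^kN_\nu(z)\log\phi_\nu(z),$$ where $\log\phi_1$ and $\log\phi_2-\beta$ have no term in $z^0$ and $\operatorname{res}_z\sum_if_iz^i=f_{-1}$.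 Shifts by $\pm[z^{-1}]$, $[z^{-1}]=(\frac1z,\frac1{2z^2},\frac1{3z^3},\dots)$, mean $f(\mathbf t_\nu\pm[z^{-1}])=\exp\big(\pm\sum_{k\ge1}\frac1{kz^k}\frac{\partial}{\partial t_{\nu,k}}\big)f$, a power series in $z^{-1}$ (the other times being unchanged). An identity with two arbitrary sets of times $(\mathbf t_1,\mathbf t_2)$, $(\mathbf t_1',\mathbf t_2')$ is understood as an identity of formal power series in $\mathbf t-\mathbf t'$, through Taylor expansion at $\mathbf t'$. **Theorem.** Let $\beta,a_{\nu,i}\in\mathcal B(U)$ be a solution of the KP-mKP hierarchy. Then: 1. The 1-form $\eta$ is closed. Hence every point of $U$ has an open neighbourhood $V\subseteq U$ with a nowhere vanishing $\tau_1\in\mathcal B(V)$ such that $\eta=d\log\tau_1$ on $V$; moreover such a $\tau_1$ exists on every star-shaped open $V\subseteq U$. 2. The (adjoint) Baker–Akhiezer functions satisfy $$\operatorname{res}_z\big(z^{-1}w_1(\mathbf t_1,\mathbf t_2;z)w_1^\dagger(\mathbf t_1',\mathbf t_2';z)\big)=\operatorname{res}_z\big(z^{-1}w_2(\mathbf t_1,\mathbf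 t_2;z)w_2^\dagger(\mathbf t_1',\mathbf t_2';z)\big).\qquad(*)$$ 3. For every open $V\subseteq U$, every nowhere vanishing $\tau_1\in\mathcal B(V)$ with $\eta=d\log\tau_1$ on $V$, and $\tau_2=e^\beta\tau_1$, one has on $V$ $$w_1=\frac{\tau_1(\mathbf t_1-[z^{-1}],\mathbf t_2)}{\tau_1(\mathbf t_1,\mathbf t_2)}e^{\xi(\mathbf t_1;z)},\qquad w_1^\dagger=\frac{\tau_2(\mathbf t_1+[z^{-1}],\mathbf t_2)}{\tau_2(\mathbf t_1,\mathbf t_2)}e^{-\xi(\mathbf t_1;z)},$$ $$w_2=\frac{\tau_2(\mathbf t_1,\mathbf t_2-[z^{-1}])}{\tau_1(\mathbf t_1,\mathbf t_2)}e^{\xi(\mathbf t_2;z)},\qquad w_2^\dagger=\frac{\tau_1(\mathbf t_1,\mathbf t_2+[z^{-1}])}{\tau_2(\mathbf t_1,\mathbf t_2)}e^{-\xi(\mathbf t_2;z)}.$$ Multiplying the left and right sides of $(*)$ by $\tau_1(\mathbf t_1,\mathbf t_2)\,\tau_2(\mathbf t_1',\mathbf t_2')$ gives respectively the left and right sides of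 $$\operatorname{res}_z\Big(z^{-1}\tau_1(\mathbf t_1-[z^{-1}],\mathbf t_2)\,\tau_2(\mathbf t_1'+[z^{-1}],\mathbf t_2')\,e^{\xi(\mathbf t_1-\mathbf t_1';z)}\Big)=\operatorname{res}_z\Big(z^{-1}\tau_2(\mathbf t_1,\mathbf t_2-[z^{-1}])\,\tau_1(\mathbf t_1',\mathbf t_2'+[z^{-1}])\,e^{\xi(\mathbf t_2-\mathbf t_2';z)}\Big),$$ and this identity holds. -/

import Mathlib

open scoped ContDiff

namespace KPmKP

/-- The index of the time variable `t_{ν,k}`, `k ≥ 1`. The values `ν = 1, 2` are written `0, 1`. -/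
abbrev TimeIndex := Fin 2 × ℕ+

/-- The space of times `(𝐭₁, 𝐭₂)` with finitely many nonzero coordinates: this is the union of the
spaces `ℝ^n`, and on it `ξ(𝐭_ν; z) = ∑ₖ t_{ν,k} z^k` is a finite sum. -/
abbrev Times := TimeIndex →₀ ℝ

/-- A domain of times: a subset that contains a box around each of its points. These are exactly
the open sets of the direct limit topology of the spaces `ℝ^n`. -/
structure TimeDomain where
  carrier : Set Times
  exists_box : ∀ p ∈ carrier, ∃ ε : TimeIndex → ℝ, (∀ i, 0 < ε i) ∧
    ∀ q : Times, (∀ i, |q i - p i| < ε i) → q ∈ carrier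

/-- The extension by zero of a function on a domain. -/
noncomputable def extendZero {U : TimeDomain} (f : U.carrier → ℂ) : Times → ℂ :=
  Function.extend Subtype.val f 0

/-- A function on a domain is smooth if it is `C^∞` along every finite-dimensional affine
slice of the domain. -/
def IsSmooth {U : TimeDomain} (f : U.carrier → ℂ) : Prop :=
  ∀ (W : Type) [NormedAddCommGroup W] [NormedSpace ℝ W] [FiniteDimensional ℝ W]
    (L : W →ₗ[ℝ] Times) (p : Times),
    ContDiffOn ℝ ∞ (fun v => extendZero f (p + L v)) {v | p + L v ∈ U.carrier}

theorem extendZero_of_mem {U : TimeDomain} (f : U.carrier → ℂ) {x : Times} (hx : x ∈ U.carrier) :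
    extendZero f x = f ⟨x, hx⟩ :=
  Subtype.val_injective.extend_apply f 0 ⟨x, hx⟩

theorem isSmooth_congr {U : TimeDomain} {f : U.carrier → ℂ} {F : Times → ℂ}
    (hF : ∀ x (hx : x ∈ U.carrier), f ⟨x, hx⟩ = F x)
    (h : ∀ (W : Type) [NormedAddCommGroup W] [NormedSpace ℝ W] [FiniteDimensional ℝ W]
      (L : W →ₗ[ℝ] Times) (p : Times),
      ContDiffOn ℝ ∞ (fun v => F (p + L v)) {v | p + L v ∈ U.carrier}) : IsSmooth f := by
  intro W _ _ _ L p
  refine (h W L p).congr fun v hv => ?_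
  rw [extendZero_of_mem f hv, hF _ hv]

theorem isOpen_slice (U : TimeDomain) {W : Type} [NormedAddCommGroup W] [NormedSpace ℝ W]
    [FiniteDimensional ℝ W] (L : W →ₗ[ℝ] Times) (p : Times) :
    IsOpen {v | p + L v ∈ U.carrier} := by
  rw [isOpen_iff_mem_nhds]
  intro v hv
  obtain ⟨ε, hε, hbox⟩ := U.exists_box _ hv
  let b := Module.finBasis ℝ W
  let F : Finset TimeIndex := Finset.univ.biUnion fun j => (L (b j)).support
  have hzero : ∀ i ∉ F, ∀ w : W, L w i = 0 := by
    intro i hi w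
    rw [← b.sum_repr w]
    simp only [map_sum, map_smul, Finsupp.coe_finsetSum, Finset.sum_apply, Finsupp.smul_apply]
    refine Finset.sum_eq_zero fun j _ => ?_
    have : i ∉ (L (b j)).support := fun hj => hi (Finset.mem_biUnion.2 ⟨j, Finset.mem_univ _, hj⟩)
    rw [Finsupp.notMem_support_iff.1 this, smul_zero]
  have hcont : ∀ i, Continuous fun w : W => L w i := fun i =>
    ((Finsupp.lapply i : Times →ₗ[ℝ] ℝ).comp L).continuous_of_finiteDimensional
  have hev : ∀ᶠ w in nhds v, ∀ i ∈ F, |L w i - L v i| < ε i := by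
    rw [Filter.eventually_all_finset]
    intro i _
    have h1 : Continuous fun w : W => |L w i - L v i| := ((hcont i).sub continuous_const).abs
    exact h1.continuousAt.eventually_lt continuousAt_const (by simpa using hε i)
  filter_upwards [hev] with w hw
  refine hbox _ fun i => ?_
  by_cases hi : i ∈ F
  · simpa using hw i hi
  · simpa [hzero i hi] using hε i

/-- The algebra `𝓑` of smooth complex functions on a domain of times. -/
noncomputable def smoothSubalgebra (U : TimeDomain) : Subalgebra ℂ (U.carrier → ℂ) where
  carrier := {f | IsSmooth f}
  mul_mem' {f g} hf hg := isSmooth_congr (F := fun x => extendZero f x * extendZero g x)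
    (fun x hx => by simp [extendZero_of_mem _ hx]) fun W _ _ _ L p => (hf W L p).mul (hg W L p)
  add_mem' {f g} hf hg := isSmooth_congr (F := fun x => extendZero f x + extendZero g x)
    (fun x hx => by simp [extendZero_of_mem _ hx]) fun W _ _ _ L p => (hf W L p).add (hg W L p)
  algebraMap_mem' c := isSmooth_congr (F := fun _ => c) (fun _ _ => rfl)
    fun W _ _ _ L p => contDiffOn_const

/-- Smooth complex functions on a domain of times. -/
abbrev SmoothFn (U : TimeDomain) : Type := ↥(smoothSubalgebra U)

/-- The coordinate direction of the time `t_i`. -/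
noncomputable def dir (i : TimeIndex) : Times := Finsupp.single i 1

/-- The values of `∂f/∂t_i`. -/
noncomputable def partialDeriv {U : TimeDomain} (i : TimeIndex) (f : U.carrier → ℂ) :
    U.carrier → ℂ :=
  fun p => deriv (fun s : ℝ => extendZero f (p.1 + s • dir i)) 0

theorem hasFDerivAt_slice {U : TimeDomain} (f : SmoothFn U)
    {W : Type} [NormedAddCommGroup W] [NormedSpace ℝ W] [FiniteDimensional ℝ W]
    (L : W →ₗ[ℝ] Times) (p : Times) {v : W} (hv : p + L v ∈ U.carrier) :
    HasFDerivAt (fun x => extendZero f.1 (p + L x))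
      (fderiv ℝ (fun x => extendZero f.1 (p + L x)) v) v :=
  (((f.2 W L p).contDiffAt ((isOpen_slice U L p).mem_nhds hv)).differentiableAt
    (by simp)).hasFDerivAt

theorem extendZero_partialDeriv {U : TimeDomain} {i : TimeIndex} (f : SmoothFn U)
    {W : Type} [NormedAddCommGroup W] [NormedSpace ℝ W] [FiniteDimensional ℝ W]
    (L : W →ₗ[ℝ] Times) (p : Times) {v w : W} (hv : p + L v ∈ U.carrier) (hw : L w = dir i) :
    extendZero (partialDeriv i f.1) (p + L v) =
      fderiv ℝ (fun x => extendZero f.1 (p + L x)) v w := by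
  have hl : HasDerivAt (fun s : ℝ => v + s • w) w 0 := by
    simpa using ((hasDerivAt_id (0 : ℝ)).smul_const w).const_add v
  have hv' : p + L (v + (0 : ℝ) • w) ∈ U.carrier := by simpa using hv
  have h := (hasFDerivAt_slice f L p hv').comp_hasDerivAt (0 : ℝ) hl
  rw [extendZero_of_mem _ hv]
  simpa [partialDeriv, Function.comp_def, hw, add_assoc] using h.deriv

theorem hasDerivAt_partialDeriv {U : TimeDomain} (i : TimeIndex) (f : SmoothFn U)
    (p : U.carrier) :
    HasDerivAt (fun s : ℝ => extendZero f.1 (p.1 + s • dir i)) (partialDeriv i f.1 p) 0 := by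
  have hp : p.1 + LinearMap.toSpanSingleton ℝ Times (dir i) 0 ∈ U.carrier := by simp
  exact (hasFDerivAt_slice f _ _ hp).differentiableAt.hasDerivAt

theorem eventually_mem {U : TimeDomain} (i : TimeIndex) (p : U.carrier) :
    ∀ᶠ s : ℝ in nhds 0, p.1 + s • dir i ∈ U.carrier :=
  (isOpen_slice U (LinearMap.toSpanSingleton ℝ Times (dir i)) p).mem_nhds (by simp)

theorem isSmooth_partialDeriv {U : TimeDomain} (i : TimeIndex) (f : SmoothFn U) :
    IsSmooth (partialDeriv i f.1) := by
  intro W _ _ _ L p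
  set M := L.coprod (LinearMap.toSpanSingleton ℝ Times (dir i)) with hM
  have h1 : ContDiffOn ℝ ∞ (fderiv ℝ fun x : W × ℝ => extendZero f.1 (p + M x))
      {x | p + M x ∈ U.carrier} :=
    (f.2 (W × ℝ) M p).fderiv_of_isOpen (isOpen_slice U M p) (by simp)
  have h2 : ContDiffOn ℝ ∞ (fun v : W => fderiv ℝ
      (fun x : W × ℝ => extendZero f.1 (p + M x)) (v, 0)) {v | p + L v ∈ U.carrier} :=
    h1.comp (contDiff_id.prodMk contDiff_const).contDiffOn fun v hv => by simpa [hM] using hv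
  refine (h2.clm_apply (contDiffOn_const (c := ((0 : W), (1 : ℝ))))).congr fun v hv => ?_
  have hv' : p + M (v, 0) ∈ U.carrier := by simpa [hM] using hv
  rw [← extendZero_partialDeriv (i := i) f M p hv' (by simp [hM])]
  simp [hM]

/-- The linear map `∂/∂t_i` on smooth functions. -/
noncomputable def pdLinear {U : TimeDomain} (i : TimeIndex) : SmoothFn U →ₗ[ℂ] SmoothFn U where
  toFun f := ⟨partialDeriv i f.1, isSmooth_partialDeriv i f⟩
  map_add' f g := by
    refine Subtype.ext (funext fun p => ?_)
    refine (((hasDerivAt_partialDeriv i f p).add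
      (hasDerivAt_partialDeriv i g p)).congr_of_eventuallyEq ?_).deriv
    filter_upwards [eventually_mem i p] with s hs
    simp [extendZero_of_mem _ hs]
  map_smul' c f := by
    refine Subtype.ext (funext fun p => ?_)
    refine (((hasDerivAt_partialDeriv i f p).const_mul c).congr_of_eventuallyEq ?_).deriv
    filter_upwards [eventually_mem i p] with s hs
    simp [extendZero_of_mem _ hs]

/-- The derivation `∂/∂t_i` of the algebra of smooth functions. -/
noncomputable def pd {U : TimeDomain} (i : TimeIndex) :
    Derivation ℂ (SmoothFn U) (SmoothFn U) :=
  Derivation.mk' (pdLinear i) fun f g => by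
    refine Subtype.ext (funext fun p => ?_)
    have hp : ∀ f : SmoothFn U, extendZero f.1 (p.1 + (0 : ℝ) • dir i) = f.1 p := fun f => by
      have : p.1 + (0 : ℝ) • dir i ∈ U.carrier := by simp
      rw [extendZero_of_mem _ this]
      simp
    have h := (hasDerivAt_partialDeriv i f p).mul (hasDerivAt_partialDeriv i g p)
    rw [hp, hp] at h
    refine ((h.congr_of_eventuallyEq ?_).deriv).trans ?_
    · filter_upwards [eventually_mem i p] with s hs
      simp [extendZero_of_mem _ hs]
    · simp only [pdLinear, LinearMap.coe_mk, AddHom.coe_mk, smul_eq_mul]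
      change _ = f.1 p * partialDeriv i g.1 p + g.1 p * partialDeriv i f.1 p
      ring

theorem pd_comm {U : TimeDomain} (i j : TimeIndex) (f : SmoothFn U) :
    pd i (pd j f) = pd j (pd i f) := by
  refine Subtype.ext (funext fun p => ?_)
  set M := (LinearMap.toSpanSingleton ℝ Times (dir i)).coprod
    (LinearMap.toSpanSingleton ℝ Times (dir j)) with hM
  set g : ℝ × ℝ → ℂ := fun x => extendZero f.1 (p.1 + M x) with hg
  have h0 : p.1 + M 0 ∈ U.carrier := by simp
  have hi : M (1, 0) = dir i := by simp [hM]
  have hj : M (0, 1) = dir j := by simp [hM]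
  have hs : IsOpen {x | p.1 + M x ∈ U.carrier} := isOpen_slice U M p
  have hcd : ContDiffOn ℝ ∞ g {x | p.1 + M x ∈ U.carrier} := f.2 (ℝ × ℝ) M p
  have hsymm : IsSymmSndFDerivAt ℝ g 0 :=
    (hcd.contDiffAt (hs.mem_nhds h0)).isSymmSndFDerivAt
      (by simpa using WithTop.coe_le_coe.2 (le_top : (2 : ℕ∞) ≤ ⊤))
  have hd2 : DifferentiableAt ℝ (fderiv ℝ g) 0 :=
    ((hcd.fderiv_of_isOpen (m := ∞) hs (by simp)).contDiffAt
      (hs.mem_nhds h0)).differentiableAt (by simp)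
  have key : ∀ (k l : TimeIndex) (a b : ℝ × ℝ), M a = dir k → M b = dir l →
      (pd k (pd l f)).1 p = fderiv ℝ (fderiv ℝ g) 0 a b := by
    intro k l a b ha hb
    have h1 := extendZero_partialDeriv (i := k) (pd l f) M p.1 h0 ha
    have h2 : (fun x => extendZero (pd l f).1 (p.1 + M x)) =ᶠ[nhds 0]
        fun x => fderiv ℝ g x b := by
      filter_upwards [hs.mem_nhds h0] with x hx
      exact extendZero_partialDeriv f M p.1 hx hb
    rw [h2.fderiv_eq, extendZero_of_mem _ h0, fderiv_clm_apply hd2 (by fun_prop)] at h1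
    have hp : (⟨p.1 + M 0, h0⟩ : U.carrier) = p := Subtype.ext (by simp)
    rw [hp] at h1
    exact h1.trans (by simp)
  rw [key i j _ _ hi hj, key j i _ _ hj hi]
  exact hsymm _ _

/-- The derivation `∂/∂t_i` as an element of the algebra of linear operators. -/
noncomputable def pdEnd (U : TimeDomain) (i : TimeIndex) : Module.End ℂ (SmoothFn U) :=
  (pd i).toLinearMap

/-- The inclusion of domains `V ⊆ U`. -/
def TimeDomain.Sub (V U : TimeDomain) : Prop := V.carrier ⊆ U.carrier

/-- Restriction of smooth functions to a smaller domain. -/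
noncomputable def restrict {U V : TimeDomain} (h : V.Sub U) : SmoothFn U →+* SmoothFn V where
  toFun f := ⟨fun p => f.1 ⟨p.1, h p.2⟩, isSmooth_congr (F := extendZero f.1)
    (fun _ hx => (extendZero_of_mem f.1 (h hx)).symm)
    fun W _ _ _ L p => (f.2 W L p).mono fun _ hv => h hv⟩
  map_one' := rfl
  map_mul' _ _ := rfl
  map_zero' := rfl
  map_add' _ _ := rfl

/-- The exponential of a smooth function. -/
noncomputable def expFn {U : TimeDomain} (f : SmoothFn U) : SmoothFn U :=
  ⟨fun p => Complex.exp (f.1 p), isSmooth_congr (F := fun x => Complex.exp (extendZero f.1 x))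
    (fun x hx => by rw [extendZero_of_mem f.1 hx]) fun W _ _ _ L p => (f.2 W L p).cexp⟩

/-- The exponential of a smooth function, as a unit with inverse `e^{-f}`. -/
noncomputable def expUnit {U : TimeDomain} (f : SmoothFn U) : (SmoothFn U)ˣ where
  val := expFn f
  inv := expFn (-f)
  val_inv := Subtype.ext (funext fun _ => by simp [expFn, ← Complex.exp_add])
  inv_val := Subtype.ext (funext fun _ => by simp [expFn, ← Complex.exp_add])

/-! ### Pseudo-differential operators with two derivations -/

/-- `∂₁ = ∂/∂t_{1,1}` (for `ν = 0`) and `∂₂ = ∂/∂t_{2,1}` (for `ν = 1`). -/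
noncomputable abbrev dd {U : TimeDomain} (ν : Fin 2) : Derivation ℂ (SmoothFn U) (SmoothFn U) :=
  pd (ν, 1)

/-- Elements `∑_{i ≤ m} ∑_{j ≤ n} f_{ij} ∂₁^i ∂₂^j` of the algebra `𝓔`. -/
@[ext]
structure PsiDO (U : TimeDomain) where
  coeff : ℤ → ℤ → SmoothFn U
  bounded : ∃ m n : ℤ, ∀ i j, m < i ∨ n < j → coeff i j = 0

namespace PsiDO

variable {U : TimeDomain}

/-- The operator `f ∂₁^i ∂₂^j`. -/
noncomputable def monomial (i j : ℤ) (f : SmoothFn U) : PsiDO U where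
  coeff a b := if a = i ∧ b = j then f else 0
  bounded := ⟨i, j, fun a b h => if_neg (by omega)⟩

/-- The multiplication operator by `f`. -/
noncomputable def ofFn (f : SmoothFn U) : PsiDO U := monomial 0 0 f

/-- The operator `∂_ν^n`, `n ∈ ℤ`. -/
noncomputable def dpow (ν : Fin 2) (n : ℤ) : PsiDO U :=
  monomial (if ν = 0 then n else 0) (if ν = 1 then n else 0) 1

noncomputable instance : One (PsiDO U) := ⟨ofFn 1⟩

noncomputable instance : Neg (PsiDO U) :=
  ⟨fun A => ⟨fun i j => -A.coeff i j, by
    obtain ⟨m, n, h⟩ := A.bounded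
    exact ⟨m, n, fun i j hij => by rw [h i j hij, neg_zero]⟩⟩⟩

/-- The product given by
`f ∂₁^i ∂₂^j · g ∂₁^p ∂₂^q = ∑_{r,s ≥ 0} C(i,r) C(j,s) f ∂₁^r∂₂^s(g) ∂₁^{i+p-r} ∂₂^{j+q-s}`:
the coefficient at `∂₁^a ∂₂^b` collects the terms with `p = a + r - i` and `q = b + s - j`;
only finitely many of them are nonzero. -/
noncomputable instance : Mul (PsiDO U) :=
  ⟨fun A B =>
    { coeff := fun a b => ∑ᶠ x : (ℤ × ℤ) × (ℕ × ℕ),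
        (Ring.choose x.1.1 x.2.1 * Ring.choose x.1.2 x.2.2) •
          (A.coeff x.1.1 x.1.2 *
            (dd 0)^[x.2.1] ((dd 1)^[x.2.2]
              (B.coeff (a + x.2.1 - x.1.1) (b + x.2.2 - x.1.2))))
      bounded := by
        obtain ⟨m, n, hA⟩ := A.bounded
        obtain ⟨p, q, hB⟩ := B.bounded
        refine ⟨m + p, n + q, fun a b hab => finsum_eq_zero_of_forall_eq_zero fun x => ?_⟩
        by_cases hx : m < x.1.1 ∨ n < x.1.2
        · rw [hA _ _ hx, zero_mul, smul_zero]
        · rw [hB _ _ (by omega), iterate_map_zero, iterate_map_zero, mul_zero, smul_zero] }⟩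

/-- Natural powers. -/
noncomputable def npow (A : PsiDO U) : ℕ → PsiDO U
  | 0 => 1
  | k + 1 => npow A k * A

noncomputable instance : Pow (PsiDO U) ℕ := ⟨npow⟩

open Classical in
/-- The two-sided inverse in `𝓔` of an invertible operator (and `1` for other operators). -/
noncomputable instance : Inv (PsiDO U) :=
  ⟨fun A => if h : ∃ B : PsiDO U, A * B = 1 ∧ B * A = 1 then h.choose else 1⟩

/-- The part of `A` with powers at least `m` of `∂_ν`. -/
noncomputable def truncGE (ν : Fin 2) (m : ℤ) (A : PsiDO U) : PsiDO U where
  coeff i j := if m ≤ (if ν = 0 then i else j) then A.coeff i j else 0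
  bounded := by
    obtain ⟨p, q, h⟩ := A.bounded
    exact ⟨p, q, fun i j hij => by rw [h i j hij, ite_self]⟩

/-- The part of `A` with powers less than `m` of `∂_ν`. -/
noncomputable def truncLT (ν : Fin 2) (m : ℤ) (A : PsiDO U) : PsiDO U where
  coeff i j := if (if ν = 0 then i else j) < m then A.coeff i j else 0
  bounded := by
    obtain ⟨p, q, h⟩ := A.bounded
    exact ⟨p, q, fun i j hij => by rw [h i j hij, ite_self]⟩

/-- The action `D⟨A⟩` of a differential operator `D = ∑_{r,s ≥ 0} g_{rs} ∂₁^r ∂₂^s` on each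
coefficient of `A`. -/
noncomputable def act (D A : PsiDO U) : PsiDO U where
  coeff i j := ∑ᶠ x : ℕ × ℕ, D.coeff x.1 x.2 * (dd 0)^[x.1] ((dd 1)^[x.2] (A.coeff i j))
  bounded := by
    obtain ⟨p, q, h⟩ := A.bounded
    refine ⟨p, q, fun i j hij => finsum_eq_zero_of_forall_eq_zero fun x => ?_⟩
    rw [h i j hij, iterate_map_zero, iterate_map_zero, mul_zero]

/-- The adjoint `A^* = ∑_{i,j} (-1)^{i+j} ∂₁^i ∂₂^j f_{ij}`, where
`∂₁^i ∂₂^j f = ∑_{r,s ≥ 0} C(i,r) C(j,s) ∂₁^r∂₂^s(f) ∂₁^{i-r} ∂₂^{j-s}`. -/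
noncomputable def adjoint (A : PsiDO U) : PsiDO U where
  coeff a b := ∑ᶠ x : ℕ × ℕ,
    (((a + x.1 + (b + x.2)).negOnePow : ℤ) *
      (Ring.choose (a + x.1) x.1 * Ring.choose (b + x.2) x.2)) •
        (dd 0)^[x.1] ((dd 1)^[x.2] (A.coeff (a + x.1) (b + x.2)))
  bounded := by
    obtain ⟨p, q, h⟩ := A.bounded
    refine ⟨p, q, fun i j hij => finsum_eq_zero_of_forall_eq_zero fun x => ?_⟩
    rw [h _ _ (by omega), iterate_map_zero, iterate_map_zero, smul_zero]

/-- The derivative `∂A/∂t_i`, coefficient by coefficient. -/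
noncomputable def dt (i : TimeIndex) (A : PsiDO U) : PsiDO U where
  coeff a b := pd i (A.coeff a b)
  bounded := by
    obtain ⟨p, q, h⟩ := A.bounded
    exact ⟨p, q, fun a b hab => by rw [h a b hab, map_zero]⟩

/-- The coefficient of `∂_ν^n`, for an operator containing powers of `∂_ν` only. -/
noncomputable def axis (A : PsiDO U) (ν : Fin 2) (n : ℤ) : SmoothFn U :=
  A.coeff (if ν = 0 then n else 0) (if ν = 1 then n else 0)

end PsiDO

/-! ### Baker-Akhiezer functions -/

/-- Formal expressions `A(𝐭₁, 𝐭₂; z) e^{ε ξ(𝐭_ν; z)}` with `ε = ±1` and `A` a Laurent series in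
`u = z⁻¹` whose coefficients are smooth functions. -/
@[ext]
structure Wave (U : TimeDomain) (ν : Fin 2) (ε : ℤˣ) where
  amp : LaurentSeries (SmoothFn U)

/-- Restriction of a formal expression to a smaller domain. -/
noncomputable def Wave.restrict {U V : TimeDomain} {ν : Fin 2} {ε : ℤˣ} (h : V.Sub U)
    (w : Wave U ν ε) : Wave V ν ε := ⟨w.amp.map (KPmKP.restrict h)⟩

/-- The action on `e^{ε ξ(𝐭_ν; z)}` of an operator containing powers of `∂_ν` only:
`∂_ν^i e^{ε ξ(𝐭_ν; z)} = (ε z)^i e^{ε ξ(𝐭_ν; z)}`. -/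
noncomputable def PsiDO.onExp {U : TimeDomain} (A : PsiDO U) (ν : Fin 2) (ε : ℤˣ) :
    Wave U ν ε where
  amp := HahnSeries.ofSuppBddBelow (fun n => ((ε ^ (-n) : ℤˣ) : ℤ) • A.axis ν (-n)) (by
    obtain ⟨p, q, h⟩ := A.bounded
    refine ⟨-(max p q), fun n hn => ?_⟩
    by_contra hlt
    refine hn ?_
    have : A.axis ν (-n) = 0 := by
      have h1 : p < -n ∧ q < -n := by
        have := le_max_left p q
        have := le_max_right p q
        omega
      refine h _ _ ?_
      fin_cases ν
      · exact Or.inl (by simpa using h1.1)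
      · exact Or.inr (by simpa using h1.2)
    simp [this])

/-! ### The KP-mKP hierarchy -/

/-- The unknown functions `β` and `a_{ν,i}`, `i ≥ 1`. -/
structure Unknowns (U : TimeDomain) where
  β : SmoothFn U
  a : Fin 2 → ℕ+ → SmoothFn U

namespace Unknowns

variable {U : TimeDomain} (S : Unknowns U)

/-- `a_{ν,n}`, with `a_{ν,0} = 1`. -/
noncomputable def a' (ν : Fin 2) (n : ℕ) : SmoothFn U := if h : 0 < n then S.a ν ⟨n, h⟩ else 1

/-- `Φ₁ = 1 + ∑_{i ≥ 1} a_{1,i} ∂₁^{-i}`. -/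
noncomputable def Phi₁ : PsiDO U where
  coeff i j := if i ≤ 0 ∧ j = 0 then S.a' 0 (-i).toNat else 0
  bounded := ⟨0, 0, fun i j h => if_neg (by omega)⟩

/-- `Φ₂ = e^β (1 + ∑_{i ≥ 1} a_{2,i} ∂₂^{-i})`. -/
noncomputable def Phi₂ : PsiDO U where
  coeff i j := if i = 0 ∧ j ≤ 0 then expFn S.β * S.a' 1 (-j).toNat else 0
  bounded := ⟨0, 0, fun i j h => if_neg (by omega)⟩

/-- `P₁ = Φ₁ ∂₁ Φ₁⁻¹`. -/
noncomputable def P₁ : PsiDO U := S.Phi₁ * PsiDO.dpow 0 1 * S.Phi₁⁻¹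

/-- `P₂ = Φ₂ ∂₂ Φ₂⁻¹`. -/
noncomputable def P₂ : PsiDO U := S.Phi₂ * PsiDO.dpow 1 1 * S.Phi₂⁻¹

/-- The equations of the KP-mKP hierarchy. -/
structure IsSolution : Prop where
  flow₁₁ : ∀ k : ℕ+, S.Phi₁.dt (0, k) = -(S.P₁ ^ (k : ℕ)).truncLT 0 0 * S.Phi₁
  flow₂₂ : ∀ k : ℕ+, S.Phi₂.dt (1, k) = -(S.P₂ ^ (k : ℕ)).truncLT 1 1 * S.Phi₂
  flow₁₂ : ∀ k : ℕ+, S.Phi₁.dt (1, k) = ((S.P₂ ^ (k : ℕ)).truncGE 1 1).act S.Phi₁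
  flow₂₁ : ∀ k : ℕ+, S.Phi₂.dt (0, k) = ((S.P₁ ^ (k : ℕ)).truncGE 0 0).act S.Phi₂
  constraint :
    PsiDO.ofFn (expFn S.β) * PsiDO.dpow 0 1 * PsiDO.ofFn (expFn (-S.β)) *
        S.Phi₁ * PsiDO.dpow 1 1 * S.Phi₁⁻¹ =
      PsiDO.dpow 1 1 * S.Phi₂ * PsiDO.dpow 0 1 * S.Phi₂⁻¹

/-- `w₁ = Φ₁ e^{ξ(𝐭₁; z)}`. -/
noncomputable def w₁ : Wave U 0 1 := S.Phi₁.onExp 0 1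

/-- `w₂ = Φ₂ e^{ξ(𝐭₂; z)}`. -/
noncomputable def w₂ : Wave U 1 1 := S.Phi₂.onExp 1 1

/-- `w₁† = (∂₁ Φ₁⁻¹ e^β ∂₁⁻¹ e^{-β})^* e^{-ξ(𝐭₁; z)}`. -/
noncomputable def w₁dag : Wave U 0 (-1) :=
  (PsiDO.dpow 0 1 * S.Phi₁⁻¹ * PsiDO.ofFn (expFn S.β) * PsiDO.dpow 0 (-1) *
    PsiDO.ofFn (expFn (-S.β))).adjoint.onExp 0 (-1)

/-- `w₂† = (∂₂ Φ₂⁻¹ ∂₂⁻¹)^* e^{-ξ(𝐭₂; z)}`. -/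
noncomputable def w₂dag : Wave U 1 (-1) :=
  (PsiDO.dpow 1 1 * S.Phi₂⁻¹ * PsiDO.dpow 1 (-1)).adjoint.onExp 1 (-1)

end Unknowns

/-! ### Formal exponentials and logarithms, shifts of the times -/

/-- `exp X = ∑_j X^j / j!` for a power series `X` without constant term. -/
noncomputable def expSeries {R : Type*} [Ring R] [Algebra ℂ R] (X : PowerSeries R) :
    PowerSeries R :=
  PowerSeries.mk fun n => ∑ j ∈ Finset.range (n + 1), ((j.factorial : ℂ)⁻¹) •
    PowerSeries.coeff n (X ^ j)

/-- `log (1 + X) = ∑_{j ≥ 1} (-1)^{j+1} X^j / j` for a power series `X` without constant term. -/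
noncomputable def logOneAdd {R : Type*} [Ring R] [Algebra ℂ R] (X : PowerSeries R) :
    PowerSeries R :=
  PowerSeries.mk fun n => ∑ j ∈ Finset.Icc 1 n, ((-1) ^ (j + 1) / (j : ℂ)) •
    PowerSeries.coeff n (X ^ j)

section Shift

variable {U : TimeDomain}

/-- The operator `exp (ε ∑_{k ≥ 1} (1 / (k z^k)) ∂/∂t_{ν,k})`, as a power series in `u = z⁻¹`
whose coefficients are operators on smooth functions; it is `G_ν(z)` for `ε = -1` and
`G_ν(z)⁻¹` for `ε = 1`. -/
noncomputable def shiftOp (U : TimeDomain) (ν : Fin 2) (ε : ℤˣ) :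
    PowerSeries (Module.End ℂ (SmoothFn U)) :=
  expSeries (PowerSeries.mk fun k => if h : 0 < k then
    (((ε : ℤ) : ℂ) / (k : ℂ)) • pdEnd U (ν, ⟨k, h⟩) else 0)

/-- The function `f(𝐭_ν + ε [z⁻¹])` with the other times unchanged, where
`[z⁻¹] = (1/z, 1/(2z²), 1/(3z³), …)`, as a series in `u = z⁻¹`. -/
noncomputable def shift (ν : Fin 2) (ε : ℤˣ) (f : SmoothFn U) : LaurentSeries (SmoothFn U) :=
  HahnSeries.ofPowerSeries ℤ (SmoothFn U)
    (PowerSeries.mk fun n => PowerSeries.coeff n (shiftOp U ν ε) f)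

/-- The operator `N_ν(z) = -∂/∂z + ∑_{k ≥ 1} z^{-k-1} ∂/∂t_{ν,k}` on power series in `u = z⁻¹`:
`-∂/∂z` sends `u^n` to `n u^{n+1}`, and the index `k` is written `j + 1`. -/
noncomputable def Nop (ν : Fin 2) (f : PowerSeries (SmoothFn U)) : PowerSeries (SmoothFn U) :=
  PowerSeries.X * PowerSeries.mk fun n => (n : ℂ) • PowerSeries.coeff n f +
    ∑ j ∈ Finset.range n, pd (ν, j.succPNat) (PowerSeries.coeff (n - 1 - j) f)

end Shift

namespace Unknowns

variable {U : TimeDomain} (S : Unknowns U)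

/-- `log φ_ν(z)` with `φ_ν(z) = w_ν e^{-ξ(𝐭_ν; z)}`: here
`φ₁(z) = 1 + ∑ a_{1,i} z^{-i}` and `φ₂(z) = e^β (1 + ∑ a_{2,i} z^{-i})`. -/
noncomputable def logPhi (ν : Fin 2) : PowerSeries (SmoothFn U) :=
  PowerSeries.C (if ν = 1 then S.β else 0) +
    logOneAdd (PowerSeries.mk fun n => if h : 0 < n then S.a ν ⟨n, h⟩ else 0)

/-- `η_{ν,k} = -res_z z^k N_ν(z) log φ_ν(z)`, the coefficients of the 1-form
`η = ∑ η_{ν,k} dt_{ν,k}`. -/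
noncomputable def η (i : TimeIndex) : SmoothFn U :=
  -PowerSeries.coeff ((i.2 : ℕ) + 1) (Nop i.1 (S.logPhi i.1))

/-- A nowhere vanishing smooth function `τ₁` on `V ⊆ U` with `η = d log τ₁`, that is
`∂τ₁/∂t_i = η_i τ₁` for all `i`. -/
def IsTau₁ {V : TimeDomain} (h : V.Sub U) (τ₁ : (SmoothFn V)ˣ) : Prop :=
  ∀ i, pd i (τ₁ : SmoothFn V) = restrict h (S.η i) * τ₁

/-- `τ₂ = e^β τ₁`. -/
noncomputable def tau₂ {V : TimeDomain} (h : V.Sub U) (τ₁ : (SmoothFn V)ˣ) : (SmoothFn V)ˣ :=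
  expUnit (restrict h S.β) * τ₁

end Unknowns

/-! ### Residues with two sets of times

An identity with arbitrary times `(𝐭₁, 𝐭₂)` and `(𝐭₁', 𝐭₂')` is one between formal power series
in `s = 𝐭 - 𝐭'` whose coefficients are smooth functions of `𝐭'`. -/

section Residue

variable {U : TimeDomain}

/-- The partial derivative `∂^m` for a multi-index `m`. -/
noncomputable def pdMulti (m : TimeIndex →₀ ℕ) : Module.End ℂ (SmoothFn U) :=
  m.support.noncommProd
    (fun i => pdEnd U i ^ m i)
    fun i _ j _ _ => Commute.pow_pow (LinearMap.ext fun f => pd_comm (U := U) i j f) _ _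

/-- The Taylor expansion `f(𝐭' + s) = ∑_m ∂^m f(𝐭') s^m / m!`. -/
noncomputable def taylor : SmoothFn U →ₗ[ℂ] MvPowerSeries TimeIndex (SmoothFn U) where
  toFun f := fun m => ((m.prod fun _ n => (n.factorial : ℂ))⁻¹) • pdMulti m f
  map_add' f g := by
    funext m
    simp only [map_add, smul_add]
    rfl
  map_smul' c f := by
    funext m
    rw [map_smul, smul_comm]
    rfl

/-- The series `e^{ξ(s_ν; z)} = exp (∑_{k ≥ 1} s_{ν,k} z^k)` in powers of `z`. -/
noncomputable def expXi (U : TimeDomain) (ν : Fin 2) :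
    PowerSeries (MvPowerSeries TimeIndex (SmoothFn U)) :=
  expSeries (PowerSeries.mk fun k => if h : 0 < k then MvPowerSeries.X (ν, ⟨k, h⟩) else 0)

/-- The weight `∑ k m_{ν,k}` of a multi-index. -/
def weight (m : TimeIndex →₀ ℕ) : ℕ := m.sum fun i n => (i.2 : ℕ) * n

/-- `res_z (z⁻¹ A(𝐭; z) B(𝐭'; z) e^{ξ(𝐭_ν - 𝐭_ν'; z)})`, with `𝐭 = 𝐭' + s`. If
`A(𝐭' + s; z) B(𝐭'; z) = ∑_j X_j z^{-j}` and `e^{ξ(s_ν; z)} = ∑_{j ≥ 0} p_j z^j`, then it is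
`∑_{j ≥ 0} p_j X_j`. As `p_j` is homogeneous of weight `j`, only the terms with `j ≤ weight m`
contribute to the coefficient of `s^m`. -/
noncomputable def residue (ν : Fin 2) (A B : LaurentSeries (SmoothFn U)) :
    MvPowerSeries TimeIndex (SmoothFn U) :=
  fun m => ∑ j ∈ Finset.range (weight m + 1), MvPowerSeries.coeff m
    (PowerSeries.coeff j (expXi U ν) *
      HahnSeries.coeff (A.map (taylor (U := U)) *
        B.map (MvPowerSeries.C : SmoothFn U →+* MvPowerSeries TimeIndex (SmoothFn U))) (j : ℤ))

/-- `res_z (z⁻¹ w(𝐭; z) w'(𝐭'; z))` for `w = A e^{ξ(𝐭_ν; z)}` and `w' = B e^{-ξ(𝐭_ν; z)}`. -/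
noncomputable def waveResidue {ν : Fin 2} (w : Wave U ν 1) (w' : Wave U ν (-1)) :
    MvPowerSeries TimeIndex (SmoothFn U) := residue ν w.amp w'.amp

end Residue

end KPmKP

open KPmKP

open scoped ContDiff

namespace KPmKP

/-! ### The product of pseudo-differential operators in one variable

The operator `∑ Aₙ ∂^{-n}` is represented by the Laurent series with coefficients `Aₙ`. -/

section Vanish

variable {R : Type*} [CommRing R]

/-! Put u = z⁻¹. An operator in powers of ∂_ν is encoded by a Laurent series in u, its amplitude on
the exponential, and composition becomes the product `star`. In these terms the hierarchy is linear
in the pair w = (w₁, w₂). The flows express ∂w/∂t_{ν,k} through the vectors ∂_ν^n w, with n ≥ 0 for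
the first set of times and n ≥ 1 for the second (`IsSolution.flow`). The constraint has order at
most one in ∂₂ on its left side and at most one in ∂₁ on its right side, which forces (∂₁ - ∂₁β) ∂₂
w = q w for a function q (`cross_of_isSolution`). The adjoint functions enter through their
orthogonality to all ∂_ν^n w. `WavePair` collects these facts, and `wavePair` derives them from the
hierarchy.

Bilinear identity. The span of all ∂₁^n w and ∂₂^n w is stable under every time derivative
(`WavePair.waveD_mem`) and orthogonal to the adjoint pair (`WavePair.pairing_eq_zero`).
Differentiating the difference of the two residues in s = 𝐭 - 𝐭' replaces w by another element of
this span, and at s = 0 the difference is a pairing. So all Taylor coefficients vanish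
(`WavePair.expResidue_eq`).

Closedness. The shift by -[v] is an exponential of time derivatives, so the coefficients of w(t_ν -
[v]) stay in the span of the ∂_ν^n w, while the exponential contributes only the factor 1 - v z.
Comparing orders in z leaves w(t₁ - [v]) = c(v) w - v ∂₁w and w(t₂ - [v]) = w - v g(v) ∂₂w, where
g(v) = e^β(t₂ - [v]) / e^β. At v = u the exponential factor vanishes, which ties c and g to the
amplitudes. It follows that φ₁(t₁ - [v]; u) φ₁(v) is symmetric in u and v. The same holds for φ₂
after division by e^β(t₂ - [v]), and the cross equation gives a mixed relation (`swap_φ`, `swap_ψ`,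
`shift_mixed`). The derivation ∇ = u d/du + ∑ u^k ∂/∂t_{ν,k} annihilates every shift f(t_ν - [u]),
and ∇φ_ν = e_ν φ_ν, where η_{ν,k} is minus the coefficient of u^k in e_ν. So a single invertible
double series has logarithmic derivatives e(v) and e(u) along two commuting derivations, and this is
closedness (`deriv_coeff_comm`).

Tau functions. The Poincaré lemma, by integration along segments in finite-dimensional slices, gives
log τ₁ (`exists_primitive`). Then φ_ν τ₁ is annihilated by ∇, hence is the shift of its constant
term (`mul_C_eq_shiftHom`), which gives w₁ and w₂. For the adjoint functions, orthogonality is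
applied to w(t_ν + [v]). The exponential factor 1/(1 - v z) evaluates the residue at u = v and
yields φ₁(t₁ + [u]; u) φ₁†(u) = e^β(t₁ + [u]) / e^β and φ₂(t₂ + [u]; u) φ₂†(u) = 1
(`diagShift_mul_zero`, `diagShift_mul_one`). -/

/-- All coefficients of `A` below `a` vanish. -/
def Vanish (a : ℤ) (A : LaurentSeries R) : Prop := ∀ n < a, A.coeff n = 0

theorem exists_vanish (A : LaurentSeries R) : ∃ a, Vanish a A :=
  ⟨A.order, fun _ h => HahnSeries.coeff_eq_zero_of_lt_order h⟩

theorem exists_vanish₂ (A B : LaurentSeries R) : ∃ a, Vanish a A ∧ Vanish a B := by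
  obtain ⟨a, ha⟩ := exists_vanish A
  obtain ⟨b, hb⟩ := exists_vanish B
  exact ⟨min a b, fun n hn => ha n (by omega), fun n hn => hb n (by omega)⟩

/-- A Laurent series with prescribed coefficients. -/
noncomputable def mkLaurent (f : ℤ → R) (h : ∃ a, ∀ n < a, f n = 0) : LaurentSeries R :=
  HahnSeries.ofSuppBddBelow f (by
    obtain ⟨a, ha⟩ := h
    exact ⟨a, fun n hn => not_lt.1 fun hlt => hn (ha n hlt)⟩)

@[simp] theorem coeff_mkLaurent (f : ℤ → R) (h) (n : ℤ) : (mkLaurent f h).coeff n = f n := rfl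

theorem Vanish.add {a : ℤ} {A B : LaurentSeries R} (hA : Vanish a A) (hB : Vanish a B) :
    Vanish a (A + B) := fun n hn => by
  rw [HahnSeries.coeff_add, hA n hn, hB n hn, add_zero]

theorem Vanish.mono {a b : ℤ} {A : LaurentSeries R} (hA : Vanish a A) (h : b ≤ a) : Vanish b A :=
  fun n hn => hA n (by omega)

theorem coeff_single_mul' (k : ℤ) (A : LaurentSeries R) (n : ℤ) :
    (HahnSeries.single k (1 : R) * A).coeff n = A.coeff (n - k) := by
  have := HahnSeries.coeff_single_mul_add (r := (1 : R)) (x := A) (a := n - k) (b := k)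
  rw [sub_add_cancel] at this
  rw [this, one_mul]

theorem coeff_mul_eq_sum {a b : ℤ} {A B : LaurentSeries R} (hA : Vanish a A) (hB : Vanish b B)
    (n : ℤ) : (A * B).coeff n = ∑ i ∈ Finset.Icc a (n - b), A.coeff i * B.coeff (n - i) := by
  rw [HahnSeries.coeff_mul]
  refine Finset.sum_bij_ne_zero (fun x _ _ => x.1) ?_ ?_ ?_ ?_
  · intro x hx _
    rw [Finset.mem_antidiagonal] at hx
    rw [Finset.mem_Icc]
    refine ⟨not_lt.1 fun h => hx.1 (hA _ h), not_lt.1 fun h => hx.2.1 (hB _ ?_)⟩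
    have := hx.2.2
    omega
  · intro x hx _ y hy _ hxy
    rw [Finset.mem_antidiagonal] at hx hy
    have h1 := hx.2.2
    have h2 := hy.2.2
    exact Prod.ext hxy (by omega)
  · intro i _ hne
    refine ⟨(i, n - i), ?_, hne, rfl⟩
    rw [Finset.mem_antidiagonal]
    exact ⟨left_ne_zero_of_mul hne, right_ne_zero_of_mul hne, by simp⟩
  · intro x hx _
    rw [Finset.mem_antidiagonal] at hx
    rw [← hx.2.2, add_sub_cancel_left]

theorem vanish_single (k : ℤ) (f : R) : Vanish k (HahnSeries.single k f) := fun _ hn =>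
  HahnSeries.coeff_single_of_ne (by omega)

theorem coeff_map {S F : Type*} [CommRing S] [FunLike F R S] [ZeroHomClass F R S] (f : F)
    (A : LaurentSeries R) (n : ℤ) : (A.map f).coeff n = f (A.coeff n) := rfl

/-- A Laurent series is a finite sum of monomials up to terms of arbitrarily high order. -/
theorem exists_eq_sum_add (A : LaurentSeries R) (N : ℤ) :
    ∃ (s : Finset ℤ) (A' : LaurentSeries R), Vanish N A' ∧
      A = (∑ i ∈ s, HahnSeries.single i (A.coeff i)) + A' := by
  obtain ⟨a, hA⟩ := exists_vanish A
  refine ⟨Finset.Ico a N, A - ∑ i ∈ Finset.Ico a N, HahnSeries.single i (A.coeff i), ?_, by ring⟩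
  intro n hn
  rw [HahnSeries.coeff_sub, HahnSeries.coeff_sum]
  by_cases h : n ∈ Finset.Ico a N
  · rw [Finset.sum_eq_single_of_mem n h fun i _ hi => HahnSeries.coeff_single_of_ne hi.symm,
      HahnSeries.coeff_single_same, sub_self]
  · rw [Finset.sum_eq_zero fun i hi => HahnSeries.coeff_single_of_ne fun hni : n = i => h (by rwa [hni]),
      sub_zero]
    exact hA n (by simp only [Finset.mem_Ico, not_and, not_lt] at h; omega)

theorem coeff_single_eq_ite (k n : ℤ) (f : R) :
    (HahnSeries.single k f).coeff n = if n = k then f else 0 := by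
  split_ifs with h
  · rw [h, HahnSeries.coeff_single_same]
  · rw [HahnSeries.coeff_single_of_ne h]

end Vanish

section Star

variable {R : Type*} [CommRing R] [Algebra ℂ R] (d : Derivation ℂ R R)

theorem iterate_add (r : ℕ) (x y : R) : d^[r] (x + y) = d^[r] x + d^[r] y :=
  iterate_map_add d r x y

theorem iterate_zero' (r : ℕ) : d^[r] 0 = 0 := iterate_map_zero d r

/-- The coefficients of `∂^{-i} B`. -/
noncomputable def dpowCoeff (i : ℤ) (B : LaurentSeries R) (n : ℤ) : R :=
  ∑ᶠ r : ℕ, Ring.choose (-i) r • d^[r] (B.coeff (n - i - r))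

theorem dpowCoeff_eq_sum {b : ℤ} {B : LaurentSeries R} (hB : Vanish b B) (i n : ℤ) {M : ℕ}
    (hM : n - i - M < b) :
    dpowCoeff d i B n = ∑ r ∈ Finset.range M, Ring.choose (-i) r • d^[r] (B.coeff (n - i - r)) := by
  refine finsum_eq_sum_of_support_subset _ fun r hr => ?_
  by_contra h
  refine hr ?_
  simp only [Finset.coe_range, Set.mem_Iio, not_lt] at h
  have h' : (M : ℤ) ≤ r := by exact_mod_cast h
  simp only
  rw [hB _ (by omega), iterate_zero', smul_zero]

theorem dpowCoeff_eq_zero {b : ℤ} {B : LaurentSeries R} (hB : Vanish b B) {i n : ℤ}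
    (h : n - i < b) : dpowCoeff d i B n = 0 := by
  rw [dpowCoeff_eq_sum d hB i n (M := 0) (by simpa using h), Finset.sum_range_zero]

theorem dpowCoeff_add (i n : ℤ) (B C : LaurentSeries R) :
    dpowCoeff d i (B + C) n = dpowCoeff d i B n + dpowCoeff d i C n := by
  obtain ⟨b, hB, hC⟩ := exists_vanish₂ B C
  have hBC : Vanish b (B + C) := fun n hn => by
    rw [HahnSeries.coeff_add, hB n hn, hC n hn, add_zero]
  have hM : n - i - ((n - i - b + 1).toNat : ℕ) < b := by omega
  rw [dpowCoeff_eq_sum d hB i n hM, dpowCoeff_eq_sum d hC i n hM, dpowCoeff_eq_sum d hBC i n hM,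
    ← Finset.sum_add_distrib]
  refine Finset.sum_congr rfl fun r _ => ?_
  rw [HahnSeries.coeff_add, iterate_add, smul_add]

theorem dpowCoeff_zero (B : LaurentSeries R) (n : ℤ) : dpowCoeff d 0 B n = B.coeff n := by
  obtain ⟨b, hB⟩ := exists_vanish B
  rw [dpowCoeff_eq_sum d hB 0 n (M := (n - b + 1).toNat + 1) (by omega), Finset.sum_range_succ']
  simp [Ring.choose_zero_succ]

/-- The composition `∂ ∂^{-i} = ∂^{-(i-1)}`. -/
theorem d_dpowCoeff (B : LaurentSeries R) (i n : ℤ) :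
    d (dpowCoeff d i B n) + dpowCoeff d i B (n + 1) = dpowCoeff d (i - 1) B n := by
  obtain ⟨b, hB⟩ := exists_vanish B
  have hM : n - i - ((n - i - b + 1).toNat : ℕ) < b := by omega
  rw [dpowCoeff_eq_sum d hB i n hM,
    dpowCoeff_eq_sum d hB i (n + 1) (M := (n - i - b + 1).toNat + 1) (by omega),
    dpowCoeff_eq_sum d hB (i - 1) n (M := (n - i - b + 1).toNat + 1) (by omega),
    Finset.sum_range_succ', Finset.sum_range_succ', ← add_assoc, map_sum,
    ← Finset.sum_add_distrib]
  congr 1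
  · refine Finset.sum_congr rfl fun r _ => ?_
    have h1 : -(i - 1) = -i + 1 := by ring
    have h2 : n - (i - 1) - ((r + 1 : ℕ) : ℤ) = n - i - r := by push_cast; ring
    have h3 : n + 1 - i - ((r + 1 : ℕ) : ℤ) = n - i - r := by push_cast; ring
    rw [h1, Ring.choose_succ_succ, add_smul, h2, h3, map_zsmul, ← Function.iterate_succ_apply' d]
  · simp only [Nat.cast_zero, Function.iterate_zero, id, sub_zero, Ring.choose_zero_right, one_smul]
    rw [show n + 1 - i = n - (i - 1) by ring]

/-- The product of pseudo-differential operators in one variable. -/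
noncomputable def star (A B : LaurentSeries R) : LaurentSeries R :=
  mkLaurent (fun n => ∑ᶠ i : ℤ, A.coeff i * dpowCoeff d i B n) (by
    obtain ⟨a, hA⟩ := exists_vanish A
    obtain ⟨b, hB⟩ := exists_vanish B
    refine ⟨a + b, fun n hn => finsum_eq_zero_of_forall_eq_zero fun i => ?_⟩
    by_cases hi : i < a
    · rw [hA i hi, zero_mul]
    · rw [dpowCoeff_eq_zero d hB (by omega), mul_zero])

theorem coeff_star (A B : LaurentSeries R) (n : ℤ) :
    (star d A B).coeff n = ∑ᶠ i : ℤ, A.coeff i * dpowCoeff d i B n := rfl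

theorem support_star {a b : ℤ} {A B : LaurentSeries R} (hA : Vanish a A) (hB : Vanish b B) (n : ℤ) :
    (Function.support fun i => A.coeff i * dpowCoeff d i B n) ⊆ Finset.Icc a (n - b) := by
  intro i hi
  by_contra h
  refine hi ?_
  simp only [Finset.coe_Icc, Set.mem_Icc, not_and_or, not_le] at h
  rcases h with h | h
  · simp only; rw [hA i h, zero_mul]
  · simp only; rw [dpowCoeff_eq_zero d hB (by omega), mul_zero]

theorem coeff_star_eq_sum {a b : ℤ} {A B : LaurentSeries R} (hA : Vanish a A) (hB : Vanish b B)
    (n : ℤ) : (star d A B).coeff n =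
      ∑ i ∈ Finset.Icc a (n - b), A.coeff i * dpowCoeff d i B n :=
  finsum_eq_sum_of_support_subset _ (support_star d hA hB n)

theorem hasFiniteSupport_star (A B : LaurentSeries R) (n : ℤ) :
    (fun i => A.coeff i * dpowCoeff d i B n).HasFiniteSupport := by
  obtain ⟨a, hA⟩ := exists_vanish A
  obtain ⟨b, hB⟩ := exists_vanish B
  exact (Finset.finite_toSet _).subset (support_star d hA hB n)

theorem Vanish.star {a b : ℤ} {A B : LaurentSeries R} (hA : Vanish a A) (hB : Vanish b B) :
    Vanish (a + b) (star d A B) := fun n hn => by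
  rw [coeff_star_eq_sum d hA hB, Finset.Icc_eq_empty (by omega), Finset.sum_empty]

/-- The leading coefficient of a product. -/
theorem coeff_star_add {a b : ℤ} {A B : LaurentSeries R} (hA : Vanish a A) (hB : Vanish b B) :
    (star d A B).coeff (a + b) = A.coeff a * B.coeff b := by
  rw [coeff_star_eq_sum d hA hB, show a + b - b = a by ring, Finset.Icc_self, Finset.sum_singleton,
    dpowCoeff_eq_sum d hB a (a + b) (M := 1) (by push_cast; omega), Finset.sum_range_one]
  simp [show a + b - a = b by ring]

theorem add_star (A B C : LaurentSeries R) : star d (A + B) C = star d A C + star d B C := by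
  ext n
  rw [HahnSeries.coeff_add, coeff_star, coeff_star, coeff_star,
    ← finsum_add_distrib (hasFiniteSupport_star d A C n) (hasFiniteSupport_star d B C n)]
  refine finsum_congr fun i => ?_
  rw [HahnSeries.coeff_add, add_mul]

theorem star_add (A B C : LaurentSeries R) : star d A (B + C) = star d A B + star d A C := by
  ext n
  rw [HahnSeries.coeff_add, coeff_star, coeff_star, coeff_star,
    ← finsum_add_distrib (hasFiniteSupport_star d A B n) (hasFiniteSupport_star d A C n)]
  refine finsum_congr fun i => ?_
  rw [dpowCoeff_add, mul_add]

theorem smul_star (f : R) (A B : LaurentSeries R) : star d (f • A) B = f • star d A B := by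
  ext n
  rw [HahnSeries.coeff_smul, coeff_star, coeff_star,
    smul_finsum' f (hasFiniteSupport_star d A B n)]
  refine finsum_congr fun i => ?_
  rw [HahnSeries.coeff_smul, smul_eq_mul, smul_eq_mul, mul_assoc]

theorem zero_star (A : LaurentSeries R) : star d 0 A = 0 := by
  have := smul_star d 0 0 A; simpa using this

theorem star_zero (A : LaurentSeries R) : star d A 0 = 0 := by
  have := star_add d A 0 0; simpa using this

theorem neg_star (A B : LaurentSeries R) : star d (-A) B = -star d A B := by
  have := smul_star d (-1) A B; simpa using this

theorem star_neg (A B : LaurentSeries R) : star d A (-B) = -star d A B := by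
  have := star_add d A B (-B)
  rw [add_neg_cancel, star_zero] at this
  exact (neg_eq_of_add_eq_zero_right this.symm).symm

theorem star_sub (A B C : LaurentSeries R) : star d A (B - C) = star d A B - star d A C := by
  rw [sub_eq_add_neg, star_add, star_neg, sub_eq_add_neg]

theorem sum_star {ι : Type*} (s : Finset ι) (A : ι → LaurentSeries R) (B : LaurentSeries R) :
    star d (∑ i ∈ s, A i) B = ∑ i ∈ s, star d (A i) B := by
  classical
  induction s using Finset.induction_on with
  | empty => simp [zero_star]
  | insert i s hi ih => rw [Finset.sum_insert hi, Finset.sum_insert hi, add_star, ih]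

/-- The product of a monomial with a series. -/
theorem coeff_single_star (i : ℤ) (f : R) (B : LaurentSeries R) (n : ℤ) :
    (star d (HahnSeries.single i f) B).coeff n = f * dpowCoeff d i B n := by
  rw [coeff_star, finsum_eq_single _ i, HahnSeries.coeff_single_same]
  intro j hj
  rw [HahnSeries.coeff_single_of_ne hj, zero_mul]

theorem C_star (f : R) (B : LaurentSeries R) : star d (HahnSeries.C f) B = f • B := by
  ext n
  rw [HahnSeries.C_apply, coeff_single_star, dpowCoeff_zero, HahnSeries.coeff_smul, smul_eq_mul]

theorem one_star (B : LaurentSeries R) : star d 1 B = B := by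
  rw [← map_one (HahnSeries.C (Γ := ℤ) (R := R)), C_star, one_smul]

theorem iterate_one_eq_zero {r : ℕ} (hr : r ≠ 0) : d^[r] 1 = 0 := by
  obtain ⟨s, rfl⟩ := Nat.exists_eq_succ_of_ne_zero hr
  rw [Function.iterate_succ_apply, Derivation.map_one_eq_zero, iterate_zero']

/-- Multiplication by a power of `∂` from the right. -/
theorem coeff_star_single_one (A : LaurentSeries R) (k n : ℤ) :
    (star d A (HahnSeries.single k 1)).coeff n = A.coeff (n - k) := by
  have h : ∀ i, dpowCoeff d i (HahnSeries.single k (1 : R)) n = if i = n - k then 1 else 0 := by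
    intro i
    unfold dpowCoeff
    rw [finsum_eq_single _ 0]
    · by_cases hi : i = n - k
      · subst hi; simp
      · rw [HahnSeries.coeff_single_of_ne (by push_cast; omega)]
        simp [hi]
    · intro r hr
      by_cases hi : n - i - r = k
      · rw [hi, HahnSeries.coeff_single_same, iterate_one_eq_zero d hr, smul_zero]
      · rw [HahnSeries.coeff_single_of_ne hi, iterate_zero', smul_zero]
  rw [coeff_star, finsum_eq_single _ (n - k)]
  · rw [h, if_pos rfl, mul_one]
  · intro i hi
    rw [h, if_neg hi, mul_zero]

theorem star_one (A : LaurentSeries R) : star d A 1 = A := by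
  ext n
  rw [show (1 : LaurentSeries R) = HahnSeries.single 0 1 from rfl, coeff_star_single_one, sub_zero]

/-- Multiplication by `∂` from the left. -/
noncomputable def leftD (A : LaurentSeries R) : LaurentSeries R :=
  A.map d + HahnSeries.single (-1) 1 * A

theorem coeff_leftD (A : LaurentSeries R) (n : ℤ) :
    (leftD d A).coeff n = d (A.coeff n) + A.coeff (n + 1) := by
  rw [leftD, HahnSeries.coeff_add, coeff_single_mul', sub_neg_eq_add]
  rfl

theorem leftD_add (A B : LaurentSeries R) : leftD d (A + B) = leftD d A + leftD d B := by
  ext n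
  simp only [coeff_leftD, HahnSeries.coeff_add, map_add]
  ring

theorem leftD_smul (f : R) (A : LaurentSeries R) :
    leftD d (f • A) = d f • A + f • leftD d A := by
  ext n
  simp only [coeff_leftD, HahnSeries.coeff_add, HahnSeries.coeff_smul, smul_eq_mul,
    Derivation.leibniz]
  ring

theorem leftD_single_one (k : ℤ) :
    leftD d (HahnSeries.single k 1) = HahnSeries.single (k - 1) 1 := by
  ext n
  rw [coeff_leftD]
  have h : ∀ m, d ((HahnSeries.single k (1 : R)).coeff m) = 0 := fun m => by
    rw [HahnSeries.coeff_single]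
    split_ifs <;> simp
  rw [h, zero_add]
  by_cases h' : n + 1 = k
  · subst h'; simp
  · rw [HahnSeries.coeff_single_of_ne h', HahnSeries.coeff_single_of_ne (by omega)]

/-- Pascal's rule in the form `d_dpowCoeff` gives this for each power of ∂; the summand z A of ∂A
only moves the summation index by one. This is associativity for the left factor ∂, and the general
case is generated from it. -/
theorem leftD_star (A B : LaurentSeries R) : leftD d (star d A B) = star d (leftD d A) B := by
  ext n
  have hz : (star d (HahnSeries.single (-1) 1 * A) B).coeff n =
      ∑ᶠ i, A.coeff i * dpowCoeff d (i - 1) B n := by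
    rw [coeff_star, ← finsum_comp_equiv (Equiv.subRight (1 : ℤ))]
    refine finsum_congr fun i => ?_
    simp [coeff_single_mul']
  have hfz : (fun i => A.coeff i * dpowCoeff d (i - 1) B n).HasFiniteSupport := by
    refine ((hasFiniteSupport_star d (HahnSeries.single (-1) 1 * A) B n).preimage
      (Equiv.subRight (1 : ℤ)).injective.injOn).subset fun i hi => ?_
    simpa [coeff_single_mul'] using hi
  have hf := hasFiniteSupport_star d A B n
  have hdf : (fun i => d (A.coeff i * dpowCoeff d i B n)).HasFiniteSupport :=
    hf.subset fun i hi h0 => hi (by simp only at h0 ⊢; rw [h0, map_zero])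
  rw [coeff_leftD, leftD, add_star, HahnSeries.coeff_add, hz, coeff_star, coeff_star, coeff_star,
    map_finsum d hf, ← finsum_add_distrib hdf (hasFiniteSupport_star d A B (n + 1)),
    ← finsum_add_distrib (hasFiniteSupport_star d (A.map d) B n) hfz]
  refine finsum_congr fun i => ?_
  rw [Derivation.leibniz, ← d_dpowCoeff]
  simp only [smul_eq_mul, coeff_map]
  ring

theorem leftD_eq_star (A : LaurentSeries R) :
    leftD d A = star d (HahnSeries.single (-1) 1) A := by
  have h : leftD d (1 : LaurentSeries R) = HahnSeries.single (-1) 1 := leftD_single_one d 0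
  rw [← h, ← leftD_star, one_star]

/-- The coefficients of ∂A are d Aₙ + Aₙ₊₁, so they determine A recursively upwards from an index
below which everything vanishes. -/
theorem leftD_injective : Function.Injective (leftD d) := by
  intro A B hAB
  obtain ⟨a, hA, hB⟩ := exists_vanish₂ A B
  ext n
  rcases lt_or_ge n a with hn | hn
  · rw [hA n hn, hB n hn]
  · have h : ∀ k : ℕ, A.coeff (a - 1 + k) = B.coeff (a - 1 + k) := by
      intro k
      induction k with
      | zero => rw [hA _ (by simp), hB _ (by simp)]
      | succ k ih =>
        have h := congrArg (fun X : LaurentSeries R => X.coeff (a - 1 + k)) hAB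
        simp only [coeff_leftD, ih] at h
        rw [Nat.cast_succ, ← add_assoc]
        exact add_left_cancel h
    have := h (n - (a - 1)).toNat
    rwa [Int.toNat_of_nonneg (by omega), add_sub_cancel] at this

/-- Left factors for which the product is associative. -/
def AssocLeft (A : LaurentSeries R) : Prop :=
  ∀ B C, star d (star d A B) C = star d A (star d B C)

theorem assocLeft_one : AssocLeft d 1 := fun B C => by rw [one_star, one_star]

theorem AssocLeft.smul {A : LaurentSeries R} (hA : AssocLeft d A) (f : R) : AssocLeft d (f • A) :=
  fun B C => by rw [smul_star, smul_star, smul_star, hA]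

/-- Injectivity of left multiplication by ∂ gives the converse direction, which carries
associativity from 1 to the negative powers of ∂ as well. -/
theorem assocLeft_leftD_iff {A : LaurentSeries R} : AssocLeft d (leftD d A) ↔ AssocLeft d A := by
  refine ⟨fun h B C => leftD_injective d ?_, fun h B C => ?_⟩
  · rw [leftD_star, leftD_star, leftD_star, h]
  · rw [← leftD_star, ← leftD_star, ← leftD_star, h]

theorem assocLeft_single_one (k : ℤ) : AssocLeft d (HahnSeries.single k 1) := by
  induction k using Int.induction_on with
  | zero => exact assocLeft_one d
  | succ k ih =>
    rw [← assocLeft_leftD_iff, leftD_single_one, add_sub_cancel_right]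
    exact ih
  | pred k ih => rwa [← leftD_single_one, assocLeft_leftD_iff]

theorem assocLeft_single (k : ℤ) (f : R) : AssocLeft d (HahnSeries.single k f) := by
  have := (assocLeft_single_one d k).smul d f
  have h : f • HahnSeries.single k (1 : R) = HahnSeries.single k f := by
    ext n
    by_cases hn : n = k
    · subst hn; simp
    · simp [HahnSeries.coeff_single_of_ne hn]
  rwa [h] at this

theorem assocLeft_sum {ι : Type*} (s : Finset ι) (A : ι → LaurentSeries R)
    (h : ∀ i, AssocLeft d (A i)) : AssocLeft d (∑ i ∈ s, A i) := fun B C => by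
  rw [sum_star, sum_star, sum_star]
  exact Finset.sum_congr rfl fun i _ => h i B C

/-- A fixed coefficient of either side involves only finitely many terms of `A`, and for these the
monomial case suffices. The cut at `n + 1 - b - c` pushes the contribution of the tail beyond order
`n`. -/
theorem star_assoc (A B C : LaurentSeries R) :
    star d (star d A B) C = star d A (star d B C) := by
  ext n
  obtain ⟨b, hB⟩ := exists_vanish B
  obtain ⟨c, hC⟩ := exists_vanish C
  obtain ⟨s, A', hA', hA⟩ := exists_eq_sum_add A (n + 1 - b - c)
  rw [hA, add_star, add_star, add_star, assocLeft_sum d s _ fun i => assocLeft_single d i _,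
    HahnSeries.coeff_add, HahnSeries.coeff_add, ((hA'.star d hB).star d hC) n (by omega),
    (hA'.star d (hB.star d hC)) n (by omega)]

theorem star_single_one (A : LaurentSeries R) (k : ℤ) :
    star d A (HahnSeries.single k 1) = HahnSeries.single k 1 * A := by
  ext n
  rw [coeff_star_single_one, coeff_single_mul']

theorem star_left_cancel {A X Y Z : LaurentSeries R} (hX : star d X A = 1)
    (h : star d A Y = star d A Z) : Y = Z := by
  rw [← one_star d Y, ← one_star d Z, ← hX, star_assoc, star_assoc, h]

theorem iterate_leftD_eq_star (n : ℕ) (A : LaurentSeries R) :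
    (leftD d)^[n] A = star d (HahnSeries.single (-(n : ℤ)) 1) A := by
  induction n with
  | zero =>
    rw [Function.iterate_zero, id, Nat.cast_zero, neg_zero]
    exact (one_star d A).symm
  | succ n ih =>
    rw [Function.iterate_succ_apply', ih, leftD_star, leftD_single_one, Nat.cast_succ, neg_add']

/-- From P A = A ∂ follows P^k A = A ∂^k, and right composition with ∂^k is plain multiplication by
z^k. The sequence `Q` stands for the powers of P, which are formed in the two-variable algebra. -/
theorem star_pow_of_star_eq {P A : LaurentSeries R}
    (h : star d P A = star d A (HahnSeries.single (-1) 1)) {Q : ℕ → LaurentSeries R}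
    (hQ0 : Q 0 = 1) (hQ : ∀ k, Q (k + 1) = star d (Q k) P) (k : ℕ) :
    star d (Q k) A = HahnSeries.single (-(k : ℤ)) 1 * A := by
  induction k with
  | zero =>
    rw [hQ0, one_star, Nat.cast_zero, neg_zero, show HahnSeries.single (0 : ℤ) (1 : R) = 1 from rfl,
      one_mul]
  | succ k ih =>
    rw [hQ, star_assoc, h, ← star_assoc, ih, star_single_one, ← mul_assoc,
      HahnSeries.single_mul_single, one_mul, Nat.cast_succ, neg_add_rev]

theorem map_dpowCoeff {e : Derivation ℂ R R} (he : ∀ x, e (d x) = d (e x)) (i n : ℤ)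
    (B : LaurentSeries R) : e (dpowCoeff d i B n) = dpowCoeff d i (B.map e) n := by
  obtain ⟨b, hB⟩ := exists_vanish B
  have hB' : Vanish b (B.map e) := fun n hn => by
    rw [coeff_map, hB n hn, map_zero]
  have hM : n - i - ((n - i - b + 1).toNat : ℕ) < b := by omega
  rw [dpowCoeff_eq_sum d hB i n hM, dpowCoeff_eq_sum d hB' i n hM, map_sum]
  refine Finset.sum_congr rfl fun r _ => ?_
  rw [map_zsmul, coeff_map]
  congr 1
  exact (Function.Commute.iterate_right (f := e) (g := d) he r) _

/-- A coefficientwise derivation is a derivation of the product. -/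
theorem map_star {e : Derivation ℂ R R} (he : ∀ x, e (d x) = d (e x)) (A B : LaurentSeries R) :
    (star d A B).map e = star d (A.map e) B + star d A (B.map e) := by
  ext n
  rw [coeff_map, HahnSeries.coeff_add, coeff_star, coeff_star, coeff_star,
    map_finsum e (hasFiniteSupport_star d A B n),
    ← finsum_add_distrib (hasFiniteSupport_star d (A.map e) B n)
      (hasFiniteSupport_star d A (B.map e) n)]
  refine finsum_congr fun i => ?_
  rw [Derivation.leibniz, map_dpowCoeff d he, coeff_map]
  simp only [smul_eq_mul]
  ring

/-- Approximations of a right inverse of `A`, where `c` is the inverse of the leading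
coefficient. -/
noncomputable def approxInv (A : LaurentSeries R) (c : R) : ℕ → LaurentSeries R
  | 0 => 0
  | N + 1 => approxInv A c N + HahnSeries.single (N : ℤ)
      (c * ((1 : LaurentSeries R).coeff N - (star d A (approxInv A c N)).coeff N))

theorem vanish_approxInv (A : LaurentSeries R) (c : R) (N : ℕ) :
    Vanish 0 (approxInv d A c N) := by
  induction N with
  | zero => exact fun _ _ => rfl
  | succ N ih => exact ih.add ((vanish_single _ _).mono (by omega))

theorem coeff_approxInv_stable (A : LaurentSeries R) (c : R) {N M : ℕ} (h : N ≤ M) {n : ℤ}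
    (hn : n < N) : (approxInv d A c M).coeff n = (approxInv d A c N).coeff n := by
  induction M, h using Nat.le_induction with
  | base => rfl
  | succ M hM ih =>
    have : (N : ℤ) ≤ M := by exact_mod_cast hM
    rw [approxInv, HahnSeries.coeff_add, HahnSeries.coeff_single_of_ne (by omega), add_zero, ih]

theorem coeff_star_approxInv {A : LaurentSeries R} (hA : Vanish 0 A) {c : R}
    (hc : A.coeff 0 * c = 1) (N : ℕ) {n : ℤ} (hn : n < N) :
    (star d A (approxInv d A c N)).coeff n = (1 : LaurentSeries R).coeff n := by
  induction N with
  | zero =>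
    rw [approxInv, star_zero, show (1 : LaurentSeries R) = HahnSeries.single 0 1 from rfl,
      HahnSeries.coeff_single_of_ne (by simp at hn; omega)]
    rfl
  | succ N ih =>
    rw [approxInv, star_add, HahnSeries.coeff_add]
    rcases lt_or_eq_of_le (show n ≤ N by push_cast at hn; omega) with h | h
    · rw [ih h, (hA.star d (vanish_single (N : ℤ) _)) n (by omega), add_zero]
    · have := coeff_star_add d hA (vanish_single (N : ℤ)
        (c * ((1 : LaurentSeries R).coeff N - (star d A (approxInv d A c N)).coeff N)))
      rw [zero_add, HahnSeries.coeff_single_same, ← mul_assoc, hc, one_mul] at this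
      rw [h, this]
      ring

/-- A series of order `0` with invertible leading coefficient has a right inverse. -/
theorem exists_right_inv {A : LaurentSeries R} (hA : Vanish 0 A) {c : R}
    (hc : A.coeff 0 * c = 1) :
    ∃ X, Vanish 0 X ∧ X.coeff 0 = c ∧ star d A X = 1 := by
  let X : LaurentSeries R := mkLaurent (fun n => (approxInv d A c (n + 1).toNat).coeff n)
    ⟨0, fun n hn => vanish_approxInv d A c _ n hn⟩
  have hX : Vanish 0 X := fun n hn => vanish_approxInv d A c _ n hn
  have hd : ∀ N : ℕ, Vanish N (X - approxInv d A c N) := by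
    intro N n hn
    rw [HahnSeries.coeff_sub, coeff_mkLaurent]
    rcases lt_or_ge n 0 with h | h
    · rw [vanish_approxInv d A c _ n h, vanish_approxInv d A c _ n h, sub_zero]
    · rw [← coeff_approxInv_stable d A c (N := (n + 1).toNat) (M := N) (by omega) (by omega),
        sub_self]
  have hinv : star d A X = 1 := by
    ext n
    -- `X` and its approximation with index `n + 1` differ only from order `n + 1` on, so replacing
    -- one by the other does not change coefficient `n` of the product.
    have h := (hA.star d (hd (n + 1).toNat)) n (by omega)
    rw [star_sub, HahnSeries.coeff_sub, sub_eq_zero] at h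
    rw [h, coeff_star_approxInv d hA hc _ (by omega)]
  refine ⟨X, hX, ?_, hinv⟩
  have h := coeff_star_add d hA hX
  rw [hinv, add_zero, show (1 : LaurentSeries R) = HahnSeries.single 0 1 from rfl,
    HahnSeries.coeff_single_same] at h
  calc X.coeff 0 = (A.coeff 0 * c) * X.coeff 0 := by rw [hc, one_mul]
    _ = c * (A.coeff 0 * X.coeff 0) := by ring
    _ = c := by rw [← h, mul_one]

/-- A series of order `0` with invertible leading coefficient is invertible. -/
theorem exists_inv {A : LaurentSeries R} (hA : Vanish 0 A) {c : R} (hc : A.coeff 0 * c = 1) :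
    ∃ X, Vanish 0 X ∧ X.coeff 0 = c ∧ star d A X = 1 ∧ star d X A = 1 := by
  obtain ⟨X, hX, hX0, hAX⟩ := exists_right_inv d hA hc
  obtain ⟨Y, -, -, hXY⟩ := exists_right_inv d hX (c := A.coeff 0) (by rw [hX0, mul_comm, hc])
  -- `X` has the left inverse `A` and the right inverse `Y`, so these agree.
  have : A = Y := by rw [← star_one d A, ← hXY, ← star_assoc, hAX, one_star]
  exact ⟨X, hX, hX0, hAX, this ▸ hXY⟩

/-- The series `B` with `B(z) e^{-xz} = (B₀)^* e^{-xz}` for the operator `B₀` of the series. -/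
noncomputable def adj (B : LaurentSeries R) : LaurentSeries R :=
  mkLaurent (fun n => dpowCoeff d (1 - n) B 1) (by
    obtain ⟨b, hB⟩ := exists_vanish B
    exact ⟨b, fun n hn => dpowCoeff_eq_zero d hB (by omega)⟩)

theorem coeff_adj (B : LaurentSeries R) (n : ℤ) : (adj d B).coeff n = dpowCoeff d (1 - n) B 1 := rfl

theorem Vanish.adj {b : ℤ} {B : LaurentSeries R} (hB : Vanish b B) : Vanish b (adj d B) :=
  fun n hn => dpowCoeff_eq_zero d hB (by omega)

theorem coeff_adj_of_vanish {b : ℤ} {B : LaurentSeries R} (hB : Vanish b B) :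
    (KPmKP.adj d B).coeff b = B.coeff b := by
  rw [coeff_adj, dpowCoeff_eq_sum d hB _ _ (M := 1) (by push_cast; omega), Finset.sum_range_one]
  simp

/-- The residue of a product of operators in terms of their actions on exponentials. -/
theorem coeff_mul_adj (A B : LaurentSeries R) :
    (A * adj d B).coeff 0 = (star d (star d A (HahnSeries.single 1 1)) B).coeff 1 := by
  obtain ⟨a, hA⟩ := exists_vanish A
  obtain ⟨b, hB⟩ := exists_vanish B
  -- Index 1 of a composition is the coefficient of ∂⁻¹, the operator residue. The factor ∂⁻¹
  -- between the two operators accounts for the shift of the index by one.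
  rw [coeff_mul_eq_sum hA (hB.adj d), coeff_star, ← finsum_comp_equiv (Equiv.addRight (1 : ℤ))]
  refine (finsum_eq_sum_of_support_subset _ ?_).symm.trans (finsum_congr fun i => ?_)
  · intro i hi
    by_contra h
    refine hi ?_
    simp only [Finset.coe_Icc, Set.mem_Icc, not_and_or, not_le] at h
    rcases h with h | h
    · simp only; rw [hA i h, zero_mul]
    · simp only; rw [(hB.adj d) _ (by omega), mul_zero]
  · rw [Equiv.coe_addRight, coeff_star_single_one, coeff_adj, add_sub_cancel_right]
    ring_nf

attribute [irreducible] star adj dpowCoeff mkLaurent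

end Star


noncomputable local instance SmoothFn.instCommRing {U : TimeDomain} : CommRing (SmoothFn U) :=
  inferInstance

noncomputable local instance SmoothFn.instAddCommGroup {U : TimeDomain} :
    AddCommGroup (SmoothFn U) := inferInstance

noncomputable local instance SmoothFn.instAddGroup {U : TimeDomain} : AddGroup (SmoothFn U) :=
  inferInstance

noncomputable local instance SmoothFn.instSubtractionMonoid {U : TimeDomain} :
    SubtractionMonoid (SmoothFn U) := inferInstance

noncomputable local instance SmoothFn.instAddMonoid {U : TimeDomain} : AddMonoid (SmoothFn U) :=
  inferInstance

noncomputable local instance SmoothFn.instAddZeroClass {U : TimeDomain} :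
    AddZeroClass (SmoothFn U) := inferInstance

noncomputable local instance SmoothFn.instAlgebra {U : TimeDomain} : Algebra ℂ (SmoothFn U) :=
  inferInstance

section Derivations

variable {U : TimeDomain}

/-- Derivations of an algebra over the complex numbers. -/
abbrev Der (R : Type*) [CommRing R] [Algebra ℂ R] := Derivation ℂ R R

/-- The derivation `∂/∂t_i`. -/
noncomputable def tD (i : TimeIndex) : Der (SmoothFn U) := pd i

theorem tD_apply (i : TimeIndex) (f : SmoothFn U) : tD i f = pd i f := rfl

theorem coe_tD (i : TimeIndex) : (tD i : SmoothFn U → SmoothFn U) = pd i := rfl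

theorem tD_comm (i j : TimeIndex) (f : SmoothFn U) : tD i (tD j f) = tD j (tD i f) :=
  pd_comm i j f

end Derivations

/-! ### Operators of the two-variable algebra through one-variable series -/

namespace PsiDO

variable {U : TimeDomain}

/-- The coefficient of `∂_ν^n ∂_{ν'}^c`, where `ν'` is the index different from `ν`. -/
noncomputable def cf (ν : Fin 2) (A : PsiDO U) (n c : ℤ) : SmoothFn U :=
  if ν = 0 then A.coeff n c else A.coeff c n

theorem cf_zero (A : PsiDO U) (n c : ℤ) : A.cf 0 n c = A.coeff n c := rfl

theorem cf_one (A : PsiDO U) (n c : ℤ) : A.cf 1 n c = A.coeff c n := rfl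

theorem cf_bounded (ν : Fin 2) (A : PsiDO U) :
    ∃ m : ℤ, ∀ n c, m < n ∨ m < c → A.cf ν n c = 0 := by
  obtain ⟨p, q, h⟩ := A.bounded
  refine ⟨max p q, fun n c hnc => ?_⟩
  have h1 := le_max_left p q
  have h2 := le_max_right p q
  fin_cases ν
  · exact h _ _ (by omega)
  · exact h _ _ (by omega)

theorem ext_cf (ν : Fin 2) {A B : PsiDO U} (h : ∀ n c, A.cf ν n c = B.cf ν n c) : A = B := by
  ext i j : 3
  fin_cases ν
  · exact h i j
  · exact h j i

theorem cf_other (ν : Fin 2) (A : PsiDO U) (n c : ℤ) : A.cf (1 - ν) n c = A.cf ν c n := by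
  fin_cases ν <;> rfl

theorem axis_eq_cf (ν : Fin 2) (A : PsiDO U) (n : ℤ) : A.axis ν n = A.cf ν n 0 := by
  fin_cases ν <;> rfl

/-- The series of the coefficients at the powers `∂_ν^n ∂_{ν'}^c` with fixed `c`. -/
noncomputable def col (ν : Fin 2) (c : ℤ) (A : PsiDO U) : LaurentSeries (SmoothFn U) :=
  mkLaurent (fun n => A.cf ν (-n) c) (by
    obtain ⟨m, h⟩ := cf_bounded ν A
    exact ⟨-m, fun n hn => h _ _ (by omega)⟩)

theorem coeff_col (ν : Fin 2) (c : ℤ) (A : PsiDO U) (n : ℤ) :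
    (A.col ν c).coeff n = A.cf ν (-n) c := by
  rw [col, coeff_mkLaurent]

attribute [irreducible] col

theorem cf_eq_coeff_col (ν : Fin 2) (c : ℤ) (A : PsiDO U) (n : ℤ) :
    A.cf ν n c = (A.col ν c).coeff (-n) := by rw [coeff_col, neg_neg]

theorem ext_col (ν : Fin 2) {A B : PsiDO U} (h : ∀ c, A.col ν c = B.col ν c) : A = B :=
  ext_cf ν fun n c => by rw [cf_eq_coeff_col, cf_eq_coeff_col, h]

/-- The coefficients of a product. -/
theorem cf_mul (ν : Fin 2) (A B : PsiDO U) (a b : ℤ) :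
    (A * B).cf ν a b = ∑ᶠ x : (ℤ × ℤ) × (ℕ × ℕ),
      (Ring.choose x.1.1 x.2.1 * Ring.choose x.1.2 x.2.2) •
        (A.cf ν x.1.1 x.1.2 * (dd ν)^[x.2.1] ((dd (1 - ν))^[x.2.2]
          (B.cf ν (a + x.2.1 - x.1.1) (b + x.2.2 - x.1.2)))) := by
  fin_cases ν
  · rfl
  · change ∑ᶠ x : (ℤ × ℤ) × (ℕ × ℕ), _ = _
    rw [← finsum_comp_equiv ((Equiv.prodComm ℤ ℤ).prodCongr (Equiv.prodComm ℕ ℕ))]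
    refine finsum_congr fun x => ?_
    rw [mul_comm (Ring.choose _ _)]
    congr 2
    have hc : Function.Commute (dd 0 : SmoothFn U → SmoothFn U) (dd 1) := fun f => pd_comm _ _ f
    exact (hc.iterate_left x.2.2).iterate_right x.2.1 _

theorem hasFiniteSupport_mul (ν : Fin 2) (A B : PsiDO U) (a b : ℤ) :
    (fun x : (ℤ × ℤ) × (ℕ × ℕ) => (Ring.choose x.1.1 x.2.1 * Ring.choose x.1.2 x.2.2) •
        (A.cf ν x.1.1 x.1.2 * (dd ν)^[x.2.1] ((dd (1 - ν))^[x.2.2]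
          (B.cf ν (a + x.2.1 - x.1.1) (b + x.2.2 - x.1.2))))).HasFiniteSupport := by
  obtain ⟨m, hA⟩ := cf_bounded ν A
  obtain ⟨p, hB⟩ := cf_bounded ν B
  refine Set.Finite.subset (Finset.finite_toSet
    ((Finset.Icc (a - p) m ×ˢ Finset.Icc (b - p) m) ×ˢ
      (Finset.range (m + p - a + 1).toNat ×ˢ Finset.range (m + p - b + 1).toNat))) ?_
  rintro ⟨⟨i, j⟩, ⟨r, s⟩⟩ hx
  have h1 : ¬ (m < i ∨ m < j) := fun h => hx (by simp only [hA i j h, zero_mul, smul_zero])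
  have h2 : ¬ (p < a + r - i ∨ p < b + s - j) := fun h => hx (by
    simp only [hB _ _ h, iterate_map_zero, mul_zero, smul_zero])
  simp only [Finset.coe_product, Set.mem_prod, Finset.mem_coe, Finset.mem_Icc, Finset.mem_range]
  omega

/-- Serves products whose left factor contains the single power ∂_{ν'}^j with j = 0 or 1: the
binomial C(j, s) then leaves only s = 0 and s = 1. -/
theorem finsum_eq_add_of_eq_zero {M : Type*} [AddCommMonoid M]
    (f : (ℤ × ℤ) × (ℕ × ℕ) → M) (hf : f.HasFiniteSupport) (j : ℤ)
    (h : ∀ i c r s, c ≠ j ∨ 2 ≤ s → f ((i, c), (r, s)) = 0) :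
    ∑ᶠ x, f x = ∑ᶠ y : ℤ × ℕ, f ((y.1, j), (y.2, 0)) +
      ∑ᶠ y : ℤ × ℕ, f ((y.1, j), (y.2, 1)) := by
  let e : (ℤ × ℕ) × (ℤ × ℕ) ≃ (ℤ × ℤ) × (ℕ × ℕ) :=
    (Equiv.prodComm _ _).trans (Equiv.prodProdProdComm ℤ ℕ ℤ ℕ)
  have hfin : (fun x => f (e x)).HasFiniteSupport := hf.preimage e.injective.injOn
  rw [← finsum_comp_equiv e, finsum_curry _ hfin,
    finsum_eq_sum_of_support_subset (s := {(j, 0), (j, 1)}), Finset.sum_pair (by simp)]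
  · rfl
  · rintro ⟨c, s⟩ hx
    by_contra hcs
    refine hx (finsum_eq_zero_of_forall_eq_zero fun y => h y.1 c y.2 s ?_)
    by_contra hcs'
    push Not at hcs'
    have : s = 0 ∨ s = 1 := by omega
    rcases this with rfl | rfl <;> simp [hcs'.1] at hcs

/-- With the second variable frozen, the defining sum of the two-variable product is the
one-variable composition. The signs come from passing between powers of ∂ and powers of u. -/
theorem finsum_eq_coeff_star {R : Type*} [CommRing R] [Algebra ℂ R] (d : Derivation ℂ R R)
    (A B : LaurentSeries R) (n : ℤ) :
    ∑ᶠ y : ℤ × ℕ, Ring.choose y.1 y.2 • (A.coeff (-y.1) * d^[y.2] (B.coeff (-(-n + y.2 - y.1)))) =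
      (star d A B).coeff n := by
  obtain ⟨a, hA⟩ := exists_vanish A
  obtain ⟨b, hB⟩ := exists_vanish B
  have hz : ∀ y : ℤ × ℕ, y ∉ Finset.Icc (b - n) (-a) ×ˢ Finset.range (n - a - b + 1).toNat →
      A.coeff (-y.1) * d^[y.2] (B.coeff (-(-n + y.2 - y.1))) = 0 := by
    intro y hy
    simp only [Finset.mem_product, Finset.mem_Icc, Finset.mem_range] at hy
    by_cases h1 : -a < y.1
    · rw [hA _ (by omega), zero_mul]
    · rw [hB _ (by omega), iterate_map_zero, mul_zero]
  have hf : (fun y : ℤ × ℕ => Ring.choose y.1 y.2 •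
      (A.coeff (-y.1) * d^[y.2] (B.coeff (-(-n + y.2 - y.1))))).HasFiniteSupport := by
    refine Set.Finite.subset (Finset.finite_toSet
      (Finset.Icc (b - n) (-a) ×ˢ Finset.range (n - a - b + 1).toNat)) fun y hy => ?_
    by_contra h
    exact hy (by simp only; rw [hz y h, smul_zero])
  rw [finsum_curry _ hf, ← finsum_comp_equiv (Equiv.neg ℤ), coeff_star]
  refine finsum_congr fun i => ?_
  rw [dpowCoeff, mul_finsum']
  · refine finsum_congr fun r => ?_
    simp only [Equiv.neg_apply, neg_neg]
    rw [mul_smul_comm, show -(-n + (r : ℤ) - -i) = n - i - r by ring]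
  · refine Set.Finite.subset (Finset.finite_toSet (Finset.range (n - i - b + 1).toNat))
      fun r hr => ?_
    by_contra h
    simp only [Finset.coe_range, Set.mem_Iio] at h
    refine hr ?_
    simp only
    rw [hB _ (by omega), iterate_map_zero, smul_zero]

/-- The derivation ∂_{ν'} passes to the right through the coefficients of `B` by ∂_{ν'} B = B ∂_{ν'}
+ ∂_{ν'}⟨B⟩, and the second term is present only for j = 1. The products needed from the hierarchy
reduce to one-variable compositions in this way. -/
theorem coeff_mul_of_col {ν : Fin 2} {j : ℤ} (hj : j = 0 ∨ j = 1) {A : PsiDO U}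
    (hA : ∀ n c, c ≠ j → A.cf ν n c = 0) (B : PsiDO U) (b n : ℤ) :
    ((A * B).col ν b).coeff n = (star (tD (ν, 1)) (A.col ν j) (B.col ν (b - j))).coeff n +
      j • (star (tD (ν, 1)) (A.col ν j) ((B.col ν (b + 1 - j)).map (tD (1 - ν, 1)))).coeff n := by
  have e0 := finsum_eq_coeff_star (tD (ν, 1)) (A.col ν j) (B.col ν (b - j)) n
  have e1 := finsum_eq_coeff_star (tD (ν, 1)) (A.col ν j) ((B.col ν (b + 1 - j)).map (tD (1 - ν, 1))) n
  rw [← e0, ← e1, coeff_col, cf_mul,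
    finsum_eq_add_of_eq_zero _ (hasFiniteSupport_mul ν A B (-n) b) j]
  · clear e0 e1
    simp only [coe_tD, tD_apply, Ring.choose_zero_right, mul_one, Ring.choose_one_right, Nat.cast_zero, add_zero,
      Nat.cast_one, Function.iterate_one, Function.iterate_zero, id, coeff_map, coeff_col, neg_neg]
    rcases hj with rfl | rfl
    · have h0 : ∀ x : SmoothFn U, (0 : ℤ) • x = 0 := fun x => by simp only [zero_smul]
      have h1 : ∀ x : ℤ, x * 0 = 0 := mul_zero
      simp only [h1, h0, finsum_zero]
    · simp only [mul_one, one_smul]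
  · rintro i c r s (hc | hs)
    · simp only [hA i c hc, zero_mul, smul_zero]
    · by_cases hc : c = j
      · have : Ring.choose c s = 0 := by
          subst hc
          rcases hj with rfl | rfl
          · exact Ring.choose_zero_pos ℤ (by omega)
          · have := Ring.choose_natCast (R := ℤ) 1 s
            rw [Nat.cast_one] at this
            rw [this, Nat.choose_eq_zero_of_lt (by omega), Nat.cast_zero]
        have h0 : ∀ x : SmoothFn U, (0 : ℤ) • x = 0 := fun x => by simp only [zero_smul]
        have h1 : ∀ x : ℤ, x * 0 = 0 := mul_zero
        simp only [this, h1, h0]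
      · simp only [hA i c hc, zero_mul, smul_zero]

end PsiDO


/-! ### Operators on one axis: products, inverses, truncations and adjoints -/

namespace PsiDO

variable {U : TimeDomain}

/-- `A` contains powers of `∂_ν` only. -/
def OnAxis (ν : Fin 2) (A : PsiDO U) : Prop := ∀ n c, c ≠ 0 → A.cf ν n c = 0

theorem OnAxis.col_eq_zero {ν : Fin 2} {A : PsiDO U} (hA : A.OnAxis ν) {c : ℤ} (hc : c ≠ 0) :
    A.col ν c = 0 := by
  ext n
  rw [coeff_col, hA _ _ hc, HahnSeries.coeff_zero]

theorem onAxis_of_col {ν : Fin 2} {A : PsiDO U} (h : ∀ c, c ≠ 0 → A.col ν c = 0) :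
    A.OnAxis ν := fun n c hc => by
  rw [cf_eq_coeff_col, h c hc, HahnSeries.coeff_zero]

theorem col_mul {ν : Fin 2} {A : PsiDO U} (hA : A.OnAxis ν) (B : PsiDO U) (c : ℤ) :
    (A * B).col ν c = star (tD (ν, 1)) (A.col ν 0) (B.col ν c) := by
  ext n
  rw [coeff_mul_of_col (Or.inl rfl) hA, sub_zero, zero_smul, add_zero]

theorem col_mul_one {ν : Fin 2} {A : PsiDO U} (hA : ∀ n c, c ≠ 1 → A.cf ν n c = 0) (B : PsiDO U)
    (c : ℤ) : (A * B).col ν c = star (tD (ν, 1)) (A.col ν 1) (B.col ν (c - 1)) +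
      star (tD (ν, 1)) (A.col ν 1) ((B.col ν c).map (tD (1 - ν, 1))) := by
  ext n
  rw [coeff_mul_of_col (Or.inr rfl) hA, add_sub_cancel_right, one_smul, HahnSeries.coeff_add]

theorem OnAxis.mul {ν : Fin 2} {A B : PsiDO U} (hA : A.OnAxis ν) (hB : B.OnAxis ν) :
    (A * B).OnAxis ν := onAxis_of_col fun c hc => by
  rw [col_mul hA, hB.col_eq_zero hc, star_zero]

theorem ext_onAxis {ν : Fin 2} {A B : PsiDO U} (hA : A.OnAxis ν) (hB : B.OnAxis ν)
    (h : A.col ν 0 = B.col ν 0) : A = B := ext_col ν fun c => by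
  by_cases hc : c = 0
  · rw [hc, h]
  · rw [hA.col_eq_zero hc, hB.col_eq_zero hc]

theorem cf_dpow (ν : Fin 2) (k n c : ℤ) :
    (dpow ν k : PsiDO U).cf ν n c = if n = k ∧ c = 0 then 1 else 0 := by
  fin_cases ν
  · rfl
  · change (if c = 0 ∧ n = k then (1 : SmoothFn U) else 0) = _
    simp only [and_comm]

theorem cf_dpow_other (ν : Fin 2) (k n c : ℤ) :
    (dpow (1 - ν) k : PsiDO U).cf ν n c = if n = 0 ∧ c = k then 1 else 0 := by
  rw [← cf_other, cf_dpow]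
  simp only [and_comm]

theorem cf_ofFn (ν : Fin 2) (f : SmoothFn U) (n c : ℤ) :
    (ofFn f).cf ν n c = if n = 0 ∧ c = 0 then f else 0 := by
  fin_cases ν
  · rfl
  · change (if c = 0 ∧ n = 0 then f else 0) = _
    simp only [and_comm]

theorem onAxis_dpow (ν : Fin 2) (k : ℤ) : (dpow ν k : PsiDO U).OnAxis ν := fun n c hc => by
  rw [cf_dpow, if_neg fun h => hc h.2]

theorem onAxis_ofFn (ν : Fin 2) (f : SmoothFn U) : (ofFn f).OnAxis ν := fun n c hc => by
  rw [cf_ofFn, if_neg fun h => hc h.2]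

theorem onAxis_one (ν : Fin 2) : (1 : PsiDO U).OnAxis ν := onAxis_ofFn ν 1

theorem col_dpow (ν : Fin 2) (k : ℤ) :
    (dpow ν k : PsiDO U).col ν 0 = HahnSeries.single (-k) 1 := by
  ext n
  rw [coeff_col, cf_dpow, coeff_single_eq_ite]
  simp only [and_true, neg_eq_iff_eq_neg]

theorem col_ofFn (ν : Fin 2) (f : SmoothFn U) : (ofFn f).col ν 0 = HahnSeries.C f := by
  ext n
  rw [coeff_col, cf_ofFn, HahnSeries.C_apply, coeff_single_eq_ite]
  simp only [and_true, neg_eq_zero]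

theorem col_one (ν : Fin 2) : (1 : PsiDO U).col ν 0 = 1 := by
  rw [show (1 : PsiDO U) = ofFn 1 from rfl, col_ofFn, map_one]

/-- The operator in powers of `∂_ν` with a given series of coefficients. -/
noncomputable def ofCol (ν : Fin 2) (X : LaurentSeries (SmoothFn U)) : PsiDO U where
  coeff i j := if (if ν = 0 then j else i) = 0 then X.coeff (-(if ν = 0 then i else j)) else 0
  bounded := by
    obtain ⟨a, ha⟩ := exists_vanish X
    refine ⟨max (-a) 0, max (-a) 0, fun i j h => ?_⟩
    have h1 := le_max_left (-a) 0
    have h2 := le_max_right (-a) 0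
    fin_cases ν
    · refine ite_eq_right_iff.2 fun h0 => ha _ ?_
      simp only [Fin.zero_eta, if_true] at h0 ⊢
      omega
    · refine ite_eq_right_iff.2 fun h0 => ha _ ?_
      simp only [Fin.mk_one, one_ne_zero, if_false] at h0 ⊢
      omega

theorem cf_ofCol (ν : Fin 2) (X : LaurentSeries (SmoothFn U)) (n c : ℤ) :
    (ofCol ν X).cf ν n c = if c = 0 then X.coeff (-n) else 0 := by
  fin_cases ν <;> rfl

theorem onAxis_ofCol (ν : Fin 2) (X : LaurentSeries (SmoothFn U)) : (ofCol ν X).OnAxis ν :=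
  fun n c hc => by rw [cf_ofCol, if_neg hc]

theorem col_ofCol (ν : Fin 2) (X : LaurentSeries (SmoothFn U)) : (ofCol ν X).col ν 0 = X := by
  ext n
  rw [coeff_col, cf_ofCol, if_pos rfl, neg_neg]

theorem inv_of_exists {A : PsiDO U} (h : ∃ B : PsiDO U, A * B = 1 ∧ B * A = 1) :
    A⁻¹ = h.choose := dif_pos h

/-- The inverse of an operator in powers of `∂_ν`. -/
theorem inv_eq_ofCol {ν : Fin 2} {A : PsiDO U} (hA : A.OnAxis ν) {X : LaurentSeries (SmoothFn U)}
    (h1 : star (tD (ν, 1)) (A.col ν 0) X = 1) (h2 : star (tD (ν, 1)) X (A.col ν 0) = 1) :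
    A⁻¹ = ofCol ν X := by
  have hX := onAxis_ofCol ν X
  have hAX : A * ofCol ν X = 1 := ext_onAxis (hA.mul hX) (onAxis_one ν) (by
    rw [col_mul hA, col_ofCol, h1, col_one])
  have hXA : ofCol ν X * A = 1 := ext_onAxis (hX.mul hA) (onAxis_one ν) (by
    rw [col_mul hX, col_ofCol, h2, col_one])
  have hex : ∃ B : PsiDO U, A * B = 1 ∧ B * A = 1 := ⟨_, hAX, hXA⟩
  have hinv : A * A⁻¹ = 1 := by
    rw [inv_of_exists hex]
    exact hex.choose_spec.1
  -- The inverse is only a chosen witness, with no a priori support condition, so it is identified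
  -- column by column through left cancellation of `A`.
  refine ext_col ν fun c => star_left_cancel (tD (ν, 1)) h2 ?_
  rw [← col_mul hA, ← col_mul hA, hinv, hAX]

theorem OnAxis.pow {ν : Fin 2} {A : PsiDO U} (hA : A.OnAxis ν) (k : ℕ) : (A ^ k).OnAxis ν := by
  induction k with
  | zero => exact onAxis_one ν
  | succ k ih => exact ih.mul hA

theorem cf_dt (ν : Fin 2) (i : TimeIndex) (A : PsiDO U) (n c : ℤ) :
    (A.dt i).cf ν n c = pd i (A.cf ν n c) := by
  fin_cases ν <;> rfl

theorem col_dt (ν : Fin 2) (i : TimeIndex) (A : PsiDO U) (c : ℤ) :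
    (A.dt i).col ν c = (A.col ν c).map (tD i) := by
  ext n
  rw [coeff_col, cf_dt, coeff_map, coeff_col, tD_apply]

theorem cf_neg (ν : Fin 2) (A : PsiDO U) (n c : ℤ) : (-A).cf ν n c = -A.cf ν n c := by
  fin_cases ν <;> rfl

theorem cf_truncGE (ν : Fin 2) (m : ℤ) (A : PsiDO U) (n c : ℤ) :
    (A.truncGE ν m).cf ν n c = if m ≤ n then A.cf ν n c else 0 := by
  fin_cases ν <;> rfl

theorem cf_truncLT (ν : Fin 2) (m : ℤ) (A : PsiDO U) (n c : ℤ) :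
    (A.truncLT ν m).cf ν n c = if n < m then A.cf ν n c else 0 := by
  fin_cases ν <;> rfl

theorem col_neg (ν : Fin 2) (A : PsiDO U) (c : ℤ) : (-A).col ν c = -A.col ν c := by
  ext n
  rw [coeff_col, cf_neg, HahnSeries.coeff_neg, coeff_col]

theorem OnAxis.neg {ν : Fin 2} {A : PsiDO U} (hA : A.OnAxis ν) : (-A).OnAxis ν :=
  fun n c hc => by rw [cf_neg, hA n c hc, neg_zero]

theorem OnAxis.truncLT {ν : Fin 2} {A : PsiDO U} (hA : A.OnAxis ν) (m : ℤ) :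
    (A.truncLT ν m).OnAxis ν :=
  fun n c hc => by rw [cf_truncLT, hA n c hc, ite_self]

/-- The part of a series with nonnegative powers of `∂` is a finite sum. -/
theorem exists_truncGE_eq_sum (ν : Fin 2) (m : ℕ) (A : PsiDO U) :
    ∃ (M : ℕ) (b : ℕ → SmoothFn U), (∀ n < m, b n = 0) ∧
      (∀ n : ℕ, b n = (A.truncGE ν m).cf ν n 0) ∧ (∀ n, M ≤ n → b n = 0) ∧
      A.col ν 0 = (A.truncLT ν m).col ν 0 +
        ∑ n ∈ Finset.range M, b n • HahnSeries.single (-(n : ℤ)) 1 := by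
  obtain ⟨p, hp⟩ := cf_bounded ν (A.truncGE ν m)
  have hM : ∀ n : ℕ, (p + 1).toNat ≤ n → (A.truncGE ν m).cf ν n 0 = 0 := fun n hn =>
    hp _ _ (Or.inl (by omega))
  refine ⟨(p + 1).toNat, fun n => (A.truncGE ν m).cf ν n 0, fun n hn => ?_, fun _ => rfl, hM, ?_⟩
  · simp only
    rw [cf_truncGE, if_neg (by omega)]
  · ext n
    rw [HahnSeries.coeff_add, coeff_col, coeff_col, cf_truncLT, HahnSeries.coeff_sum]
    simp only [HahnSeries.coeff_smul, smul_eq_mul, coeff_single_eq_ite]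
    rcases lt_or_ge (-n) m with h | h
    · rw [if_pos h, Finset.sum_eq_zero, add_zero]
      intro k _
      by_cases hk : n = -k
      · rw [cf_truncGE, if_neg (by omega), zero_mul]
      · rw [if_neg hk, mul_zero]
    · obtain ⟨k, hk⟩ : ∃ k : ℕ, -n = k := ⟨(-n).toNat, by omega⟩
      have hn : n = -(k : ℤ) := by omega
      rw [if_neg (by omega), zero_add]
      by_cases hkM : k < (p + 1).toNat
      · rw [Finset.sum_eq_single_of_mem k (Finset.mem_range.2 hkM), if_pos hn, mul_one, hk,
          cf_truncGE, if_pos (by omega)]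
        intro l _ hl
        rw [if_neg (by omega), mul_zero]
      · rw [Finset.sum_eq_zero]
        · have := hM k (by omega)
          rw [cf_truncGE, if_pos (by omega)] at this
          rw [hk, this]
        · intro l hl
          have := Finset.mem_range.1 hl
          rw [if_neg (by omega), mul_zero]

/-- The flow of the dressing operator `A` of `P = A ∂_ν A⁻¹` in its own times, through the action
on exponentials. -/
theorem flow_same {ν : Fin 2} {i : TimeIndex} {m k : ℕ} {A P : PsiDO U}
    (hP : P.OnAxis ν)
    (hPA : star (tD (ν, 1)) (P.col ν 0) (A.col ν 0) =
      star (tD (ν, 1)) (A.col ν 0) (HahnSeries.single (-1) 1))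
    (hflow : A.dt i = -(P ^ k).truncLT ν m * A) {M : ℕ} {b : ℕ → SmoothFn U}
    (hb : (P ^ k).col ν 0 = ((P ^ k).truncLT ν m).col ν 0 +
        ∑ n ∈ Finset.range M, b n • HahnSeries.single (-(n : ℤ)) 1) :
    (A.col ν 0).map (tD i) + HahnSeries.single (-(k : ℤ)) 1 * A.col ν 0 =
      ∑ n ∈ Finset.range M, b n • (leftD (tD (ν, 1)))^[n] (A.col ν 0) := by
  have hpow := star_pow_of_star_eq (tD (ν, 1)) hPA (Q := fun k => (P ^ k).col ν 0) (col_one ν)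
    (fun k => col_mul (hP.pow k) P 0) k
  -- The term z^k A equals P^k A, so adding it to -(P^k)_{<m} A leaves the differential part
  -- (P^k)_{≥m} A.
  rw [← hpow, ← col_dt, hflow, col_mul ((hP.pow k).truncLT m).neg, col_neg, neg_star, hb,
    add_star, neg_add_cancel_left, sum_star]
  refine Finset.sum_congr rfl fun n _ => ?_
  rw [smul_star, iterate_leftD_eq_star]

/-- The action of a differential operator on the coefficients. -/
theorem col_act (ν : Fin 2) {D : PsiDO U} (hD : D.OnAxis ν) {M : ℕ} {b : ℕ → SmoothFn U}
    (hb : ∀ n : ℕ, b n = D.cf ν n 0) (hM : ∀ n, M ≤ n → b n = 0) (A : PsiDO U) (μ : Fin 2)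
    (c n : ℤ) : ((D.act A).col μ c).coeff n =
      ∑ k ∈ Finset.range M, b k * (dd ν)^[k] ((A.col μ c).coeff n) := by
  have key : ∀ i j, (D.act A).coeff i j =
      ∑ k ∈ Finset.range M, b k * (dd ν)^[k] (A.coeff i j) := by
    intro i j
    change ∑ᶠ x : ℕ × ℕ, D.coeff x.1 x.2 * (dd 0)^[x.1] ((dd 1)^[x.2] (A.coeff i j)) = _
    fin_cases ν
    · rw [finsum_eq_sum_of_support_subset
        (s := (Finset.range M).map ⟨fun k => (k, 0), fun _ _ h => congrArg Prod.fst h⟩)]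
      · rw [Finset.sum_map]
        exact Finset.sum_congr rfl fun k _ => by rw [hb]; rfl
      · rintro ⟨r, s⟩ hx
        by_contra h
        refine hx ?_
        have : D.coeff r s = 0 := by
          by_cases hs : s = 0
          · subst hs
            refine (hb r).symm.trans (hM r ?_)
            by_contra hr
            exact h (Finset.mem_map.2 ⟨r, Finset.mem_range.2 (not_le.1 hr), rfl⟩)
          · exact hD r s (by exact_mod_cast hs)
        simp only
        rw [this, zero_mul]
    · rw [finsum_eq_sum_of_support_subset
        (s := (Finset.range M).map ⟨fun k => (0, k), fun _ _ h => congrArg Prod.snd h⟩)]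
      · rw [Finset.sum_map]
        exact Finset.sum_congr rfl fun k _ => by rw [hb]; rfl
      · rintro ⟨r, s⟩ hx
        by_contra h
        refine hx ?_
        have : D.coeff r s = 0 := by
          by_cases hs : r = 0
          · subst hs
            refine (hb s).symm.trans (hM s ?_)
            by_contra hr
            exact h (Finset.mem_map.2 ⟨s, Finset.mem_range.2 (not_le.1 hr), rfl⟩)
          · exact hD s r (by exact_mod_cast hs)
        simp only
        rw [this, zero_mul]
  rw [coeff_col, coeff_col]
  fin_cases μ
  · exact key _ _
  · exact key _ _

theorem amp_onExp (ν : Fin 2) (A : PsiDO U) : (A.onExp ν 1).amp = A.col ν 0 := by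
  refine HahnSeries.ext (funext fun n => ?_)
  change (((1 : ℤˣ) ^ (-n) : ℤˣ) : ℤ) • A.axis ν (-n) = _
  rw [coeff_col, one_zpow, Units.val_one, one_smul, axis_eq_cf]

theorem cf_adjoint (ν : Fin 2) (A : PsiDO U) (a b : ℤ) :
    A.adjoint.cf ν a b = ∑ᶠ x : ℕ × ℕ, (((a + x.1 + (b + x.2)).negOnePow : ℤ) *
      (Ring.choose (a + x.1) x.1 * Ring.choose (b + x.2) x.2)) •
        (dd ν)^[x.1] ((dd (1 - ν))^[x.2] (A.cf ν (a + x.1) (b + x.2))) := by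
  fin_cases ν
  · rfl
  · change ∑ᶠ x : ℕ × ℕ, _ = _
    rw [← finsum_comp_equiv (Equiv.prodComm ℕ ℕ)]
    refine finsum_congr fun x => ?_
    rw [mul_comm (Ring.choose _ _), add_comm (b + _)]
    have hc : Function.Commute (dd 0 : SmoothFn U → SmoothFn U) (dd 1) := fun f => pd_comm _ _ f
    exact congrArg _ ((hc.iterate_left x.2).iterate_right x.1 _)

/-- Upper negation (-1)^r C(r - n, r) = C(n - 1, r). It absorbs the signs of the formal adjoint and
of the powers of -z, leaving the binomials of `dpowCoeff`. -/
theorem negOnePow_mul_choose (n : ℤ) (r : ℕ) :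
    ((-n).negOnePow : ℤ) * (((-n + r).negOnePow : ℤ) * Ring.choose (-n + r) r) =
      Ring.choose (n - 1) r := by
  have h := Ring.choose_neg (1 - n) r
  rw [neg_sub, show (1 - n + r - 1 : ℤ) = -n + r by ring] at h
  rw [h, ← mul_assoc, Int.negOnePow_add, Units.smul_def, smul_eq_mul]
  congr 1
  rw [Units.val_mul, ← mul_assoc, ← Units.val_mul, ← Int.negOnePow_add, ← two_mul,
    Int.negOnePow_two_mul, Units.val_one, one_mul]

theorem finsum_prod_eq {M : Type*} [AddCommMonoid M] (f : ℕ × ℕ → M)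
    (hf : ∀ r s, s ≠ 0 → f (r, s) = 0) : ∑ᶠ x, f x = ∑ᶠ r, f (r, 0) := by
  classical
  have hinj : Function.Injective fun r : ℕ => (r, 0) := fun _ _ h => congrArg Prod.fst h
  rw [← finsum_mem_range (f := f) hinj]
  refine finsum_congr fun x => (finsum_eq_if.trans ?_).symm
  refine ite_eq_left_iff.2 fun hx => (hf x.1 x.2 fun h => hx ⟨x.1, by rw [← h]⟩).symm

/-- The adjoint of an operator on one axis, acting on `e^{-ξ}`. -/
theorem amp_adjoint_onExp (ν : Fin 2) {A : PsiDO U} (hA : A.OnAxis ν) :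
    (A.adjoint.onExp ν (-1)).amp = adj (tD (ν, 1)) (A.col ν 0) := by
  refine HahnSeries.ext (funext fun n => ?_)
  change (((-1 : ℤˣ) ^ (-n) : ℤˣ) : ℤ) • A.adjoint.axis ν (-n) = _
  rw [coeff_adj, axis_eq_cf, cf_adjoint, finsum_prod_eq]
  · simp only [Nat.cast_zero, add_zero, Ring.choose_zero_right, mul_one, Function.iterate_zero, id]
    rw [dpowCoeff, smul_finsum']
    · refine finsum_congr fun r => ?_
      rw [smul_smul, ← Int.negOnePow_def, negOnePow_mul_choose, coeff_col, neg_sub]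
      have h : -(1 - (1 - n) - r) = -n + (r : ℤ) := by ring
      rw [h, coe_tD]
    · obtain ⟨m, hm⟩ := cf_bounded ν A
      refine Set.Finite.subset (Finset.finite_toSet (Finset.range (m + n + 1).toNat))
        fun r hr => ?_
      by_contra h
      simp only [Finset.coe_range, Set.mem_Iio] at h
      refine hr ?_
      simp only
      rw [hm _ _ (by omega), iterate_map_zero, smul_zero]
  · intro r s hs
    rw [hA _ _ (by omega), iterate_map_zero, iterate_map_zero, smul_zero]

end PsiDO


/-! ### Wave functions -/

section Wave

variable {R : Type*} [CommRing R] [Algebra ℂ R]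

/-- The derivative `∂/∂t_i` of `(W₁ e^{ξ(t₁; z)}, W₂ e^{ξ(t₂; z)})`, in terms of the amplitudes. -/
noncomputable def waveD (D : TimeIndex → Derivation ℂ R R) (i : TimeIndex)
    (W : Fin 2 → LaurentSeries R) : Fin 2 → LaurentSeries R :=
  fun μ => (W μ).map (D i) +
    if i.1 = μ then HahnSeries.single (-((i.2 : ℕ) : ℤ)) 1 * W μ else 0

/-- The residue pairing of amplitudes with those of adjoint wave functions. -/
noncomputable def pairing (V W : Fin 2 → LaurentSeries R) : R :=
  (W 0 * V 0).coeff 0 - (W 1 * V 1).coeff 0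

/-- The properties of the pair of wave functions `W` and of the pair of adjoint wave functions
`V` on which the theory of tau functions rests. -/
structure WavePair (D : TimeIndex → Derivation ℂ R R) (W V : Fin 2 → LaurentSeries R)
    (ε ε' β' : R) : Prop where
  comm : ∀ i j x, D i (D j x) = D j (D i x)
  mul_inv : ε * ε' = 1
  deriv_ε : D (0, 1) ε = β' * ε
  vanish : ∀ μ, Vanish 0 (W μ)
  vanish' : ∀ μ, Vanish 0 (V μ)
  lead₀ : (W 0).coeff 0 = 1
  lead₁ : (W 1).coeff 0 = ε
  lead₀' : (V 0).coeff 0 = 1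
  lead₁' : (V 1).coeff 0 = ε'
  flow : ∀ (ν : Fin 2) (k : ℕ+), ∃ (M : ℕ) (b : ℕ → R), (∀ n < (ν : ℕ), b n = 0) ∧
    waveD D (ν, k) W = ∑ n ∈ Finset.range M, b n • (waveD D (ν, 1))^[n] W
  cross : ∃ q : R, waveD D (0, 1) (waveD D (1, 1) W) = β' • waveD D (1, 1) W + q • W
  dual : ∀ (ν : Fin 2) (n : ℕ), pairing V ((waveD D (ν, 1))^[n] W) = 0

theorem waveD_self (D : TimeIndex → Derivation ℂ R R) (W : Fin 2 → LaurentSeries R) (ν : Fin 2) :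
    waveD D (ν, 1) W ν = leftD (D (ν, 1)) (W ν) := by
  simp [waveD, leftD]

theorem waveD_of_ne (D : TimeIndex → Derivation ℂ R R) (W : Fin 2 → LaurentSeries R)
    {i : TimeIndex} {μ : Fin 2} (h : i.1 ≠ μ) : waveD D i W μ = (W μ).map (D i) := by
  simp [waveD, h]

theorem iterate_waveD_self (D : TimeIndex → Derivation ℂ R R) (W : Fin 2 → LaurentSeries R)
    (ν : Fin 2) (n : ℕ) :
    (waveD D (ν, 1))^[n] W ν = (leftD (D (ν, 1)))^[n] (W ν) := by
  induction n with
  | zero => rfl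
  | succ n ih => rw [Function.iterate_succ_apply', Function.iterate_succ_apply', waveD_self, ih]

theorem coeff_iterate_waveD_of_ne (D : TimeIndex → Derivation ℂ R R)
    (W : Fin 2 → LaurentSeries R) {i : TimeIndex} {μ : Fin 2} (h : i.1 ≠ μ) (n : ℕ) (k : ℤ) :
    ((waveD D i)^[n] W μ).coeff k = (D i)^[n] ((W μ).coeff k) := by
  induction n generalizing k with
  | zero => rfl
  | succ n ih =>
    rw [Function.iterate_succ_apply', Function.iterate_succ_apply', waveD_of_ne _ _ h, coeff_map,
      ih]

theorem vanish_iterate_waveD_of_ne (D : TimeIndex → Derivation ℂ R R)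
    (W : Fin 2 → LaurentSeries R) {i : TimeIndex} {μ : Fin 2} (h : i.1 ≠ μ) (n : ℕ) {a : ℤ}
    (hW : Vanish a (W μ)) : Vanish a ((waveD D i)^[n] W μ) := fun k hk => by
  rw [coeff_iterate_waveD_of_ne D W h, hW k hk, iterate_map_zero]

theorem coeff_mul_zero {A B : LaurentSeries R} (hA : Vanish 0 A) (hB : Vanish 0 B) :
    (A * B).coeff 0 = A.coeff 0 * B.coeff 0 := by
  rw [coeff_mul_eq_sum hA hB]
  simp

/-- Differentiating one of two mutually inverse operators. -/
theorem star_map_of_inv {d e : Derivation ℂ R R} (he : ∀ x, e (d x) = d (e x))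
    {A Y : LaurentSeries R} (hAY : star d A Y = 1) (hYA : star d Y A = 1) (Z : LaurentSeries R) :
    star d Z (A.map e) = -star d (star d (star d Z A) (Y.map e)) A := by
  have h1 : (1 : LaurentSeries R).map e = 0 := by
    ext n
    rw [coeff_map, show (1 : LaurentSeries R) = HahnSeries.single 0 1 from rfl,
      coeff_single_eq_ite, HahnSeries.coeff_zero]
    split_ifs <;> simp
  have h := map_star d he A Y
  rw [hAY, h1] at h
  rw [star_assoc d Z A, ← neg_eq_of_add_eq_zero_right h.symm, star_neg, neg_star, neg_neg,
    star_assoc, star_assoc, hYA, star_one]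

/-- The composition ∂^n f is a differential operator, so it has no ∂⁻¹ term. -/
theorem coeff_one_iterate_leftD_C (d : Derivation ℂ R R) (n : ℕ) (f : R) :
    ((leftD d)^[n] (HahnSeries.C f)).coeff 1 = 0 := by
  have : ∀ k : ℤ, 0 < k → ((leftD d)^[n] (HahnSeries.C f)).coeff k = 0 := by
    induction n with
    | zero =>
      intro k hk
      rw [Function.iterate_zero, id, HahnSeries.C_apply, HahnSeries.coeff_single_of_ne hk.ne']
    | succ n ih =>
      intro k hk
      rw [Function.iterate_succ_apply', coeff_leftD, ih k hk, ih _ (by omega), map_zero, add_zero]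
  exact this 1 one_pos

/-- Here `X` plays the role of ∂⁻¹ c. By ∂ f X = d(f) X + f c, each ∂ either differentiates `f` or
produces a function, and a function has no residue even after further applications of ∂. -/
theorem coeff_one_iterate_leftD_smul (d : Derivation ℂ R R) {X : LaurentSeries R} {c : R}
    (hX : leftD d X = HahnSeries.C c) (hc : X.coeff 1 = c) (n : ℕ) (f : R) :
    ((leftD d)^[n] (f • X)).coeff 1 = d^[n] f * c := by
  have hadd : ∀ (n : ℕ) (A B : LaurentSeries R),
      (leftD d)^[n] (A + B) = (leftD d)^[n] A + (leftD d)^[n] B := fun n => by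
    induction n with
    | zero => exact fun A B => rfl
    | succ n ih =>
      intro A B
      rw [Function.iterate_succ_apply', Function.iterate_succ_apply', Function.iterate_succ_apply',
        ih, leftD_add]
  induction n generalizing f with
  | zero => rw [Function.iterate_zero, id, HahnSeries.coeff_smul, hc]; rfl
  | succ n ih =>
    have hC : f • HahnSeries.C c = (HahnSeries.C (f * c) : LaurentSeries R) := by
      rw [map_mul, HahnSeries.C_mul_eq_smul]
    rw [Function.iterate_succ_apply, Function.iterate_succ_apply, leftD_smul, hX, hC, hadd,
      HahnSeries.coeff_add, ih, coeff_one_iterate_leftD_C, add_zero]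

/-- The pairing of the derivatives of a wave function with an adjoint wave function of the form
`(∂ A⁻¹ f ∂⁻¹ g)^* e^{-ξ}`. -/
theorem coeff_iterate_leftD_mul_adj (d : Derivation ℂ R R) {A Y : LaurentSeries R}
    (hAY : star d A Y = 1) (f g : R) (n : ℕ) :
    ((leftD d)^[n] A * adj d (star d (star d (star d (star d (HahnSeries.single (-1) 1) Y)
      (HahnSeries.C f)) (HahnSeries.single 1 1)) (HahnSeries.C g))).coeff 0 = d^[n] f * g := by
  have hX : leftD d (star d (HahnSeries.single 1 1) (HahnSeries.C g)) = HahnSeries.C g := by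
    rw [leftD_star, leftD_single_one, sub_self]
    exact one_star d _
  rw [coeff_mul_adj, ← coeff_one_iterate_leftD_smul d hX ?_ n f]
  · congr 1
    -- In ∂^n A ∂⁻¹ ∂ A⁻¹ f ∂⁻¹ g the inner factors cancel, and the residue of ∂^n f ∂⁻¹ g remains.
    rw [iterate_leftD_eq_star, iterate_leftD_eq_star, ← C_star d f, star_assoc, star_assoc]
    congr 1
    have h1 : star d (HahnSeries.single 1 1) (HahnSeries.single (-1) 1) =
        (1 : LaurentSeries R) := by
      rw [star_single_one, HahnSeries.single_mul_single]
      simp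
    simp only [star_assoc]
    rw [← star_assoc d (HahnSeries.single 1 1) (HahnSeries.single (-1) 1), h1, one_star,
      ← star_assoc d A Y, hAY, one_star]
  · have := coeff_star_add d (vanish_single (R := R) 1 1) (vanish_single 0 g)
    rw [add_zero, HahnSeries.coeff_single_same, HahnSeries.coeff_single_same, one_mul] at this
    exact this

end Wave


namespace PsiDO

variable {U : TimeDomain}

/-- The nonzero columns of `A ∂_{ν'} B`. -/
theorem col_mul_dpow_mul {ν : Fin 2} {A B : PsiDO U} (hA : A.OnAxis ν) (hB : B.OnAxis ν) (c : ℤ) :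
    (A * dpow (1 - ν) 1 * B).col ν c =
      if c = 1 then star (tD (ν, 1)) (A.col ν 0) (B.col ν 0) else
      if c = 0 then star (tD (ν, 1)) (A.col ν 0) ((B.col ν 0).map (tD (1 - ν, 1))) else 0 := by
  have hcol : ∀ c, (dpow (1 - ν) 1 : PsiDO U).col ν c = if c = 1 then 1 else 0 := by
    intro c
    refine HahnSeries.ext (funext fun n => ?_)
    rw [coeff_col, cf_dpow_other]
    by_cases hc : c = 1
    · rw [if_pos hc, show (1 : LaurentSeries (SmoothFn U)) = HahnSeries.single 0 1 from rfl,
        coeff_single_eq_ite]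
      simp only [hc, and_true, neg_eq_zero]
    · rw [if_neg hc, if_neg fun h => hc h.2, HahnSeries.coeff_zero]
  have hA1 : (A * dpow (1 - ν) 1).col ν 1 = A.col ν 0 := by
    rw [col_mul hA, hcol, if_pos rfl, star_one]
  have hA2 : ∀ n c, c ≠ 1 → (A * dpow (1 - ν) 1).cf ν n c = 0 := by
    intro n c hc
    rw [cf_eq_coeff_col, col_mul hA, hcol, if_neg hc, star_zero, HahnSeries.coeff_zero]
  have hmap : ((0 : LaurentSeries (SmoothFn U)).map (tD (1 - ν, 1))) = 0 :=
    HahnSeries.ext (funext fun n => by rw [coeff_map, HahnSeries.coeff_zero, map_zero])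
  rw [col_mul_one hA2, hA1]
  by_cases h1 : c = 1
  · subst h1
    rw [sub_self, hB.col_eq_zero one_ne_zero, hmap, star_zero, add_zero, if_pos rfl]
  · rw [if_neg h1, hB.col_eq_zero (c := c - 1) (by omega), star_zero, zero_add]
    by_cases h0 : c = 0
    · rw [if_pos h0, h0]
    · rw [if_neg h0, hB.col_eq_zero h0, hmap, star_zero]

end PsiDO

/-! ### The dressing operators and their flows -/

namespace Unknowns

variable {U : TimeDomain} (S : Unknowns U)

/-- The operator `Φ_ν`. -/
noncomputable def Phi (ν : Fin 2) : PsiDO U := if ν = 0 then S.Phi₁ else S.Phi₂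

/-- The leading coefficient of `Φ_ν`. -/
noncomputable def lead (ν : Fin 2) : SmoothFn U := if ν = 0 then 1 else expFn S.β

/-- The inverse of the leading coefficient of `Φ_ν`. -/
noncomputable def lead' (ν : Fin 2) : SmoothFn U := if ν = 0 then 1 else expFn (-S.β)

theorem exp_mul_exp_neg : expFn S.β * expFn (-S.β) = 1 := (expUnit S.β).val_inv

theorem lead_mul (ν : Fin 2) : S.lead ν * S.lead' ν = 1 := by
  fin_cases ν
  · exact one_mul 1
  · exact S.exp_mul_exp_neg

theorem cf_Phi (ν : Fin 2) (n c : ℤ) :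
    (S.Phi ν).cf ν n c = if n ≤ 0 ∧ c = 0 then S.lead ν * S.a' ν (-n).toNat else 0 := by
  fin_cases ν
  · change (if n ≤ 0 ∧ c = 0 then S.a' 0 (-n).toNat else 0) =
      if n ≤ 0 ∧ c = 0 then 1 * S.a' 0 (-n).toNat else 0
    rw [one_mul]
  · change (if c = 0 ∧ n ≤ 0 then expFn S.β * S.a' 1 (-n).toNat else 0) = _
    simp only [and_comm]
    rfl

theorem onAxis_Phi (ν : Fin 2) : (S.Phi ν).OnAxis ν := fun n c hc => by
  rw [cf_Phi, if_neg fun h => hc h.2]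

/-- The amplitude of `w_ν`. -/
noncomputable def W (ν : Fin 2) : LaurentSeries (SmoothFn U) := (S.Phi ν).col ν 0

theorem coeff_W (ν : Fin 2) (n : ℕ) : (S.W ν).coeff n = S.lead ν * S.a' ν n := by
  rw [W, PsiDO.coeff_col, cf_Phi, if_pos ⟨by omega, rfl⟩, neg_neg, Int.toNat_natCast]

theorem vanish_W (ν : Fin 2) : Vanish 0 (S.W ν) := fun n hn => by
  rw [W, PsiDO.coeff_col, cf_Phi, if_neg (by omega)]

theorem coeff_zero_W (ν : Fin 2) : (S.W ν).coeff 0 = S.lead ν := by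
  have h := S.coeff_W ν 0
  rw [Nat.cast_zero] at h
  rw [h, a', dif_neg (lt_irrefl 0), mul_one]

theorem exists_inv_Phi (ν : Fin 2) : ∃ Y : LaurentSeries (SmoothFn U), Vanish 0 Y ∧
    Y.coeff 0 = S.lead' ν ∧ star (tD (ν, 1)) (S.W ν) Y = 1 ∧ star (tD (ν, 1)) Y (S.W ν) = 1 ∧
    (S.Phi ν)⁻¹ = PsiDO.ofCol ν Y := by
  obtain ⟨Y, h1, h2, h3, h4⟩ := exists_inv (tD (ν, 1)) (S.vanish_W ν) (c := S.lead' ν)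
    (by rw [coeff_zero_W, lead_mul])
  exact ⟨Y, h1, h2, h3, h4, PsiDO.inv_eq_ofCol (S.onAxis_Phi ν) h3 h4⟩

/-- The series of `Φ_ν⁻¹`. -/
noncomputable def invW (ν : Fin 2) : LaurentSeries (SmoothFn U) := (S.exists_inv_Phi ν).choose

theorem vanish_invW (ν : Fin 2) : Vanish 0 (S.invW ν) := (S.exists_inv_Phi ν).choose_spec.1

theorem coeff_zero_invW (ν : Fin 2) : (S.invW ν).coeff 0 = S.lead' ν :=
  (S.exists_inv_Phi ν).choose_spec.2.1

theorem W_star_invW (ν : Fin 2) : star (tD (ν, 1)) (S.W ν) (S.invW ν) = 1 :=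
  (S.exists_inv_Phi ν).choose_spec.2.2.1

theorem invW_star_W (ν : Fin 2) : star (tD (ν, 1)) (S.invW ν) (S.W ν) = 1 :=
  (S.exists_inv_Phi ν).choose_spec.2.2.2.1

theorem inv_Phi (ν : Fin 2) : (S.Phi ν)⁻¹ = PsiDO.ofCol ν (S.invW ν) :=
  (S.exists_inv_Phi ν).choose_spec.2.2.2.2

attribute [irreducible] W invW

/-- The operator `P_ν`. -/
noncomputable def P (ν : Fin 2) : PsiDO U := S.Phi ν * PsiDO.dpow ν 1 * (S.Phi ν)⁻¹

theorem onAxis_inv (ν : Fin 2) : ((S.Phi ν)⁻¹).OnAxis ν := by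
  rw [inv_Phi]
  exact PsiDO.onAxis_ofCol ν _

theorem onAxis_P (ν : Fin 2) : (S.P ν).OnAxis ν :=
  ((S.onAxis_Phi ν).mul (PsiDO.onAxis_dpow ν 1)).mul (S.onAxis_inv ν)

theorem col_Phi (ν : Fin 2) : (S.Phi ν).col ν 0 = S.W ν := by
  rw [W]

theorem col_inv_Phi (ν : Fin 2) : ((S.Phi ν)⁻¹).col ν 0 = S.invW ν := by
  rw [inv_Phi, PsiDO.col_ofCol]

theorem P_star_W (ν : Fin 2) : star (tD (ν, 1)) ((S.P ν).col ν 0) (S.W ν) =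
    star (tD (ν, 1)) (S.W ν) (HahnSeries.single (-1) 1) := by
  rw [P, PsiDO.col_mul ((S.onAxis_Phi ν).mul (PsiDO.onAxis_dpow ν 1)),
    PsiDO.col_mul (S.onAxis_Phi ν), PsiDO.col_dpow, col_Phi, col_inv_Phi, star_assoc,
    invW_star_W, star_one]

variable {S}

/-- The two equations for a time t_{ν,k} merge into one: the differential part of P_ν^k acts on w_ν
by composition (`flow_same`) and on the other wave function through its coefficients (`col_act`).
The index `ν`, 0 or 1, is at the same time the order of truncation. -/
theorem IsSolution.flow (hS : S.IsSolution) (ν : Fin 2) (k : ℕ+) :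
    ∃ (M : ℕ) (b : ℕ → SmoothFn U), (∀ n < (ν : ℕ), b n = 0) ∧
      waveD tD (ν, k) S.W = ∑ n ∈ Finset.range M, b n • (waveD tD (ν, 1))^[n] S.W := by
  have h1 : (S.Phi ν).dt (ν, k) = -(S.P ν ^ (k : ℕ)).truncLT ν ((ν : ℕ) : ℤ) * S.Phi ν := by
    fin_cases ν
    · exact hS.flow₁₁ k
    · exact hS.flow₂₂ k
  have h2 : (S.Phi (1 - ν)).dt (ν, k) =
      ((S.P ν ^ (k : ℕ)).truncGE ν ((ν : ℕ) : ℤ)).act (S.Phi (1 - ν)) := by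
    fin_cases ν
    · exact hS.flow₂₁ k
    · exact hS.flow₁₂ k
  obtain ⟨M, b, hb0, hb, hbM, hcol⟩ := PsiDO.exists_truncGE_eq_sum ν (ν : ℕ) (S.P ν ^ (k : ℕ))
  refine ⟨M, b, hb0, funext fun μ => ?_⟩
  rw [Finset.sum_apply]
  have hPk : ((S.P ν ^ (k : ℕ)).truncGE ν ((ν : ℕ) : ℤ)).OnAxis ν := fun n c hc => by
    rw [PsiDO.cf_truncGE, (S.onAxis_P ν).pow _ n c hc, ite_self]
  by_cases hμ : ν = μ
  · subst hμ
    have := PsiDO.flow_same (S.onAxis_P ν) (by rw [col_Phi]; exact S.P_star_W ν) h1 hcol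
    rw [col_Phi] at this
    rw [waveD, if_pos rfl, this]
    refine Finset.sum_congr rfl fun n _ => ?_
    rw [Pi.smul_apply, iterate_waveD_self]
  · have hμ' : μ = 1 - ν := by fin_cases ν <;> fin_cases μ <;> first | rfl | exact absurd rfl hμ
    subst hμ'
    refine HahnSeries.ext (funext fun n => ?_)
    rw [waveD_of_ne _ _ hμ, coeff_map, HahnSeries.coeff_sum]
    have := congrArg (fun A => (PsiDO.col (1 - ν) 0 A).coeff n) h2
    simp only [PsiDO.col_dt, PsiDO.col_act ν hPk hb hbM, col_Phi, coeff_map] at this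
    rw [this]
    refine Finset.sum_congr rfl fun m _ => ?_
    rw [Pi.smul_apply, HahnSeries.coeff_smul, coeff_iterate_waveD_of_ne _ _ hμ, smul_eq_mul, coe_tD]

end Unknowns


/-! ### The constraint as a linear equation for the wave functions -/

theorem pd_expFn {U : TimeDomain} (i : TimeIndex) (f : SmoothFn U) :
    pd i (expFn f) = pd i f * expFn f := by
  refine Subtype.ext (funext fun p => ?_)
  have h := (hasDerivAt_partialDeriv i f p).cexp
  have hp : p.1 + (0 : ℝ) • dir i ∈ U.carrier := by simp
  have hf : extendZero f.1 (p.1 + (0 : ℝ) • dir i) = f.1 p := by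
    rw [extendZero_of_mem _ hp]
    simp
  rw [hf] at h
  refine ((h.congr_of_eventuallyEq ?_).deriv).trans (mul_comm _ _)
  filter_upwards [eventually_mem i p] with s hs
  rw [extendZero_of_mem _ hs, extendZero_of_mem _ hs]
  rfl

section

variable {R : Type*} [CommRing R] [Algebra ℂ R]

/-- Multiplication by `ε ∂ ε⁻¹` from the left. -/
theorem conj_star (d : Derivation ℂ R R) {ε ε' β' : R} (h : ε * ε' = 1) (hd : d ε = β' * ε)
    (A : LaurentSeries R) :
    star d (star d (star d (HahnSeries.C ε) (HahnSeries.single (-1) 1)) (HahnSeries.C ε')) A =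
      leftD d A - β' • A := by
  have hd' : ε * d ε' = -β' := by
    have h1 : d (ε * ε') = 0 := by rw [h, Derivation.map_one_eq_zero]
    rw [Derivation.leibniz, hd, smul_eq_mul, smul_eq_mul,
      show ε' * (β' * ε) = β' * (ε * ε') by ring, h, mul_one] at h1
    exact eq_neg_of_add_eq_zero_left h1
  rw [star_assoc, star_assoc, C_star, C_star, ← leftD_eq_star, leftD_smul, smul_add, smul_smul,
    smul_smul, hd', h, one_smul, neg_smul, neg_add_eq_sub]

theorem C_one : (HahnSeries.C (1 : R) : LaurentSeries R) = 1 := map_one _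

theorem leftD_one_sub_smul (d : Derivation ℂ R R) (f : R) :
    leftD d 1 - f • (1 : LaurentSeries R) = HahnSeries.single (-1) 1 - HahnSeries.C f := by
  rw [leftD_eq_star, star_one, ← HahnSeries.C_mul_eq_smul, mul_one]

/-- An operator with two expansions, each in at most first powers of one of the derivations. -/
theorem eq_of_two_expansions {f : R} {X Z : LaurentSeries R} (c : ℤ → ℤ → R)
    (hX : ∀ a b, c a b = (if b = 1 then HahnSeries.single (-1) 1 - HahnSeries.C f else
      if b = 0 then X else 0).coeff (-a))
    (hZ : ∀ a b, c a b = (if a = 1 then HahnSeries.single (-1) 1 else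
      if a = 0 then Z else 0).coeff (-b)) :
    X = (0 : R) • HahnSeries.single (-1) 1 + HahnSeries.C (c 0 0) ∧
      Z = (-f) • HahnSeries.single (-1) 1 + HahnSeries.C (c 0 0) := by
  -- One expansion bounds the powers of the second derivation and the other those of the first. Only
  -- c(1,1) = 1, c(1,0) = 0, c(0,1) = -f and the free coefficient c(0,0) survive.
  constructor
  · ext n
    have := (hX (-n) 0).symm.trans (hZ (-n) 0)
    rw [if_neg zero_ne_one, if_pos rfl, neg_neg, neg_zero] at this
    rw [this, zero_smul, zero_add, HahnSeries.C_apply, coeff_single_eq_ite]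
    by_cases h : n = 0
    · subst h
      rw [hZ]
      simp
    · rw [if_neg h, if_neg (by omega : ¬ -n = 0)]
      split_ifs
      · rw [HahnSeries.coeff_single_of_ne (by omega)]
      · rfl
  · ext n
    have := (hZ 0 (-n)).symm.trans (hX 0 (-n))
    rw [if_neg zero_ne_one, if_pos rfl, neg_neg, neg_zero] at this
    rw [this, HahnSeries.coeff_add, HahnSeries.coeff_smul, HahnSeries.C_apply (c 0 0),
      coeff_single_eq_ite (-1) n, coeff_single_eq_ite 0 n]
    by_cases h : n = 0
    · subst h
      rw [hX]
      simp
    · by_cases h' : n = -1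
      · subst h'
        simp
      · rw [if_neg h, if_neg h', if_neg (by omega : ¬ -n = 1), if_neg (by omega : ¬ -n = 0)]
        simp

/-- The consequences of the constraint between the two dressing operators for the wave
functions. -/
theorem wave_of_constraint {d e : Derivation ℂ R R} (he : ∀ x, e (d x) = d (e x))
    {A Y E : LaurentSeries R} (hAY : star d A Y = 1) (hYA : star d Y A = 1) {f g : R}
    (h : star d (star d E A) (Y.map e) = f • HahnSeries.single (-1) 1 + HahnSeries.C g) :
    star d E (A.map e) = -(f • leftD d A + g • A) := by
  rw [star_map_of_inv he hAY hYA, h, add_star, smul_star, C_star, ← leftD_eq_star]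

/-- These are the two components of (∂₁ - f) ∂₂ w = -g w, so q = -g. In each component one of the
derivations acts on coefficients only, and commutativity brings the second one to the required
order. -/
theorem exists_cross {D : TimeIndex → Derivation ℂ R R} {W : Fin 2 → LaurentSeries R} {f g : R}
    (h0 : leftD (D (0, 1)) ((W 0).map (D (1, 1))) - f • (W 0).map (D (1, 1)) =
      -((0 : R) • leftD (D (0, 1)) (W 0) + g • W 0))
    (h1 : leftD (D (1, 1)) ((W 1).map (D (0, 1))) =
      -((-f) • leftD (D (1, 1)) (W 1) + g • W 1))
    (hcomm : ∀ x, D (0, 1) (D (1, 1) x) = D (1, 1) (D (0, 1) x)) :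
    ∃ q : R, waveD D (0, 1) (waveD D (1, 1) W) = f • waveD D (1, 1) W + q • W := by
  refine ⟨-g, funext fun μ => ?_⟩
  rw [Pi.add_apply, Pi.smul_apply, Pi.smul_apply]
  fin_cases μ
  · change waveD D (0, 1) _ 0 = f • waveD D (1, 1) W 0 + -g • W 0
    rw [waveD_self, waveD_of_ne D W (i := (1, 1)) (by decide), sub_eq_iff_eq_add.1 h0]
    module
  · change waveD D (0, 1) _ 1 = f • waveD D (1, 1) W 1 + -g • W 1
    have h2 : (leftD (D (1, 1)) (W 1)).map (D (0, 1)) =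
        leftD (D (1, 1)) ((W 1).map (D (0, 1))) := by
      ext n
      rw [coeff_map, coeff_leftD, coeff_leftD, map_add, coeff_map, coeff_map, hcomm]
    rw [waveD_of_ne D _ (i := (0, 1)) (by decide), waveD_self, h2, h1]
    module

end

/-! ### Adjoint wave functions and the wave pair of a solution -/

namespace Unknowns

variable {U : TimeDomain} (S : Unknowns U)

/-- The operators `Φ₁⁻¹ e^β ∂₁⁻¹ e^{-β}` and `Φ₂⁻¹ ∂₂⁻¹`, multiplied by `∂_ν` from the left. -/
noncomputable def PhiDag (ν : Fin 2) : PsiDO U :=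
  if ν = 0 then PsiDO.dpow 0 1 * S.Phi₁⁻¹ * PsiDO.ofFn (expFn S.β) * PsiDO.dpow 0 (-1) *
    PsiDO.ofFn (expFn (-S.β))
  else PsiDO.dpow 1 1 * S.Phi₂⁻¹ * PsiDO.dpow 1 (-1)

/-- The amplitude of `w_ν^†`. -/
noncomputable def V (ν : Fin 2) : LaurentSeries (SmoothFn U) :=
  ((S.PhiDag ν).adjoint.onExp ν (-1)).amp

theorem V_zero : S.V 0 = adj (tD (0, 1)) (star (tD (0, 1)) (star (tD (0, 1)) (star (tD (0, 1))
    (star (tD (0, 1)) (HahnSeries.single (-1) 1) (S.invW 0)) (HahnSeries.C (expFn S.β)))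
      (HahnSeries.single 1 1)) (HahnSeries.C (expFn (-S.β)))) := by
  have h0 := PsiDO.onAxis_dpow (U := U) 0 1
  have h1 := h0.mul (S.onAxis_inv 0)
  have h2 := h1.mul (PsiDO.onAxis_ofFn 0 (expFn S.β))
  have h3 := h2.mul (PsiDO.onAxis_dpow 0 (-1))
  have h4 := h3.mul (PsiDO.onAxis_ofFn 0 (expFn (-S.β)))
  refine (PsiDO.amp_adjoint_onExp 0 h4).trans ?_
  rw [PsiDO.col_mul h3, PsiDO.col_mul h2, PsiDO.col_mul h1, PsiDO.col_mul h0, PsiDO.col_ofFn,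
    PsiDO.col_ofFn, PsiDO.col_dpow, PsiDO.col_dpow, col_inv_Phi, neg_neg]

theorem V_one : S.V 1 = adj (tD (1, 1)) (star (tD (1, 1)) (star (tD (1, 1)) (star (tD (1, 1))
    (star (tD (1, 1)) (HahnSeries.single (-1) 1) (S.invW 1)) (HahnSeries.C 1))
      (HahnSeries.single 1 1)) (HahnSeries.C 1)) := by
  have h0 := PsiDO.onAxis_dpow (U := U) 1 1
  have h1 := h0.mul (S.onAxis_inv 1)
  have h2 := h1.mul (PsiDO.onAxis_dpow 1 (-1))
  refine (PsiDO.amp_adjoint_onExp 1 h2).trans ?_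
  rw [PsiDO.col_mul h1, PsiDO.col_mul h0, PsiDO.col_dpow, PsiDO.col_dpow, col_inv_Phi, neg_neg,
    C_one, star_one, star_one]

/-- The left side of the constraint has order at most one in ∂₂ and the right side order at most one
in ∂₁, so their common value is ∂₁∂₂ - (∂₁β) ∂₂ + c with a function c. Moving the inverse dressing
operators to the other side turns the coefficients of this operator into equations for w₁ and w₂. -/
theorem cross_of_isSolution {S : Unknowns U} (hS : S.IsSolution) : ∃ q : SmoothFn U,
    waveD tD (0, 1) (waveD tD (1, 1) S.W) =
      pd (0, 1) S.β • waveD tD (1, 1) S.W + q • S.W := by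
  have hβ : tD (0, 1) (expFn S.β) = pd (0, 1) S.β * expFn S.β := pd_expFn _ _
  have hE : ((PsiDO.ofFn (expFn S.β) * PsiDO.dpow 0 1 * PsiDO.ofFn (expFn (-S.β)) :
      PsiDO U)).OnAxis 0 :=
    ((PsiDO.onAxis_ofFn 0 _).mul (PsiDO.onAxis_dpow 0 1)).mul (PsiDO.onAxis_ofFn 0 _)
  have hc : PsiDO.ofFn (expFn S.β) * PsiDO.dpow 0 1 * PsiDO.ofFn (expFn (-S.β)) *
        S.Phi 0 * PsiDO.dpow (1 - 0) 1 * (S.Phi 0)⁻¹ =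
      PsiDO.dpow 1 1 * S.Phi 1 * PsiDO.dpow (1 - 1) 1 * (S.Phi 1)⁻¹ := hS.constraint
  set E := star (tD (0, 1)) (star (tD (0, 1)) (HahnSeries.C (expFn S.β))
    (HahnSeries.single (-1) 1)) (HahnSeries.C (expFn (-S.β))) with hEdef
  have hEcol : (PsiDO.ofFn (expFn S.β) * PsiDO.dpow 0 1 * PsiDO.ofFn (expFn (-S.β)) *
        S.Phi 0).col 0 0 = star (tD (0, 1)) E (S.W 0) := by
    rw [PsiDO.col_mul hE, PsiDO.col_mul ((PsiDO.onAxis_ofFn 0 _).mul (PsiDO.onAxis_dpow 0 1)),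
      PsiDO.col_mul (PsiDO.onAxis_ofFn 0 _), PsiDO.col_ofFn, PsiDO.col_ofFn, PsiDO.col_dpow,
      col_Phi]
  have hZcol : (PsiDO.dpow 1 1 * S.Phi 1).col 1 0 =
      star (tD (1, 1)) (HahnSeries.single (-1) 1) (S.W 1) := by
    rw [PsiDO.col_mul (PsiDO.onAxis_dpow 1 1), PsiDO.col_dpow, col_Phi]
  have hL := PsiDO.col_mul_dpow_mul (ν := 0) (hE.mul (S.onAxis_Phi 0)) (S.onAxis_inv 0)
  have hR := PsiDO.col_mul_dpow_mul (ν := 1) ((PsiDO.onAxis_dpow 1 1).mul (S.onAxis_Phi 1))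
    (S.onAxis_inv 1)
  rw [hEcol, col_inv_Phi] at hL
  rw [hZcol, col_inv_Phi] at hR
  have hEY : star (tD (0, 1)) (star (tD (0, 1)) E (S.W 0)) (S.invW 0) =
      HahnSeries.single (-1) 1 - HahnSeries.C (pd (0, 1) S.β) := by
    rw [star_assoc, W_star_invW, hEdef, conj_star _ S.exp_mul_exp_neg hβ, leftD_one_sub_smul]
  have hZY : star (tD (1, 1)) (star (tD (1, 1)) (HahnSeries.single (-1) 1) (S.W 1)) (S.invW 1) =
      HahnSeries.single (-1) 1 := by
    rw [star_assoc, W_star_invW, star_one]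
  rw [hEY] at hL
  rw [hZY] at hR
  rw [hc] at hL
  obtain ⟨hX, hZ⟩ := eq_of_two_expansions
    (PsiDO.dpow 1 1 * S.Phi 1 * PsiDO.dpow (1 - 1) 1 * (S.Phi 1)⁻¹).coeff
    (fun a b => by rw [← hL, ← PsiDO.cf_eq_coeff_col, PsiDO.cf_zero])
    (fun a b => by rw [← hR, ← PsiDO.cf_eq_coeff_col, PsiDO.cf_one])
  have e0 := wave_of_constraint (tD_comm _ _) (S.W_star_invW 0) (S.invW_star_W 0) hX
  have e1 := wave_of_constraint (tD_comm _ _) (S.W_star_invW 1) (S.invW_star_W 1) hZ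
  rw [hEdef, conj_star _ S.exp_mul_exp_neg hβ] at e0
  rw [← leftD_eq_star] at e1
  exact exists_cross e0 e1 (tD_comm _ _)

/-- The orders -1, 0, 0, 1, 0 of the five factors add up to 0, and leading coefficients multiply. -/
theorem vanish_V_aux {R : Type*} [CommRing R] [Algebra ℂ R] (d : Derivation ℂ R R)
    {Y : LaurentSeries R} (hY : Vanish 0 Y) (f g : R) :
    Vanish 0 (adj d (star d (star d (star d (star d (HahnSeries.single (-1) 1) Y)
      (HahnSeries.C f)) (HahnSeries.single 1 1)) (HahnSeries.C g))) ∧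
    (adj d (star d (star d (star d (star d (HahnSeries.single (-1) 1) Y)
      (HahnSeries.C f)) (HahnSeries.single 1 1)) (HahnSeries.C g))).coeff 0 =
        Y.coeff 0 * f * g := by
  have hC : ∀ f : R, Vanish 0 (HahnSeries.C f) := fun f => vanish_single 0 f
  have h1 := (vanish_single (-1) (1 : R)).star d hY
  have h2 := h1.star d (hC f)
  have h3 := h2.star d (vanish_single 1 1)
  have h4 := h3.star d (hC g)
  have e1 := coeff_star_add d (vanish_single (-1) (1 : R)) hY
  have e2 := coeff_star_add d h1 (hC f)
  have e3 := coeff_star_add d h2 (vanish_single 1 1)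
  have e4 := coeff_star_add d h3 (hC g)
  rw [HahnSeries.coeff_single_same] at e1
  rw [HahnSeries.C_apply f, HahnSeries.coeff_single_same] at e2
  rw [HahnSeries.coeff_single_same] at e3
  rw [HahnSeries.C_apply g, HahnSeries.coeff_single_same] at e4
  norm_num at e1 e2 e3 e4
  rw [← HahnSeries.C_apply] at e2 e3 e4
  rw [← HahnSeries.C_apply] at e4
  rw [show (-1 + 0 + 0 + 1 + 0 : ℤ) = 0 from rfl] at h4
  refine ⟨h4.adj d, ?_⟩
  rw [coeff_adj_of_vanish d h4, e4, e3, e2, e1]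

/-- For duality, one component of the pairing is an operator residue, and in the other ∂_ν acts on
coefficients, so only leading coefficients count. For ν = 0 both give e^{-β} ∂₁^n e^β, for ν = 1
both give ∂₂^n 1. -/
theorem wavePair {S : Unknowns U} (hS : S.IsSolution) :
    WavePair tD S.W S.V (expFn S.β) (expFn (-S.β)) (pd (0, 1) S.β) := by
  have hVv : ∀ μ, Vanish 0 (S.V μ) := by
    intro μ
    fin_cases μ
    · exact S.V_zero ▸ (vanish_V_aux _ (S.vanish_invW 0) _ _).1
    · exact S.V_one ▸ (vanish_V_aux _ (S.vanish_invW 1) _ _).1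
  have hV0 : (S.V 0).coeff 0 = 1 := by
    rw [V_zero, (vanish_V_aux _ (S.vanish_invW 0) _ _).2, mul_assoc, exp_mul_exp_neg, mul_one,
      coeff_zero_invW]
    rfl
  have hV1 : (S.V 1).coeff 0 = expFn (-S.β) := by
    rw [V_one, (vanish_V_aux _ (S.vanish_invW 1) _ _).2, mul_one, mul_one, coeff_zero_invW]
    rfl
  have hW0 : (S.W 0).coeff 0 = 1 := S.coeff_zero_W 0
  have hW1 : (S.W 1).coeff 0 = expFn S.β := S.coeff_zero_W 1
  refine ⟨tD_comm, S.exp_mul_exp_neg, pd_expFn _ _, S.vanish_W, hVv, hW0, hW1, hV0, hV1, hS.flow,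
    cross_of_isSolution hS, fun ν n => ?_⟩
  rw [pairing, sub_eq_zero]
  fin_cases ν
  · change ((waveD tD (0, 1))^[n] S.W 0 * S.V 0).coeff 0 =
      ((waveD tD (0, 1))^[n] S.W 1 * S.V 1).coeff 0
    rw [coeff_mul_zero (vanish_iterate_waveD_of_ne tD S.W (i := (0, 1)) (by decide) n (S.vanish_W 1))
      (hVv 1), coeff_iterate_waveD_of_ne tD S.W (i := (0, 1)) (by decide), hW1, hV1,
      iterate_waveD_self, V_zero, coeff_iterate_leftD_mul_adj _ (S.W_star_invW 0)]
  · change ((waveD tD (1, 1))^[n] S.W 0 * S.V 0).coeff 0 =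
      ((waveD tD (1, 1))^[n] S.W 1 * S.V 1).coeff 0
    rw [coeff_mul_zero (vanish_iterate_waveD_of_ne tD S.W (i := (1, 1)) (by decide) n (S.vanish_W 0))
      (hVv 0), coeff_iterate_waveD_of_ne tD S.W (i := (1, 1)) (by decide), hW0, hV0,
      iterate_waveD_self, V_one, coeff_iterate_leftD_mul_adj _ (S.W_star_invW 1)]

end Unknowns


/-! ### Formal exponentials and logarithms -/

/-- The operator `X d/dX`. -/
noncomputable def theta {A : Type*} [Ring A] [Algebra ℂ A] : PowerSeries A →ₗ[ℂ] PowerSeries A where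
  toFun f := PowerSeries.mk fun n => (n : ℂ) • PowerSeries.coeff n f
  map_add' f g := by
    ext n
    rw [map_add, PowerSeries.coeff_mk, PowerSeries.coeff_mk, PowerSeries.coeff_mk, map_add,
      smul_add]
  map_smul' c f := by
    ext n
    rw [PowerSeries.coeff_mk, RingHom.id_apply, PowerSeries.coeff_smul, PowerSeries.coeff_smul,
      PowerSeries.coeff_mk, smul_comm]

section Exp

variable {A : Type*} [Ring A] [Algebra ℂ A]

theorem coeff_theta (f : PowerSeries A) (n : ℕ) :
    PowerSeries.coeff n (theta f) = (n : ℂ) • PowerSeries.coeff n f := by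
  change PowerSeries.coeff n (PowerSeries.mk fun n => (n : ℂ) • PowerSeries.coeff n f) = _
  rw [PowerSeries.coeff_mk]

theorem theta_mul (f g : PowerSeries A) : theta (f * g) = theta f * g + f * theta g := by
  ext n
  rw [coeff_theta, map_add, PowerSeries.coeff_mul, PowerSeries.coeff_mul, PowerSeries.coeff_mul,
    ← Finset.sum_add_distrib, Finset.smul_sum]
  refine Finset.sum_congr rfl fun x hx => ?_
  rw [coeff_theta, coeff_theta, ← Finset.HasAntidiagonal.mem_antidiagonal.1 hx, Nat.cast_add, add_smul,
    smul_mul_assoc, mul_smul_comm]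

/-- The coefficient at `X^n` of the value of `T` depends on the first coefficients only. -/
def IsLocal (T : PowerSeries A →ₗ[ℂ] PowerSeries A) : Prop :=
  ∀ n f, (∀ m ≤ n, PowerSeries.coeff m f = 0) → PowerSeries.coeff n (T f) = 0

theorem isLocal_theta : IsLocal (theta : PowerSeries A →ₗ[ℂ] PowerSeries A) := fun n f h => by
  rw [coeff_theta, h n le_rfl, smul_zero]

theorem IsLocal.congr {T : PowerSeries A →ₗ[ℂ] PowerSeries A} (hT : IsLocal T) {n : ℕ}
    {f g : PowerSeries A} (h : ∀ m ≤ n, PowerSeries.coeff m f = PowerSeries.coeff m g) :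
    PowerSeries.coeff n (T f) = PowerSeries.coeff n (T g) := by
  have := hT n (f - g) fun m hm => by rw [map_sub, h m hm, sub_self]
  rwa [map_sub, map_sub, sub_eq_zero] at this

theorem coeff_pow_of_lt {X : PowerSeries A} (hX : PowerSeries.coeff 0 X = 0) {n j : ℕ} (h : n < j) :
    PowerSeries.coeff n (X ^ j) = 0 := by
  induction j generalizing n with
  | zero => omega
  | succ j ih =>
    rw [pow_succ, PowerSeries.coeff_mul]
    refine Finset.sum_eq_zero fun x hx => ?_
    have := Finset.HasAntidiagonal.mem_antidiagonal.1 hx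
    rcases Nat.eq_zero_or_pos x.2 with h0 | h0
    · rw [h0, hX, mul_zero]
    · rw [ih (by omega), zero_mul]

theorem coeff_expSeries {X : PowerSeries A} (hX : PowerSeries.coeff 0 X = 0) {n N : ℕ} (h : n ≤ N) :
    PowerSeries.coeff n (expSeries X) =
      PowerSeries.coeff n (∑ j ∈ Finset.range (N + 1), ((j.factorial : ℂ)⁻¹) • X ^ j) := by
  rw [expSeries, PowerSeries.coeff_mk, map_sum]
  refine Finset.sum_subset_zero_on_sdiff (Finset.range_mono (by omega)) ?_ ?_
  · intro j hj
    simp only [Finset.mem_sdiff, Finset.mem_range] at hj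
    rw [PowerSeries.coeff_smul, coeff_pow_of_lt hX (by omega), smul_zero]
  · intro j _
    rw [PowerSeries.coeff_smul]

theorem map_pow_of_commute {T : PowerSeries A →ₗ[ℂ] PowerSeries A}
    (hT : ∀ f g, T (f * g) = T f * g + f * T g) {X : PowerSeries A} (hc : Commute (T X) X) (j : ℕ) :
    T (X ^ (j + 1)) = ((j + 1 : ℕ) : ℂ) • (T X * X ^ j) := by
  induction j with
  | zero => simp
  | succ j ih =>
    rw [pow_succ, hT, ih, smul_mul_assoc, mul_assoc, ← pow_succ, ← (hc.pow_right (j + 1)).eq]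
    rw [Nat.cast_succ (j + 1), add_smul, one_smul]

/-- A derivation of formal series maps `exp X` to `T X * exp X`. -/
theorem map_expSeries {T : PowerSeries A →ₗ[ℂ] PowerSeries A}
    (hT : ∀ f g, T (f * g) = T f * g + f * T g) (hloc : IsLocal T) {X : PowerSeries A}
    (hX : PowerSeries.coeff 0 X = 0) (hc : Commute (T X) X) :
    T (expSeries X) = T X * expSeries X := by
  have h1 : T 1 = 0 := by
    have := hT 1 1
    rw [mul_one, mul_one, one_mul] at this
    exact left_eq_add.1 this
  ext n
  -- By locality the exponential may be truncated. One power beyond `n` is kept because the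
  -- derivation lowers the exponent by one.
  rw [hloc.congr (g := ∑ j ∈ Finset.range (n + 1 + 1), ((j.factorial : ℂ)⁻¹) • X ^ j)
    fun m hm => coeff_expSeries hX (by omega), map_sum, Finset.sum_range_succ', pow_zero, map_smul,
    h1, smul_zero, add_zero]
  have h2 : ∑ j ∈ Finset.range (n + 1), T ((((j + 1).factorial : ℕ) : ℂ)⁻¹ • X ^ (j + 1)) =
      T X * ∑ j ∈ Finset.range (n + 1), ((j.factorial : ℂ)⁻¹) • X ^ j := by
    rw [Finset.mul_sum]
    refine Finset.sum_congr rfl fun j _ => ?_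
    rw [map_smul, map_pow_of_commute hT hc, smul_smul, mul_smul_comm, Nat.factorial_succ]
    congr 1
    have : (j.factorial : ℂ) ≠ 0 := by exact_mod_cast j.factorial_ne_zero
    have : ((j + 1 : ℕ) : ℂ) ≠ 0 := by exact_mod_cast j.succ_ne_zero
    push_cast at *
    field_simp
  rw [h2, PowerSeries.coeff_mul, PowerSeries.coeff_mul]
  refine Finset.sum_congr rfl fun x hx => ?_
  have := Finset.HasAntidiagonal.mem_antidiagonal.1 hx
  rw [coeff_expSeries hX (show x.2 ≤ n by omega)]

theorem coeff_zero_expSeries (X : PowerSeries A) : PowerSeries.coeff 0 (expSeries X) = 1 := by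
  rw [expSeries, PowerSeries.coeff_mk]
  simp

theorem eq_C_of_theta_eq_zero {f : PowerSeries A} (h : theta f = 0) :
    f = PowerSeries.C (PowerSeries.coeff 0 f) := by
  ext n
  rw [PowerSeries.coeff_C]
  split_ifs with hn
  · rw [hn]
  · have := congrArg (PowerSeries.coeff n) h
    rw [coeff_theta, map_zero] at this
    have h0 : (n : ℂ) ≠ 0 := by exact_mod_cast hn
    rw [← inv_smul_smul₀ h0 (PowerSeries.coeff n f), this, smul_zero]

/-- The Euler operator kills the product, which is therefore its constant term. The coefficients
will be operators, so commutation of `X` with its derivative has to be assumed. -/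
theorem expSeries_mul_expSeries_neg {X : PowerSeries A} (hX : PowerSeries.coeff 0 X = 0)
    (hc : Commute (theta X) X) : expSeries X * expSeries (-X) = 1 := by
  have hE := map_expSeries theta_mul isLocal_theta hX hc
  have hE' := map_expSeries theta_mul isLocal_theta (X := -X) (by rw [map_neg, hX, neg_zero])
    (by rw [map_neg]; exact hc.neg_left.neg_right)
  have hcE : Commute (theta X) (expSeries X) := by
    change _ * _ = _ * _
    ext n
    rw [PowerSeries.coeff_mul, PowerSeries.coeff_mul]
    have h2 := congrArg (PowerSeries.coeff n) ((Commute.sum_right (Finset.range (n + 1))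
      (fun j => ((j.factorial : ℂ)⁻¹) • X ^ j) (theta X)
      fun j _ => (hc.pow_right j).smul_right _).eq)
    rw [PowerSeries.coeff_mul, PowerSeries.coeff_mul] at h2
    refine Eq.trans (Finset.sum_congr rfl fun x hx => ?_)
      (h2.trans (Finset.sum_congr rfl fun x hx => ?_))
    · rw [coeff_expSeries hX (show x.2 ≤ n by have := Finset.HasAntidiagonal.mem_antidiagonal.1 hx; omega)]
    · rw [coeff_expSeries hX (show x.1 ≤ n by have := Finset.HasAntidiagonal.mem_antidiagonal.1 hx; omega)]
  have h : theta (expSeries X * expSeries (-X)) = 0 := by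
    rw [theta_mul, hE, hE', map_neg, ← mul_assoc, mul_neg, neg_mul, ← hcE.eq, add_neg_cancel]
  rw [eq_C_of_theta_eq_zero h, PowerSeries.coeff_mul]
  simp [coeff_zero_expSeries]

end Exp

section Log

variable {R : Type*} [CommRing R] [Algebra ℂ R]

theorem coeff_logOneAdd {X : PowerSeries R} (hX : PowerSeries.coeff 0 X = 0) {n N : ℕ} (h : n ≤ N) :
    PowerSeries.coeff n (logOneAdd X) = PowerSeries.coeff n
      (∑ j ∈ Finset.range N, ((-1) ^ j / ((j + 1 : ℕ) : ℂ)) • X ^ (j + 1)) := by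
  have hIcc : Finset.Icc 1 n = (Finset.range n).map (addRightEmbedding 1) := by
    rw [Finset.range_eq_Ico, Finset.map_add_right_Ico, zero_add]
    rfl
  rw [logOneAdd, PowerSeries.coeff_mk, map_sum, hIcc, Finset.sum_map]
  refine Eq.trans (Finset.sum_congr rfl fun j _ => ?_)
    (Finset.sum_subset (Finset.range_mono h) fun j _ hj => ?_)
  · rw [PowerSeries.coeff_smul, addRightEmbedding_apply, pow_add (-1 : ℂ), pow_add (-1 : ℂ)]
    norm_num
  · rw [Finset.mem_range, not_lt] at hj
    rw [PowerSeries.coeff_smul, coeff_pow_of_lt hX (by omega), smul_zero]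

/-- A derivation of formal series applied to a logarithm. -/
theorem map_logOneAdd {T : PowerSeries R →ₗ[ℂ] PowerSeries R}
    (hT : ∀ f g, T (f * g) = T f * g + f * T g) (hloc : IsLocal T) {X : PowerSeries R}
    (hX : PowerSeries.coeff 0 X = 0) : T (logOneAdd X) * (1 + X) = T X := by
  ext n
  -- The truncated logarithm differentiates to a finite geometric sum, whose remainder has order
  -- above `n`.
  have h2 : T (∑ j ∈ Finset.range (n + 1), ((-1) ^ j / ((j + 1 : ℕ) : ℂ)) • X ^ (j + 1)) * (1 + X) =
      T X - T X * (-X) ^ (n + 1) := by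
    have : T (∑ j ∈ Finset.range (n + 1), ((-1) ^ j / ((j + 1 : ℕ) : ℂ)) • X ^ (j + 1)) =
        T X * ∑ j ∈ Finset.range (n + 1), (-X) ^ j := by
      rw [map_sum, Finset.mul_sum]
      refine Finset.sum_congr rfl fun j _ => ?_
      rw [map_smul, map_pow_of_commute hT (Commute.all _ _), smul_smul, div_mul_cancel₀ _
        (by exact_mod_cast j.succ_ne_zero), neg_pow X j, ← mul_smul_comm]
      congr 1
      rw [Algebra.smul_def, map_pow, map_neg, map_one]
    have hg := geom_sum_mul_neg (-X) (n + 1)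
    rw [sub_neg_eq_add] at hg
    rw [this, mul_assoc, hg, mul_sub, mul_one]
  have h3 : PowerSeries.coeff n (T X * (-X) ^ (n + 1)) = 0 := by
    rw [PowerSeries.coeff_mul]
    refine Finset.sum_eq_zero fun x hx => ?_
    have hx1 := Finset.HasAntidiagonal.mem_antidiagonal.1 hx
    rw [coeff_pow_of_lt (by rw [map_neg, hX, neg_zero]) (show x.2 < n + 1 by omega), mul_zero]
  have h4 := congrArg (PowerSeries.coeff n) h2
  rw [map_sub, h3, sub_zero] at h4
  rw [← h4, PowerSeries.coeff_mul, PowerSeries.coeff_mul]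
  refine Finset.sum_congr rfl fun x hx => ?_
  have hx1 := Finset.HasAntidiagonal.mem_antidiagonal.1 hx
  rw [hloc.congr fun m (hm : m ≤ x.1) => coeff_logOneAdd hX (show m ≤ n + 1 by omega)]

end Log


/-! ### Shift operators as exponentials of commuting derivations -/

section Shift

variable {R : Type*} [CommRing R] [Algebra ℂ R]

/-- The exponent of the shift operator. -/
noncomputable def shiftExponent (δ : ℕ → Derivation ℂ R R) (e : ℂ) :
    PowerSeries (Module.End ℂ R) :=
  PowerSeries.mk fun k => if 0 < k then (e / (k : ℂ)) • ((δ (k - 1)).toLinearMap : Module.End ℂ R)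
    else 0

/-- The coefficients of the operator `exp (e ∑_{k ≥ 1} u^k δ_{k-1} / k)`. -/
noncomputable def hs (δ : ℕ → Derivation ℂ R R) (e : ℂ) (n : ℕ) : R →ₗ[ℂ] R :=
  PowerSeries.coeff n (expSeries (shiftExponent δ e))

/-- The derivations of a family commute. -/
def CommDer (δ : ℕ → Derivation ℂ R R) : Prop := ∀ i j x, δ i (δ j x) = δ j (δ i x)

variable {δ : ℕ → Derivation ℂ R R}

theorem coeff_zero_shiftExponent (e : ℂ) : PowerSeries.coeff 0 (shiftExponent δ e) = 0 := by
  rw [shiftExponent, PowerSeries.coeff_mk, if_neg (lt_irrefl 0)]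

theorem coeff_theta_shiftExponent (e : ℂ) (k : ℕ) :
    PowerSeries.coeff (k + 1) (theta (shiftExponent δ e)) =
      e • ((δ k).toLinearMap : Module.End ℂ R) := by
  rw [coeff_theta, shiftExponent, PowerSeries.coeff_mk, if_pos k.succ_pos, smul_smul,
    mul_div_cancel₀ _ (by exact_mod_cast k.succ_ne_zero), Nat.add_sub_cancel]

theorem coeff_zero_theta {A : Type*} [Ring A] [Algebra ℂ A] (f : PowerSeries A) :
    PowerSeries.coeff 0 (theta f) = 0 := by
  rw [coeff_theta, Nat.cast_zero, zero_smul]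

theorem CommDer.commute_coeff (h : CommDer δ) (e e' : ℂ) (m n : ℕ) :
    Commute (PowerSeries.coeff m (shiftExponent δ e)) (PowerSeries.coeff n (shiftExponent δ e')) := by
  rw [shiftExponent, shiftExponent, PowerSeries.coeff_mk, PowerSeries.coeff_mk]
  have : ∀ i j, Commute ((δ i).toLinearMap : Module.End ℂ R) (δ j).toLinearMap := fun i j =>
    LinearMap.ext fun x => h i j x
  split_ifs
  · exact ((this _ _).smul_left _).smul_right _
  · exact Commute.zero_right _
  · exact Commute.zero_left _
  · exact Commute.zero_left _

theorem CommDer.commute_theta (h : CommDer δ) (e : ℂ) :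
    Commute (theta (shiftExponent δ e)) (shiftExponent δ e) := by
  change _ * _ = _ * _
  ext1 n
  rw [PowerSeries.coeff_mul, PowerSeries.coeff_mul, ← Finset.Nat.sum_antidiagonal_swap]
  refine Finset.sum_congr rfl fun x _ => ?_
  rw [Prod.fst_swap, Prod.snd_swap, coeff_theta]
  exact ((h.commute_coeff e e x.2 x.1).smul_left (x.2 : ℂ)).eq

theorem hs_eq (e : ℂ) (n : ℕ) (x : R) :
    hs δ e n x = (PowerSeries.coeff n (expSeries (shiftExponent δ e)) : Module.End ℂ R) x := rfl

attribute [irreducible] hs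

theorem hs_zero (e : ℂ) (x : R) : hs δ e 0 x = x := by
  rw [hs_eq, coeff_zero_expSeries]
  rfl

/-- The coefficient comparison in θ(exp E) = θ(E) exp E. As n + 1 is invertible, this recursion
characterises the shifts, and it replaces the exponential series in later inductions. -/
theorem hs_succ (h : CommDer δ) (e : ℂ) (n : ℕ) (x : R) :
    ((n + 1 : ℕ) : ℂ) • hs δ e (n + 1) x =
      e • ∑ j ∈ Finset.range (n + 1), δ j (hs δ e (n - j) x) := by
  have h0 := map_expSeries (X := shiftExponent δ e) theta_mul isLocal_theta
    (coeff_zero_shiftExponent e) (h.commute_theta e)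
  have h1 : ((n + 1 : ℕ) : ℂ) • PowerSeries.coeff (n + 1) (expSeries (shiftExponent δ e)) =
      ∑ j ∈ Finset.range (n + 1), (e • ((δ j).toLinearMap : Module.End ℂ R)) *
        PowerSeries.coeff (n - j) (expSeries (shiftExponent δ e)) := by
    rw [← coeff_theta, h0, PowerSeries.coeff_mul,
      Finset.Nat.sum_antidiagonal_eq_sum_range_succ_mk, Finset.sum_range_succ']
    dsimp only
    rw [coeff_zero_theta, zero_mul, add_zero]
    refine Finset.sum_congr rfl fun j _ => ?_
    rw [coeff_theta_shiftExponent, Nat.add_sub_add_right]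
  have h2 := LinearMap.congr_fun h1 x
  rw [LinearMap.smul_apply, LinearMap.sum_apply] at h2
  rw [Finset.smul_sum]
  simp only [hs_eq]
  rw [h2]
  refine Finset.sum_congr rfl fun j _ => ?_
  rw [Module.End.mul_apply, LinearMap.smul_apply, Derivation.coeFn_coe]

theorem smul_cancel {n : ℕ} {M : Type*} [AddCommGroup M] [Module ℂ M] {x y : M}
    (h : ((n + 1 : ℕ) : ℂ) • x = ((n + 1 : ℕ) : ℂ) • y) : x = y := by
  have hn : ((n + 1 : ℕ) : ℂ) ≠ 0 := by exact_mod_cast n.succ_ne_zero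
  rw [← inv_smul_smul₀ hn x, h, inv_smul_smul₀ hn]

/-- Maps compatible with the derivations are compatible with the shifts. -/
theorem map_hs {R' : Type*} [CommRing R'] [Algebra ℂ R'] {δ' : ℕ → Derivation ℂ R' R'}
    (h : CommDer δ) (h' : CommDer δ') (T : R →ₗ[ℂ] R') (hT : ∀ j x, T (δ j x) = δ' j (T x))
    (e : ℂ) (n : ℕ) (x : R) : T (hs δ e n x) = hs δ' e n (T x) := by
  induction n using Nat.strong_induction_on with
  | _ n ih =>
    rcases n with _ | n
    · rw [hs_zero, hs_zero]
    · refine smul_cancel (n := n) ?_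
      rw [← map_smul, hs_succ h, hs_succ h', map_smul, map_sum]
      congr 1
      refine Finset.sum_congr rfl fun j _ => ?_
      rw [hT, ih _ (by omega)]

/-- A derivation acting on the coefficients of power series. -/
noncomputable def mapDer (d : Derivation ℂ R R) : Derivation ℂ (PowerSeries R) (PowerSeries R) :=
  Derivation.mk'
    { toFun := fun f => PowerSeries.mk fun n => d (PowerSeries.coeff n f)
      map_add' := fun f g => by
        ext n
        rw [map_add, PowerSeries.coeff_mk, PowerSeries.coeff_mk, PowerSeries.coeff_mk, map_add,
          map_add]
      map_smul' := fun c f => by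
        ext n
        rw [PowerSeries.coeff_mk, RingHom.id_apply, PowerSeries.coeff_smul,
          PowerSeries.coeff_smul, PowerSeries.coeff_mk, Derivation.map_smul] }
    fun f g => by
      ext n
      simp only [LinearMap.coe_mk, AddHom.coe_mk, smul_eq_mul]
      rw [map_add, PowerSeries.coeff_mk, mul_comm g, PowerSeries.coeff_mul, PowerSeries.coeff_mul,
        PowerSeries.coeff_mul, map_sum, ← Finset.sum_add_distrib]
      refine Finset.sum_congr rfl fun x _ => ?_
      rw [PowerSeries.coeff_mk, PowerSeries.coeff_mk, Derivation.leibniz, smul_eq_mul, smul_eq_mul]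
      ring

theorem coeff_mapDer (d : Derivation ℂ R R) (f : PowerSeries R) (n : ℕ) :
    PowerSeries.coeff n (mapDer d f) = d (PowerSeries.coeff n f) := by
  change PowerSeries.coeff n (PowerSeries.mk fun n => d (PowerSeries.coeff n f)) = _
  rw [PowerSeries.coeff_mk]

/-- The derivation `X d/dX` of power series. -/
noncomputable def thetaDer : Derivation ℂ (PowerSeries R) (PowerSeries R) :=
  Derivation.mk' theta fun f g => by
    rw [theta_mul, smul_eq_mul, smul_eq_mul, add_comm, mul_comm g]

/-- The derivation `X d/dX + c ∑_{j < N} X^{j+1} δ_j`. -/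
noncomputable def nablaTrunc (δ : ℕ → Derivation ℂ R R) (c : ℂ) (N : ℕ) :
    Derivation ℂ (PowerSeries R) (PowerSeries R) :=
  thetaDer + ∑ j ∈ Finset.range N, c • (PowerSeries.X ^ (j + 1) : PowerSeries R) • mapDer (δ j)

/-- The coefficients of `(X d/dX + c ∑_j X^{j+1} δ_j) f`. -/
noncomputable def nablaCoeff (δ : ℕ → Derivation ℂ R R) (c : ℂ) (f : PowerSeries R) (n : ℕ) : R :=
  (n : ℂ) • PowerSeries.coeff n f +
    c • ∑ j ∈ Finset.range n, δ j (PowerSeries.coeff (n - 1 - j) f)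

theorem coeff_nablaTrunc (c : ℂ) {n N : ℕ} (h : n ≤ N) (f : PowerSeries R) :
    PowerSeries.coeff n (nablaTrunc δ c N f) = nablaCoeff δ c f n := by
  rw [nablaTrunc, Derivation.add_apply, map_add, nablaCoeff]
  congr 1
  · exact coeff_theta f n
  · rw [← Derivation.coeFnAddMonoidHom_apply, map_sum, Finset.sum_apply, map_sum, Finset.smul_sum]
    refine (Finset.sum_subset_zero_on_sdiff (Finset.range_mono h) ?_ ?_).symm
    · intro j hj
      simp only [Finset.mem_sdiff, Finset.mem_range] at hj
      rw [Derivation.coeFnAddMonoidHom_apply, Derivation.smul_apply, Derivation.smul_apply, PowerSeries.coeff_smul, smul_eq_mul,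
        PowerSeries.coeff_X_pow_mul', if_neg (by omega), smul_zero]
    · intro j hj
      rw [Finset.mem_range] at hj
      rw [Derivation.coeFnAddMonoidHom_apply, Derivation.smul_apply, Derivation.smul_apply, PowerSeries.coeff_smul, smul_eq_mul,
        PowerSeries.coeff_X_pow_mul', if_pos (by omega), coeff_mapDer,
        show n - (j + 1) = n - 1 - j by omega]

/-- The derivation `X d/dX + c ∑_j X^{j+1} δ_j` of power series. -/
noncomputable def nabla (δ : ℕ → Derivation ℂ R R) (c : ℂ) :
    Derivation ℂ (PowerSeries R) (PowerSeries R) :=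
  Derivation.mk'
    { toFun := fun f => PowerSeries.mk (nablaCoeff δ c f)
      map_add' := fun f g => by
        ext n
        rw [map_add, PowerSeries.coeff_mk, PowerSeries.coeff_mk, PowerSeries.coeff_mk,
          ← coeff_nablaTrunc c le_rfl, map_add, map_add, coeff_nablaTrunc c le_rfl,
          coeff_nablaTrunc c le_rfl]
      map_smul' := fun a f => by
        ext n
        rw [PowerSeries.coeff_mk, RingHom.id_apply, PowerSeries.coeff_smul, PowerSeries.coeff_mk,
          ← coeff_nablaTrunc c le_rfl, Derivation.map_smul, PowerSeries.coeff_smul,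
          coeff_nablaTrunc c le_rfl] }
    fun f g => by
      ext n
      simp only [LinearMap.coe_mk, AddHom.coe_mk, smul_eq_mul]
      -- Each coefficient involves finitely many `δ j` only, so the Leibniz rule is inherited from
      -- the truncated derivation.
      rw [map_add, PowerSeries.coeff_mk, ← coeff_nablaTrunc c le_rfl, Derivation.leibniz, map_add,
        smul_eq_mul, smul_eq_mul, PowerSeries.coeff_mul, PowerSeries.coeff_mul,
        PowerSeries.coeff_mul, PowerSeries.coeff_mul]
      congr 1
      all_goals
        refine Finset.sum_congr rfl fun x hx => ?_
        have := Finset.HasAntidiagonal.mem_antidiagonal.1 hx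
        rw [PowerSeries.coeff_mk, coeff_nablaTrunc c (by omega)]

theorem coeff_nabla (c : ℂ) (f : PowerSeries R) (n : ℕ) :
    PowerSeries.coeff n (nabla δ c f) = (n : ℂ) • PowerSeries.coeff n f +
      c • ∑ j ∈ Finset.range n, δ j (PowerSeries.coeff (n - 1 - j) f) := by
  change PowerSeries.coeff n (PowerSeries.mk (nablaCoeff δ c f)) = _
  rw [PowerSeries.coeff_mk, nablaCoeff]

theorem isLocal_nabla (c : ℂ) : IsLocal (nabla δ c).toLinearMap := fun n f h => by
  change PowerSeries.coeff n (nabla δ c f) = 0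
  rw [coeff_nabla, h n le_rfl, smul_zero, Finset.sum_eq_zero, smul_zero, add_zero]
  intro j hj
  rw [h _ (by omega), map_zero]

theorem coeff_nabla_C_succ (x : R) (n : ℕ) (c : ℂ) :
    PowerSeries.coeff (n + 1) (nabla δ c (PowerSeries.C x)) = c • δ n x := by
  rw [coeff_nabla, PowerSeries.coeff_C, if_neg n.succ_ne_zero, smul_zero, zero_add,
    Finset.sum_eq_single_of_mem n (Finset.self_mem_range_succ n)]
  · simp
  · intro j hj hjn
    rw [Finset.mem_range] at hj
    rw [PowerSeries.coeff_C, if_neg (by omega), map_zero]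

theorem coeff_nabla_zero (c : ℂ) (f : PowerSeries R) : PowerSeries.coeff 0 (nabla δ c f) = 0 := by
  rw [coeff_nabla, Nat.cast_zero, zero_smul, Finset.range_zero, Finset.sum_empty, smul_zero,
    add_zero]

/-- Coefficient n + 1 of the equation expresses (n + 1) fₙ₊₁ through earlier coefficients, so a
series annihilated by ∇ is determined by its constant term. This is the uniqueness principle behind
multiplicativity of shifts and the tau function formulas. -/
theorem eq_of_nabla_eq_zero (c : ℂ) {f g : PowerSeries R} (hf : nabla δ c f = 0)
    (hg : nabla δ c g = 0) (h : PowerSeries.coeff 0 f = PowerSeries.coeff 0 g) : f = g := by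
  ext n
  induction n using Nat.strong_induction_on with
  | _ n ih =>
    rcases n with _ | n
    · exact h
    · refine smul_cancel (n := n) ?_
      have h1 := congrArg (PowerSeries.coeff (n + 1)) (hf.trans hg.symm)
      rw [coeff_nabla, coeff_nabla] at h1
      rw [Finset.sum_congr rfl fun j (hj : j ∈ Finset.range (n + 1)) => by
        rw [ih (n + 1 - 1 - j) (by omega)]] at h1
      exact add_right_cancel h1

/-- As a function of v, the shift x(t + e[v]) changes only through t: v d/dv acts on it as e ∑
v^{j+1} δ_j. -/
theorem nabla_shift (h : CommDer δ) (e : ℂ) (x : R) :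
    nabla δ (-e) (PowerSeries.mk fun n => hs δ e n x) = 0 := by
  ext n
  rw [map_zero]
  rcases n with _ | n
  · rw [coeff_nabla_zero]
  · rw [coeff_nabla, PowerSeries.coeff_mk, hs_succ h, neg_smul, add_neg_eq_zero]
    congr 1
    refine Finset.sum_congr rfl fun j _ => ?_
    rw [PowerSeries.coeff_mk, Nat.add_sub_cancel]

/-- The shift `exp (e ∑_k u^k δ_{k-1} / k)`, as a homomorphism to power series. -/
noncomputable def shiftHom (δ : ℕ → Derivation ℂ R R) (h : CommDer δ) (e : ℂ) :
    R →+* PowerSeries R where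
  toFun x := PowerSeries.mk fun n => hs δ e n x
  map_one' := by
    refine eq_of_nabla_eq_zero (δ := δ) (-e) (nabla_shift h e 1) (Derivation.map_one_eq_zero _) ?_
    rw [PowerSeries.coeff_mk, hs_zero, PowerSeries.coeff_zero_one]
  map_mul' x y := by
    -- The shift of a product and the product of the shifts are both annihilated by the same
    -- derivation and share the constant term x y.
    refine eq_of_nabla_eq_zero (δ := δ) (-e) (nabla_shift h e _) ?_ ?_
    · rw [Derivation.leibniz, nabla_shift h, nabla_shift h, smul_zero, smul_zero, add_zero]
    · rw [PowerSeries.coeff_mk, hs_zero, PowerSeries.coeff_mul, Finset.Nat.antidiagonal_zero,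
        Finset.sum_singleton, PowerSeries.coeff_mk, PowerSeries.coeff_mk, hs_zero, hs_zero]
  map_zero' := by
    ext n
    rw [PowerSeries.coeff_mk, map_zero, map_zero]
  map_add' x y := by
    ext n
    rw [map_add, PowerSeries.coeff_mk, PowerSeries.coeff_mk, PowerSeries.coeff_mk, map_add]

end Shift


/-! ### Double series and the integrability condition -/

section Series

variable {R : Type*} [CommRing R] [Algebra ℂ R] {δ δ' : ℕ → Derivation ℂ R R}

theorem coeff_shiftHom (h : CommDer δ) (e : ℂ) (x : R) (n : ℕ) :
    PowerSeries.coeff n (shiftHom δ h e x) = hs δ e n x := by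
  change PowerSeries.coeff n (PowerSeries.mk fun n => hs δ e n x) = _
  rw [PowerSeries.coeff_mk]

theorem shiftExponent_neg (e : ℂ) : shiftExponent δ (-e) = -shiftExponent δ e := by
  ext1 n
  rw [map_neg, shiftExponent, shiftExponent, PowerSeries.coeff_mk, PowerSeries.coeff_mk]
  split_ifs
  · rw [neg_div]
    exact neg_smul (e / (n : ℂ)) ((δ (n - 1)).toLinearMap : Module.End ℂ R)
  · rw [neg_zero]

/-- Opposite shifts are inverse to each other. -/
theorem sum_hs_hs_neg (h : CommDer δ) (e : ℂ) (n : ℕ) (x : R) :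
    ∑ p ∈ Finset.HasAntidiagonal.antidiagonal n, hs δ e p.1 (hs δ (-e) p.2 x) =
      if n = 0 then x else 0 := by
  have h1 := congrArg (PowerSeries.coeff n) (expSeries_mul_expSeries_neg (X := shiftExponent δ e)
    (coeff_zero_shiftExponent e) (h.commute_theta e))
  rw [PowerSeries.coeff_mul, PowerSeries.coeff_one, ← shiftExponent_neg] at h1
  have h2 := LinearMap.congr_fun h1 x
  rw [LinearMap.sum_apply] at h2
  simp only [hs_eq]
  refine h2.trans ?_
  split_ifs <;> rfl

theorem CommDer.mapDer (h : CommDer δ) : CommDer fun j => mapDer (δ j) := fun i j x => by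
  ext n
  rw [coeff_mapDer, coeff_mapDer, coeff_mapDer, coeff_mapDer, h]

/-- Exchange of the two variables of a double series. -/
noncomputable def swap : PowerSeries (PowerSeries R) →+* PowerSeries (PowerSeries R) where
  toFun f := PowerSeries.mk fun n => PowerSeries.mk fun m =>
    PowerSeries.coeff n (PowerSeries.coeff m f)
  map_one' := by
    ext n m
    simp only [PowerSeries.coeff_mk, PowerSeries.coeff_one]
    by_cases hn : n = 0 <;> by_cases hm : m = 0 <;> simp [hn, hm, PowerSeries.coeff_one]
  map_zero' := by
    ext n m
    simp only [PowerSeries.coeff_mk, map_zero]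
  map_add' f g := by
    ext n m
    simp only [PowerSeries.coeff_mk, map_add]
  map_mul' f g := by
    ext n m
    simp only [PowerSeries.coeff_mk, PowerSeries.coeff_mul, map_sum]
    exact Finset.sum_comm

theorem coeff_swap (f : PowerSeries (PowerSeries R)) (n m : ℕ) :
    PowerSeries.coeff m (PowerSeries.coeff n (swap f)) =
      PowerSeries.coeff n (PowerSeries.coeff m f) := by
  change PowerSeries.coeff m (PowerSeries.coeff n (PowerSeries.mk fun n => PowerSeries.mk fun m =>
    PowerSeries.coeff n (PowerSeries.coeff m f))) = _
  rw [PowerSeries.coeff_mk, PowerSeries.coeff_mk]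

/-- A series in the inner variable as a double series. -/
noncomputable abbrev inner : PowerSeries R →+* PowerSeries (PowerSeries R) := PowerSeries.C

/-- A series in the outer variable as a double series. -/
noncomputable abbrev outer : PowerSeries R →+* PowerSeries (PowerSeries R) :=
  PowerSeries.map PowerSeries.C

theorem swap_inner (f : PowerSeries R) : swap (inner f) = outer f := by
  ext n m
  rw [coeff_swap, PowerSeries.coeff_C, PowerSeries.coeff_map, PowerSeries.coeff_C]
  split_ifs <;> simp

theorem swap_outer (f : PowerSeries R) : swap (outer f) = inner f := by
  ext n m
  rw [coeff_swap, PowerSeries.coeff_C, PowerSeries.coeff_map, PowerSeries.coeff_C]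
  split_ifs <;> simp

/-- The derivation `v d/dv + ∑_j v^{j+1} δ_j` in the outer variable. -/
noncomputable abbrev nablaOuter (δ : ℕ → Derivation ℂ R R) :
    Derivation ℂ (PowerSeries (PowerSeries R)) (PowerSeries (PowerSeries R)) :=
  nabla (fun j => mapDer (δ j)) 1

/-- The derivation `u d/du + ∑_j u^{j+1} δ_j` in the inner variable. -/
noncomputable abbrev nablaInner (δ : ℕ → Derivation ℂ R R) :
    Derivation ℂ (PowerSeries (PowerSeries R)) (PowerSeries (PowerSeries R)) :=
  mapDer (nabla δ 1)

theorem nablaInner_swap (f : PowerSeries (PowerSeries R)) :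
    nablaInner δ (swap f) = swap (nablaOuter δ f) := by
  ext n m
  rw [coeff_swap, coeff_mapDer, coeff_nabla, coeff_nabla, map_add, PowerSeries.coeff_smul,
    PowerSeries.coeff_smul, map_sum, coeff_swap]
  simp only [coeff_mapDer, coeff_swap]

theorem nablaOuter_outer (f : PowerSeries R) :
    nablaOuter δ (outer f) = outer (nabla δ 1 f) := by
  ext n m
  rw [coeff_nabla, PowerSeries.coeff_map, PowerSeries.coeff_map, coeff_nabla, map_add,
    PowerSeries.coeff_smul, PowerSeries.coeff_smul, map_sum]
  simp only [coeff_mapDer, PowerSeries.coeff_map, PowerSeries.coeff_C]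
  split_ifs
  · rfl
  · simp

theorem nablaInner_inner (f : PowerSeries R) :
    nablaInner δ (inner f) = inner (nabla δ 1 f) := by
  rw [← swap_outer, nablaInner_swap, nablaOuter_outer, swap_outer]

theorem nabla_comm (hδ : ∀ i j x, δ i (δ' j x) = δ' j (δ i x)) (f : PowerSeries (PowerSeries R)) :
    nablaInner δ' (nablaOuter δ f) = nablaOuter δ (nablaInner δ' f) := by
  have h : ∀ j (x : PowerSeries R), nabla δ' 1 (mapDer (δ j) x) = mapDer (δ j) (nabla δ' 1 x) := by
    intro j x
    ext m
    rw [coeff_mapDer, coeff_nabla, coeff_nabla, map_add, Derivation.map_smul, Derivation.map_smul,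
      map_sum]
    simp only [coeff_mapDer, hδ]
  ext1 n
  rw [coeff_mapDer, coeff_nabla, coeff_nabla, map_add, Derivation.map_smul, Derivation.map_smul,
    map_sum]
  simp only [coeff_mapDer, h]

/-- The integrability condition from a joint solution of two linear equations. -/
theorem deriv_coeff_comm (hδ : ∀ i j x, δ i (δ' j x) = δ' j (δ i x)) {f g : PowerSeries R}
    {H : PowerSeries (PowerSeries R)} (hH : IsUnit H) (h1 : nablaOuter δ H = outer f * H)
    (h2 : nablaInner δ' H = inner g * H) (n m : ℕ) :
    δ' m (PowerSeries.coeff (n + 1) f) = δ n (PowerSeries.coeff (m + 1) g) := by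
  have h := nabla_comm hδ H
  rw [h1, h2, Derivation.leibniz, Derivation.leibniz, h1, h2, smul_eq_mul, smul_eq_mul, smul_eq_mul,
    smul_eq_mul] at h
  -- In the two mixed derivatives of `H` the terms with f(v) g(u) H agree and cancel. The unit `H`
  -- can then be removed and a single coefficient read off.
  have h3 : H * nablaInner δ' (outer f) = H * nablaOuter δ (inner g) := by
    linear_combination h
  have h4 := congrArg (fun X => PowerSeries.coeff (m + 1) (PowerSeries.coeff (n + 1) X))
    (hH.mul_left_cancel h3)
  simp only [coeff_mapDer, coeff_nabla_C_succ, PowerSeries.coeff_map, one_smul] at h4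
  exact h4

/-- Symmetry of `H` turns the equation in the outer variable into the same equation in the inner
one. -/
theorem deriv_coeff_comm_self (h : CommDer δ) {f : PowerSeries R}
    {H : PowerSeries (PowerSeries R)} (hH : IsUnit H) (hs : swap H = H)
    (h1 : nablaOuter δ H = outer f * H) (n m : ℕ) :
    δ m (PowerSeries.coeff (n + 1) f) = δ n (PowerSeries.coeff (m + 1) f) := by
  refine deriv_coeff_comm h hH h1 ?_ n m
  have := nablaInner_swap (δ := δ) H
  rw [hs, h1, map_mul, swap_outer, hs] at this
  exact this

/-- The shift in the outer variable. -/
noncomputable def shiftOuter (h : CommDer δ) : PowerSeries R →+* PowerSeries (PowerSeries R) :=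
  shiftHom (fun j => mapDer (δ j)) h.mapDer (-1)

/-- The shift in the inner variable. -/
noncomputable def shiftInner (h : CommDer δ) : PowerSeries R →+* PowerSeries (PowerSeries R) :=
  PowerSeries.map (shiftHom δ h (-1))

theorem nablaOuter_shiftOuter (h : CommDer δ) (f : PowerSeries R) :
    nablaOuter δ (shiftOuter h f) = 0 := by
  have := nabla_shift h.mapDer (-1) f
  rw [neg_neg] at this
  exact this

theorem nabla_shiftHom (h : CommDer δ) (x : R) : nabla δ 1 (shiftHom δ h (-1) x) = 0 := by
  have := nabla_shift h (-1) x
  rw [neg_neg] at this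
  exact this

theorem nablaInner_shiftInner (h : CommDer δ) (f : PowerSeries R) :
    nablaInner δ (shiftInner h f) = 0 := by
  ext1 n
  rw [coeff_mapDer, shiftInner, PowerSeries.coeff_map, nabla_shiftHom, map_zero]

theorem coeff_shiftOuter (h : CommDer δ) (f : PowerSeries R) (n m : ℕ) :
    PowerSeries.coeff m (PowerSeries.coeff n (shiftOuter h f)) =
      hs δ (-1) n (PowerSeries.coeff m f) := by
  rw [shiftOuter, coeff_shiftHom]
  refine map_hs h.mapDer h ((PowerSeries.coeff m : PowerSeries R →ₗ[R] R).restrictScalars ℂ)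
    (fun j x => ?_) (-1) n f
  exact coeff_mapDer _ _ _

theorem shiftInner_eq_swap (h : CommDer δ) (f : PowerSeries R) :
    shiftInner h f = swap (shiftOuter h f) := by
  ext n m
  rw [coeff_swap, coeff_shiftOuter, shiftInner, PowerSeries.coeff_map, coeff_shiftHom]

theorem isUnit_of_coeff_zero {A : Type*} [CommRing A] {f : PowerSeries A}
    (h : IsUnit (PowerSeries.coeff 0 f)) : IsUnit f :=
  PowerSeries.isUnit_iff_constantCoeff.2 (by rwa [PowerSeries.coeff_zero_eq_constantCoeff_apply] at h)

/-- The difference of the two variables of a double series is not a zero divisor. -/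
theorem sub_mul_cancel {F G : PowerSeries (PowerSeries R)}
    (h : (inner PowerSeries.X - PowerSeries.X) * F = (inner PowerSeries.X - PowerSeries.X) * G) :
    F = G := by
  rw [← sub_eq_zero, ← mul_sub] at h
  rw [← sub_eq_zero]
  set K := F - G
  have h0 : ∀ n m, PowerSeries.coeff m (PowerSeries.coeff n K) = 0 := by
    intro n
    induction n with
    | zero =>
      intro m
      have := congrArg (fun X => PowerSeries.coeff (m + 1) (PowerSeries.coeff 0 X)) h
      simp only [sub_mul, map_sub, PowerSeries.coeff_C_mul, PowerSeries.coeff_zero_X_mul,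
        PowerSeries.coeff_succ_X_mul, map_zero, sub_zero] at this
      exact this
    | succ n ih =>
      intro m
      have := congrArg (fun X => PowerSeries.coeff (m + 1) (PowerSeries.coeff (n + 1) X)) h
      simp only [sub_mul, map_sub, PowerSeries.coeff_C_mul,
        PowerSeries.coeff_succ_X_mul, map_zero, ih, sub_zero] at this
      exact this
  ext n m
  rw [h0, map_zero, map_zero]

end Series


/-! ### Closedness from the shift equations -/

section TauEquations

variable {R : Type*} [CommRing R] [Algebra ℂ R]

/-- The derivations `∂/∂t_{ν,j+1}`, `j ≥ 0`. -/
def timeDer (D : TimeIndex → Derivation ℂ R R) (ν : Fin 2) (j : ℕ) : Derivation ℂ R R :=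
  D (ν, j.succPNat)

/-- Equations for the effect of shifts of the times on the amplitudes `φ`, `ψ` of two wave
functions. -/
structure ShiftEquations (D : TimeIndex → Derivation ℂ R R) (h₀ : CommDer (timeDer D 0))
    (h₁ : CommDer (timeDer D 1)) (φ ψ : PowerSeries R) (ε ε' β' q : R) (c : PowerSeries R) :
    Prop where
  comm : ∀ i j x, D i (D j x) = D j (D i x)
  mul_inv : ε * ε' = 1
  coeff_φ : PowerSeries.coeff 0 φ = 1
  coeff_ψ : PowerSeries.coeff 0 ψ = ε
  outer_φ : (inner PowerSeries.X - PowerSeries.X) * shiftOuter h₀ φ =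
    outer c * inner (PowerSeries.X * φ) -
      PowerSeries.X * inner (φ + PowerSeries.X * mapDer (D (0, 1)) φ)
  outer_ψ : shiftOuter h₀ ψ = outer c * inner ψ - PowerSeries.X * inner (mapDer (D (0, 1)) ψ)
  shift_ε : shiftHom _ h₀ (-1) ε = c * PowerSeries.C ε - PowerSeries.X * PowerSeries.C (β' * ε)
  outer_ψ' : (inner PowerSeries.X - PowerSeries.X) * shiftOuter h₁ ψ = inner (PowerSeries.X * ψ) -
    PowerSeries.X * outer (PowerSeries.C ε' * shiftHom _ h₁ (-1) ε) *
      inner (ψ + PowerSeries.X * mapDer (D (1, 1)) ψ)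
  outer_φ' : shiftOuter h₁ φ = inner φ - PowerSeries.X *
    outer (PowerSeries.C ε' * shiftHom _ h₁ (-1) ε) * inner (mapDer (D (1, 1)) φ)
  diag_φ : c * φ = φ + PowerSeries.X * mapDer (D (0, 1)) φ
  diag_ψ : PowerSeries.C ε' * shiftHom _ h₁ (-1) ε * (ψ + PowerSeries.X * mapDer (D (1, 1)) ψ) = ψ
  cross_φ : PowerSeries.X * mapDer (D (0, 1)) (mapDer (D (1, 1)) φ) + mapDer (D (1, 1)) φ =
    PowerSeries.X * (PowerSeries.C β' * mapDer (D (1, 1)) φ + PowerSeries.C q * φ)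
  cross_ψ : PowerSeries.X * mapDer (D (1, 1)) (mapDer (D (0, 1)) ψ) + mapDer (D (0, 1)) ψ =
    PowerSeries.C β' * (ψ + PowerSeries.X * mapDer (D (1, 1)) ψ) +
      PowerSeries.X * (PowerSeries.C q * ψ)

variable {D : TimeIndex → Derivation ℂ R R} {h₀ : CommDer (timeDer D 0)}
  {h₁ : CommDer (timeDer D 1)} {φ ψ : PowerSeries R} {ε ε' β' q : R} {c : PowerSeries R}

theorem outer_X : outer (PowerSeries.X : PowerSeries R) = PowerSeries.X := PowerSeries.map_X _

theorem swap_X : swap (PowerSeries.X : PowerSeries (PowerSeries R)) = inner PowerSeries.X := by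
  rw [← outer_X, swap_outer]

theorem outer_C (x : R) : outer (PowerSeries.C x) = inner (PowerSeries.C x) := PowerSeries.map_C _ _

theorem shiftOuter_C {δ : ℕ → Derivation ℂ R R} (h : CommDer δ) (x : R) :
    shiftOuter h (PowerSeries.C x) = outer (shiftHom δ h (-1) x) := by
  ext n m
  rw [coeff_shiftOuter, PowerSeries.coeff_map, PowerSeries.coeff_C, PowerSeries.coeff_C,
    coeff_shiftHom]
  split_ifs
  · rfl
  · rw [map_zero]

theorem shiftOuter_X {δ : ℕ → Derivation ℂ R R} (h : CommDer δ) :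
    shiftOuter h PowerSeries.X = inner PowerSeries.X := by
  ext n m
  rw [coeff_shiftOuter, PowerSeries.coeff_X, PowerSeries.coeff_C]
  have h1 := coeff_shiftHom h (-1) 1 n
  rw [map_one, PowerSeries.coeff_one] at h1
  split_ifs with hm hn hn
  · rw [← h1, if_pos hn, PowerSeries.coeff_X, if_pos hm]
  · rw [← h1, if_neg hn, map_zero]
  · rw [map_zero, PowerSeries.coeff_X, if_neg hm]
  · rw [map_zero, map_zero]

theorem shiftOuter_mapDer {δ : ℕ → Derivation ℂ R R} (h : CommDer δ) {d : Derivation ℂ R R}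
    (hd : ∀ j x, d (δ j x) = δ j (d x)) (f : PowerSeries R) :
    shiftOuter h (mapDer d f) = mapDer (mapDer d) (shiftOuter h f) := by
  ext n m
  rw [coeff_mapDer, coeff_mapDer, coeff_shiftOuter, coeff_shiftOuter, coeff_mapDer]
  exact (map_hs h h d.toLinearMap hd (-1) n _).symm

theorem mapDer_inner (d : Derivation ℂ R R) (f : PowerSeries R) :
    mapDer (mapDer d) (inner f) = inner (mapDer d f) := by
  ext1 n
  rw [coeff_mapDer, PowerSeries.coeff_C, PowerSeries.coeff_C]
  split_ifs
  · rfl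
  · rw [map_zero]

theorem mapDer_outer (d : Derivation ℂ R R) (f : PowerSeries R) :
    mapDer (mapDer d) (outer f) = outer (mapDer d f) := by
  ext n m
  rw [coeff_mapDer, coeff_mapDer, PowerSeries.coeff_map, PowerSeries.coeff_map, PowerSeries.coeff_C,
    PowerSeries.coeff_C, coeff_mapDer]
  split_ifs
  · rfl
  · rw [map_zero]

theorem mapDer_X (d : Derivation ℂ R R) : mapDer d PowerSeries.X = 0 := by
  ext n
  rw [coeff_mapDer, PowerSeries.coeff_X, map_zero]
  split_ifs
  · exact Derivation.map_one_eq_zero _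
  · rw [map_zero]

namespace ShiftEquations

variable (h : ShiftEquations D h₀ h₁ φ ψ ε ε' β' q c)
include h

theorem isUnit_ε : IsUnit ε := IsUnit.of_mul_eq_one ε' h.mul_inv

theorem isUnit_φ : IsUnit φ := isUnit_of_coeff_zero (by rw [h.coeff_φ]; exact isUnit_one)

theorem isUnit_ψ : IsUnit ψ := isUnit_of_coeff_zero (by rw [h.coeff_ψ]; exact h.isUnit_ε)

/-- Let u be the inner and v the outer variable. By `diag_φ`, the shift equation multiplied by φ(v)
reads (u - v) φ(t₁ - [v]; u) φ(v) = (u c(v) - v c(u)) φ(u) φ(v), whose right side is antisymmetric.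
-/
theorem swap_φ : swap (shiftOuter h₀ φ * outer φ) = shiftOuter h₀ φ * outer φ := by
  have h1 := h.outer_φ
  rw [← h.diag_φ, map_mul, map_mul] at h1
  have h2 := congrArg swap h1
  simp only [map_mul, map_sub, swap_inner, swap_outer, swap_X, outer_X] at h2
  refine sub_mul_cancel ?_
  rw [map_mul, swap_outer]
  linear_combination (-inner φ) * h2 - outer φ * h1

/-- Of the two factors of φ(t₁ - [v]; u) φ(v), the first is annihilated by the derivation in v, so
the product has the logarithmic derivative e(v). -/
theorem closed_φ {e : PowerSeries R} (he : nabla (timeDer D 0) 1 φ = e * φ) (n m : ℕ) :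
    timeDer D 0 m (PowerSeries.coeff (n + 1) e) = timeDer D 0 n (PowerSeries.coeff (m + 1) e) := by
  refine deriv_coeff_comm_self h₀ (H := shiftOuter h₀ φ * outer φ)
    ((h.isUnit_φ.map _).mul (h.isUnit_φ.map _)) h.swap_φ ?_ n m
  rw [Derivation.leibniz, nablaOuter_outer, nablaOuter_shiftOuter, he, map_mul, smul_zero, add_zero,
    smul_eq_mul]
  ring

/-- With g(v) = ε(t₂ - [v]) / ε one finds (u - v) ψ(t₂ - [v]; u) ψ(v) g(u) = (u g(u) - v g(v)) ψ(u)
ψ(v). Dividing by the symmetric factor g(u) g(v) leaves 1/g(v), which is written as a shift of ε' up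
to the constant ε so that the derivation in v annihilates it. -/
theorem swap_ψ : swap (shiftOuter h₁ ψ * outer ψ * outer (shiftHom _ h₁ (-1) ε')) =
    shiftOuter h₁ ψ * outer ψ * outer (shiftHom _ h₁ (-1) ε') := by
  set g := PowerSeries.C ε' * shiftHom _ h₁ (-1) ε with hg
  set g' := shiftHom _ h₁ (-1) ε' with hg'
  have hgg : PowerSeries.C ε * g * g' = 1 := by
    calc PowerSeries.C ε * g * g' = PowerSeries.C (ε * ε') * shiftHom _ h₁ (-1) (ε * ε') := by
          rw [hg, hg', map_mul, map_mul]; ring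
      _ = 1 := by rw [h.mul_inv, map_one, map_one, one_mul]
  have h1 := h.outer_ψ'
  have h3 := congrArg inner h.diag_ψ
  have h5 := congrArg inner hgg
  rw [map_mul inner _ ψ] at h1
  rw [← hg] at h1 h3
  rw [map_mul inner g] at h3
  set θ := ψ + PowerSeries.X * mapDer (D (1, 1)) ψ
  rw [map_mul, map_mul, map_one] at h5
  have h6 : (inner PowerSeries.X - PowerSeries.X) * (shiftOuter h₁ ψ * outer ψ * inner g) =
      (inner PowerSeries.X * inner g - PowerSeries.X * outer g) * inner ψ * outer ψ := by
    linear_combination (outer ψ * inner g) * h1 - PowerSeries.X * outer g * outer ψ * h3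
  have h2 := congrArg swap h6
  simp only [map_mul, map_sub, swap_inner, swap_outer, swap_X, outer_X] at h2
  have h7 : swap (shiftOuter h₁ ψ) * inner ψ * outer g = shiftOuter h₁ ψ * outer ψ * inner g := by
    refine sub_mul_cancel ?_
    linear_combination -h2 - h6
  have h8 := congrArg outer hgg
  rw [map_mul, map_mul, map_one, outer_C] at h8
  rw [map_mul, map_mul, swap_outer, swap_outer]
  linear_combination (inner (PowerSeries.C ε) * inner g' * outer g') * h7 -
    swap (shiftOuter h₁ ψ) * inner ψ * inner g' * h8 + shiftOuter h₁ ψ * outer ψ * outer g' * h5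

theorem closed_ψ {e : PowerSeries R} (he : nabla (timeDer D 1) 1 ψ = e * ψ) (n m : ℕ) :
    timeDer D 1 m (PowerSeries.coeff (n + 1) e) = timeDer D 1 n (PowerSeries.coeff (m + 1) e) := by
  have hu : IsUnit ε' := IsUnit.of_mul_eq_one ε (by rw [mul_comm, h.mul_inv])
  refine deriv_coeff_comm_self h₁
    (H := shiftOuter h₁ ψ * outer ψ * outer (shiftHom _ h₁ (-1) ε'))
    (((h.isUnit_ψ.map _).mul (h.isUnit_ψ.map _)).mul ((hu.map _).map _)) h.swap_ψ ?_ n m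
  rw [Derivation.leibniz, Derivation.leibniz, nablaOuter_outer, nablaOuter_outer,
    nablaOuter_shiftOuter, he, nabla_shiftHom, map_mul, map_zero, smul_zero, smul_zero, add_zero,
    smul_eq_mul, smul_eq_mul]
  ring

/-- Compatibility of the shift of t₁ by [v] with that of t₂ by [u]; once tau functions exist, both
sides are the same product of their values. Among the shift equations it is here that `cross_φ`,
`cross_ψ` and `shift_ε` are needed. -/
theorem shift_mixed : shiftOuter h₀ ψ * outer φ * inner (shiftHom _ h₁ (-1) ε) =
    inner ψ * shiftInner h₁ φ * shiftOuter h₀ (shiftHom _ h₁ (-1) ε) := by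
  set g := shiftHom _ h₁ (-1) ε with hg
  set θ := ψ + PowerSeries.X * mapDer (D (1, 1)) ψ with hθ
  have hθu : IsUnit θ := isUnit_of_coeff_zero (by
    rw [hθ, map_add, PowerSeries.coeff_zero_X_mul, add_zero, h.coeff_ψ]
    exact h.isUnit_ε)
  have hεg : g * θ = PowerSeries.C ε * ψ := by
    rw [← h.diag_ψ, ← mul_assoc, ← mul_assoc, ← map_mul, h.mul_inv, map_one, one_mul]
  have hcross := congrArg inner h.cross_ψ
  rw [← hθ] at hcross
  have hΓθ : shiftOuter h₀ θ = shiftOuter h₀ ψ + inner PowerSeries.X *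
      mapDer (mapDer (D (1, 1))) (shiftOuter h₀ ψ) := by
    rw [hθ, map_add, map_mul, shiftOuter_X, shiftOuter_mapDer h₀ fun j x => h.comm _ _ _]
  have hdP : mapDer (mapDer (D (1, 1))) (shiftOuter h₀ ψ) =
      outer (mapDer (D (1, 1)) c) * inner ψ + outer c * inner (mapDer (D (1, 1)) ψ) -
        PowerSeries.X * inner (mapDer (D (1, 1)) (mapDer (D (0, 1)) ψ)) := by
    rw [h.outer_ψ, map_sub, Derivation.leibniz, Derivation.leibniz, mapDer_inner, mapDer_inner,
      mapDer_outer, mapDer_X]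
    simp only [smul_eq_mul]
    ring
  have hφ : shiftInner h₁ φ * inner θ =
      outer φ * inner θ - inner PowerSeries.X * inner ψ * outer (mapDer (D (1, 1)) φ) := by
    have h1 := congrArg inner h.diag_ψ
    rw [← hθ, map_mul] at h1
    rw [shiftInner_eq_swap, h.outer_φ', map_sub, map_mul, map_mul, swap_inner, swap_outer,
      swap_inner, swap_X]
    linear_combination (-inner PowerSeries.X * outer (mapDer (D (1, 1)) φ)) * h1
  have ha : shiftOuter h₀ (PowerSeries.C ε) =
      outer c * inner (PowerSeries.C ε) - PowerSeries.X * inner (PowerSeries.C β') *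
        inner (PowerSeries.C ε) := by
    rw [shiftOuter_C, h.shift_ε, map_sub, map_mul, map_mul, outer_C, outer_C, outer_X, map_mul,
      map_mul, mul_assoc]
  have hD := congrArg (fun f => outer (mapDer (D (1, 1)) f)) h.diag_φ
  have hcφ := congrArg outer h.cross_φ
  have hcomm : mapDer (D (0, 1)) (mapDer (D (1, 1)) φ) =
      mapDer (D (1, 1)) (mapDer (D (0, 1)) φ) := by
    ext n
    simp only [coeff_mapDer, h.comm (0, 1)]
  rw [hcomm] at hcφ
  -- With θ in place of ψ, all shifts can be eliminated and a polynomial identity remains, a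
  -- combination of the cross equations and the derivative of `diag_φ`. The relation ε(t₂ - [u]) θ =
  -- ε ψ then leads back to ψ.
  have hmain : outer φ * inner (PowerSeries.C ε) * shiftOuter h₀ θ =
      shiftInner h₁ φ * inner θ * shiftOuter h₀ (PowerSeries.C ε) := by
    rw [hφ, ha, hΓθ, hdP, h.outer_ψ]
    simp only [map_add, map_mul, Derivation.leibniz, smul_eq_mul, mapDer_X, outer_X, outer_C,
      mul_zero, add_zero, hθ] at hD hcφ hcross ⊢
    linear_combination inner (PowerSeries.C ε) * ((-PowerSeries.X * outer φ) * hcross +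
      inner PowerSeries.X * inner ψ * hD + inner PowerSeries.X * inner ψ * hcφ)
  have e1 := congrArg inner hεg
  have e2 := congrArg (shiftOuter h₀) hεg
  rw [map_mul, map_mul] at e1 e2
  refine ((hθu.map inner).mul (hθu.map (shiftOuter h₀))).mul_left_cancel ?_
  linear_combination (shiftOuter h₀ ψ * outer φ * shiftOuter h₀ θ) * e1 -
    inner ψ * shiftInner h₁ φ * inner θ * e2 + shiftOuter h₀ ψ * inner ψ * hmain

/-- In v, the series ψ(t₁ - [v]; u) φ(v) has the logarithmic derivative e(v). By `shift_mixed` it is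
also ψ(u) times factors shifted in t₂ by -[u], so in u its logarithmic derivative is f(u). -/
theorem closed_mixed {e f : PowerSeries R} (he : nabla (timeDer D 0) 1 φ = e * φ)
    (hf : nabla (timeDer D 1) 1 ψ = f * ψ) (n m : ℕ) :
    timeDer D 1 m (PowerSeries.coeff (n + 1) e) = timeDer D 0 n (PowerSeries.coeff (m + 1) f) := by
  refine deriv_coeff_comm (δ := timeDer D 0) (δ' := timeDer D 1)
    (fun i j x => h.comm _ _ x) (H := shiftOuter h₀ ψ * outer φ)
    ((h.isUnit_ψ.map _).mul (h.isUnit_φ.map _)) ?_ ?_ n m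
  · rw [Derivation.leibniz, nablaOuter_outer, nablaOuter_shiftOuter, he, map_mul, smul_zero,
      add_zero, smul_eq_mul]
    ring
  · have h1 : shiftOuter h₀ (shiftHom _ h₁ (-1) ε) = shiftInner h₁ (shiftHom _ h₀ (-1) ε) := by
      ext n m
      rw [coeff_shiftOuter, shiftInner, PowerSeries.coeff_map, coeff_shiftHom, coeff_shiftHom,
        coeff_shiftHom]
      refine (map_hs h₀ h₀ (hs (timeDer D 1) (-1) m) (fun j x => ?_) (-1) n ε).symm
      exact (map_hs h₁ h₁ (timeDer D 0 j).toLinearMap (fun i x => h.comm _ _ x) (-1) m x).symm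
    have h2 : inner (shiftHom _ h₁ (-1) ε) * inner (shiftHom _ h₁ (-1) ε') = 1 := by
      rw [← map_mul, ← map_mul, h.mul_inv, map_one, map_one]
    have h3 : shiftOuter h₀ ψ * outer φ = inner ψ * shiftInner h₁ φ *
        shiftInner h₁ (shiftHom _ h₀ (-1) ε) * inner (shiftHom _ h₁ (-1) ε') := by
      have := h.shift_mixed
      rw [h1] at this
      linear_combination inner (shiftHom _ h₁ (-1) ε') * this - shiftOuter h₀ ψ * outer φ * h2
    rw [h3, Derivation.leibniz, Derivation.leibniz, Derivation.leibniz, nablaInner_inner,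
      nablaInner_inner, nablaInner_shiftInner, nablaInner_shiftInner, nabla_shiftHom, hf, map_zero,
      map_mul]
    simp only [smul_eq_mul]
    ring

end ShiftEquations

end TauEquations


/-! ### The module spanned by the derivatives of the wave functions -/

section WaveModule

variable {R : Type*} [CommRing R] [Algebra ℂ R] (D : TimeIndex → Derivation ℂ R R)

theorem coeff_waveD (i : TimeIndex) (W : Fin 2 → LaurentSeries R) (μ : Fin 2) (k : ℤ) :
    (waveD D i W μ).coeff k = D i ((W μ).coeff k) +
      if i.1 = μ then (W μ).coeff (k + (i.2 : ℕ)) else 0 := by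
  rw [waveD, HahnSeries.coeff_add, coeff_map]
  split_ifs
  · rw [coeff_single_mul', sub_neg_eq_add]
  · rw [HahnSeries.coeff_zero]

theorem waveD_add (i : TimeIndex) (W W' : Fin 2 → LaurentSeries R) :
    waveD D i (W + W') = waveD D i W + waveD D i W' := by
  ext μ k
  simp only [Pi.add_apply, HahnSeries.coeff_add, coeff_waveD, map_add]
  split_ifs <;> ring

theorem waveD_smul (i : TimeIndex) (f : R) (W : Fin 2 → LaurentSeries R) :
    waveD D i (f • W) = D i f • W + f • waveD D i W := by
  ext μ k
  simp only [Pi.add_apply, Pi.smul_apply, HahnSeries.coeff_add, HahnSeries.coeff_smul, coeff_waveD,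
    smul_eq_mul, Derivation.leibniz]
  split_ifs <;> ring

variable {D} in
theorem waveD_comm (hD : ∀ i j x, D i (D j x) = D j (D i x)) (i j : TimeIndex)
    (W : Fin 2 → LaurentSeries R) : waveD D i (waveD D j W) = waveD D j (waveD D i W) := by
  ext μ k
  simp only [coeff_waveD, map_add, hD i j]
  split_ifs
  · rw [add_right_comm k]
    ring
  · simp
  · simp
  · simp

theorem waveD_zero (i : TimeIndex) : waveD D i 0 = 0 := by
  have := waveD_smul D i 0 0
  simpa using this

theorem waveD_mem_of_span {i : TimeIndex} {s : Set (Fin 2 → LaurentSeries R)}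
    {N : Submodule R (Fin 2 → LaurentSeries R)} (hs : ∀ x ∈ s, waveD D i x ∈ N)
    (hN : Submodule.span R s ≤ N) {x : Fin 2 → LaurentSeries R} (hx : x ∈ Submodule.span R s) :
    waveD D i x ∈ N := by
  induction hx using Submodule.span_induction with
  | mem x hx => exact hs x hx
  | zero => rw [waveD_zero]; exact N.zero_mem
  | add x y _ _ hx hy => rw [waveD_add]; exact N.add_mem hx hy
  | smul f x hx ih => rw [waveD_smul]; exact N.add_mem (N.smul_mem _ (hN hx)) (N.smul_mem _ ih)

theorem mem_of_smul_mem {n : ℕ} {N : Submodule R (Fin 2 → LaurentSeries R)}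
    {x : Fin 2 → LaurentSeries R} (h : ((n + 1 : ℕ) : ℂ) • x ∈ N) : x ∈ N := by
  have hn : ((n + 1 : ℕ) : ℂ) ≠ 0 := by exact_mod_cast n.succ_ne_zero
  have h2 : (algebraMap ℂ R ((n + 1 : ℕ) : ℂ)⁻¹) • ((n + 1 : ℕ) : ℂ) • x = x := by
    rw [algebraMap_smul, inv_smul_smul₀ hn]
  rw [← h2]
  exact N.smul_mem _ h

/-- The module spanned by the derivatives `∂_ν^n W`, `n ≥ m`. -/
noncomputable def axisModule (W : Fin 2 → LaurentSeries R) (ν : Fin 2) (m : ℕ) :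
    Submodule R (Fin 2 → LaurentSeries R) :=
  Submodule.span R (Set.range fun n => (waveD D (ν, 1))^[n + m] W)

/-- The module spanned by the derivatives `∂_ν^n W`, `ν = 1, 2`. -/
noncomputable def waveModule (W : Fin 2 → LaurentSeries R) :
    Submodule R (Fin 2 → LaurentSeries R) :=
  Submodule.span R (Set.range fun x : Fin 2 × ℕ => (waveD D (x.1, 1))^[x.2] W)

variable {D} {W V : Fin 2 → LaurentSeries R} {ε ε' β' : R}

theorem axisModule_le (ν : Fin 2) (m : ℕ) : axisModule D W ν m ≤ waveModule D W :=
  Submodule.span_mono (by rintro _ ⟨n, rfl⟩; exact ⟨(ν, n + m), rfl⟩)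

theorem iterate_mem_waveModule (ν : Fin 2) (n : ℕ) : (waveD D (ν, 1))^[n] W ∈ waveModule D W :=
  Submodule.subset_span ⟨(ν, n), rfl⟩

theorem self_mem_waveModule : W ∈ waveModule D W := iterate_mem_waveModule 0 0

theorem iterate_mem {T : (Fin 2 → LaurentSeries R) → Fin 2 → LaurentSeries R}
    {N : Submodule R (Fin 2 → LaurentSeries R)} (hT : ∀ x ∈ N, T x ∈ N) (n : ℕ)
    {x : Fin 2 → LaurentSeries R} (hx : x ∈ N) : T^[n] x ∈ N := by
  induction n with
  | zero => exact hx
  | succ n ih => rw [Function.iterate_succ_apply']; exact hT _ ih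

theorem axisModule_closed (ν : Fin 2) (m : ℕ) :
    ∀ x ∈ axisModule D W ν m, waveD D (ν, 1) x ∈ axisModule D W ν m := fun _ hx => by
  refine waveD_mem_of_span D ?_ le_rfl hx
  rintro _ ⟨n, rfl⟩
  refine Submodule.subset_span ⟨n + 1, ?_⟩
  simp only
  rw [← Function.iterate_succ_apply' (waveD D (ν, 1)), Nat.succ_add]

namespace WavePair

variable (h : WavePair D W V ε ε' β')
include h

theorem waveD_iterate (i : TimeIndex) (ν : Fin 2) (n : ℕ) (x : Fin 2 → LaurentSeries R) :
    waveD D i ((waveD D (ν, 1))^[n] x) = (waveD D (ν, 1))^[n] (waveD D i x) :=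
  (Function.Commute.iterate_right (f := waveD D i) (g := waveD D (ν, 1))
    (waveD_comm h.comm _ _) n) x

theorem waveD_self_mem (ν : Fin 2) (k : ℕ+) : waveD D (ν, k) W ∈ axisModule D W ν ν := by
  obtain ⟨M, b, hb, hW⟩ := h.flow ν k
  rw [hW]
  refine Submodule.sum_mem _ fun n _ => ?_
  by_cases hn : n < ν
  · rw [hb n hn, zero_smul]
    exact Submodule.zero_mem _
  · refine Submodule.smul_mem _ _ (Submodule.subset_span ⟨n - ν, ?_⟩)
    simp only
    rw [Nat.sub_add_cancel (not_lt.1 hn)]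

theorem waveD_mem_axisModule (ν : Fin 2) (k : ℕ+) :
    ∀ x ∈ axisModule D W ν ν, waveD D (ν, k) x ∈ axisModule D W ν ν := fun _ hx => by
  refine waveD_mem_of_span D ?_ le_rfl hx
  rintro _ ⟨n, rfl⟩
  simp only
  rw [h.waveD_iterate]
  exact iterate_mem (axisModule_closed ν ν) _ (h.waveD_self_mem ν k)

/-- The cross equation rewrites ∂₁∂₂^{n+1} W as ∂₂^n applied to a combination of ∂₂W and W, so no
mixed derivatives are needed as generators. -/
theorem waveD_zero_mem : ∀ x ∈ waveModule D W, waveD D (0, 1) x ∈ waveModule D W := fun _ hx => by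
  refine waveD_mem_of_span D ?_ le_rfl hx
  rintro _ ⟨⟨ν, n⟩, rfl⟩
  fin_cases ν
  · change waveD D (0, 1) ((waveD D (0, 1))^[n] W) ∈ _
    rw [← Function.iterate_succ_apply' (waveD D (0, 1))]
    exact iterate_mem_waveModule 0 (n + 1)
  · change waveD D (0, 1) ((waveD D (1, 1))^[n] W) ∈ _
    rcases n with _ | n
    · exact iterate_mem_waveModule 0 1
    · obtain ⟨q, hq⟩ := h.cross
      rw [Function.iterate_succ_apply, h.waveD_iterate, hq]
      refine axisModule_le 1 0 (iterate_mem (axisModule_closed 1 0) _ ?_)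
      exact Submodule.add_mem _ (Submodule.smul_mem _ _ (Submodule.subset_span ⟨1, rfl⟩))
        (Submodule.smul_mem _ _ (Submodule.subset_span ⟨0, rfl⟩))

/-- By commutation ∂₂∂₁^n W = ∂₁^n ∂₂W, where closure under ∂₁ applies. -/
theorem waveD_one_mem : ∀ x ∈ waveModule D W, waveD D (1, 1) x ∈ waveModule D W := fun _ hx => by
  refine waveD_mem_of_span D ?_ le_rfl hx
  rintro _ ⟨⟨ν, n⟩, rfl⟩
  fin_cases ν
  · change waveD D (1, 1) ((waveD D (0, 1))^[n] W) ∈ _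
    rw [h.waveD_iterate]
    exact iterate_mem h.waveD_zero_mem _ (iterate_mem_waveModule 1 1)
  · change waveD D (1, 1) ((waveD D (1, 1))^[n] W) ∈ _
    rw [← Function.iterate_succ_apply' (waveD D (1, 1))]
    exact iterate_mem_waveModule 1 (n + 1)

/-- The module spanned by the derivatives of the wave functions is closed under the derivatives in
all times. -/
theorem waveD_mem (i : TimeIndex) : ∀ x ∈ waveModule D W, waveD D i x ∈ waveModule D W :=
    fun _ hx => by
  refine waveD_mem_of_span D ?_ le_rfl hx
  rintro _ ⟨⟨ν, n⟩, rfl⟩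
  simp only
  rw [h.waveD_iterate]
  refine iterate_mem ?_ _ (axisModule_le i.1 i.1 (h.waveD_self_mem i.1 i.2))
  fin_cases ν
  · exact h.waveD_zero_mem
  · exact h.waveD_one_mem

/-- Orthogonality holds on the generators by assumption, and the pairing is linear over the
functions. -/
theorem pairing_eq_zero {x : Fin 2 → LaurentSeries R} (hx : x ∈ waveModule D W) :
    pairing V x = 0 := by
  induction hx using Submodule.span_induction with
  | mem x hx =>
    obtain ⟨⟨ν, n⟩, rfl⟩ := hx
    exact h.dual ν n
  | zero => simp [pairing]
  | add x y _ _ hx hy =>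
    rw [pairing, sub_eq_zero] at hx hy ⊢
    rw [Pi.add_apply, Pi.add_apply, add_mul, add_mul, HahnSeries.coeff_add, HahnSeries.coeff_add,
      hx, hy]
  | smul f x _ hx =>
    rw [pairing, sub_eq_zero] at hx ⊢
    rw [Pi.smul_apply, Pi.smul_apply, ← HahnSeries.C_mul_eq_smul, ← HahnSeries.C_mul_eq_smul,
      mul_assoc, mul_assoc, HahnSeries.C_mul_eq_smul, HahnSeries.C_mul_eq_smul,
      HahnSeries.coeff_smul, HahnSeries.coeff_smul, hx]

theorem isUnit_lead (ν : Fin 2) : IsUnit ((W ν).coeff 0) := by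
  fin_cases ν
  · exact h.lead₀ ▸ isUnit_one
  · exact h.lead₁ ▸ IsUnit.of_mul_eq_one ε' h.mul_inv

end WavePair

theorem leading_iterate_leftD (d : Derivation ℂ R R) {A : LaurentSeries R} (hA : Vanish 0 A)
    (n : ℕ) : Vanish (-(n : ℤ)) ((leftD d)^[n] A) ∧
      ((leftD d)^[n] A).coeff (-(n : ℤ)) = A.coeff 0 := by
  induction n with
  | zero => exact ⟨by simpa using hA, by simp⟩
  | succ n ih =>
    constructor
    · intro k hk
      push_cast at hk
      rw [Function.iterate_succ_apply', coeff_leftD, ih.1 k (by omega), ih.1 _ (by omega), map_zero,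
        add_zero]
    · rw [Function.iterate_succ_apply', coeff_leftD, ih.1 _ (by push_cast; omega), map_zero,
        zero_add, ← ih.2]
      congr 1
      push_cast
      ring

/-- An element of the module of derivatives is determined by its leading coefficient. -/
theorem WavePair.eq_smul_of_vanish (h : WavePair D W V ε ε' β') {ν : Fin 2} {m : ℕ}
    {x : Fin 2 → LaurentSeries R} (hx : x ∈ axisModule D W ν m) (hv : Vanish (-(m : ℤ)) (x ν)) :
    ∃ c : R, x = c • (waveD D (ν, 1))^[m] W := by
  obtain ⟨c, hc⟩ := (Finsupp.mem_span_range_iff_exists_finsupp).1 hx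
  have key : ∀ (M : ℕ) (x : Fin 2 → LaurentSeries R), Vanish (-(m : ℤ)) (x ν) →
      x = ∑ n ∈ Finset.range (M + 1), c n • (waveD D (ν, 1))^[n + m] W →
        x = c 0 • (waveD D (ν, 1))^[m] W := by
    intro M
    induction M with
    | zero =>
      intro x _ hx
      rw [hx, zero_add, Finset.sum_range_one, zero_add]
    | succ M ih =>
      intro x hv hx
      rw [Finset.sum_range_succ] at hx
      -- Among the summands only the last reaches this power of z, and there with a unit as
      -- coefficient, so the order bound on `x` forces `c (M + 1) = 0`.
      have h1 := hv (-((M + 1 + m : ℕ) : ℤ)) (by push_cast; omega)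
      rw [hx, Pi.add_apply, HahnSeries.coeff_add, Finset.sum_apply, HahnSeries.coeff_sum,
        Finset.sum_eq_zero, zero_add, Pi.smul_apply, HahnSeries.coeff_smul, smul_eq_mul,
        iterate_waveD_self, (leading_iterate_leftD _ (h.vanish ν) _).2,
        (h.isUnit_lead ν).mul_left_eq_zero] at h1
      · rw [h1, zero_smul, add_zero] at hx
        exact ih x hv hx
      · intro n hn
        have := Finset.mem_range.1 hn
        rw [Pi.smul_apply, HahnSeries.coeff_smul, iterate_waveD_self,
          (leading_iterate_leftD _ (h.vanish ν) _).1 _ (by push_cast; omega), smul_zero]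
  refine ⟨c 0, key (c.support.sup id) x hv ?_⟩
  rw [← hc]
  exact Finsupp.sum_of_support_subset _ (fun n hn => Finset.mem_range.2
    (Nat.lt_succ_of_le (Finset.le_sup (f := id) hn))) _ (fun _ _ => zero_smul _ _)

end WaveModule


/-! ### Wave functions at shifted times -/

section ShiftedWaves

variable {R : Type*} [CommRing R] [Algebra ℂ R]

/-- The factor 1 - v z is the exponential of -∑ v^k z^k / k. Multiplying the shifted coefficients by
it replaces δ_j by δ_j + z^{j+1} in the recursion; multiplication by z appears as the step k ↦ k +
1. -/
theorem sub_shift_recursion {δ : ℕ → Derivation ℂ R R} {a y : ℕ → ℤ → R}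
    (ha : ∀ n k, ((n + 1 : ℕ) : ℂ) • a (n + 1) k =
      (-1 : ℂ) • ∑ j ∈ Finset.range (n + 1), δ j (a (n - j) k))
    (h0 : ∀ k, y 0 k = a 0 k) (hs : ∀ n k, y (n + 1) k = a (n + 1) k - a n (k + 1))
    (n : ℕ) (k : ℤ) : ((n + 1 : ℕ) : ℂ) • y (n + 1) k =
      (-1 : ℂ) • ∑ j ∈ Finset.range (n + 1),
        (δ j (y (n - j) k) + y (n - j) (k + (j + 1 : ℕ))) := by
  have h1 : ∀ (n : ℕ) (k : ℤ),
      ∑ j ∈ Finset.range (n + 1), y (n - j) (k + (j + 1 : ℕ)) = a n (k + 1) := by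
    intro n
    induction n with
    | zero => intro k; simp [h0]
    | succ n ih =>
      intro k
      rw [Finset.sum_range_succ', Finset.sum_congr rfl fun j _ => by
        rw [Nat.add_sub_add_right, show k + ((j + 1 + 1 : ℕ) : ℤ) = k + 1 + ((j + 1 : ℕ) : ℤ) by
          push_cast; ring], ih, Nat.sub_zero, hs]
      simp
  rw [Finset.sum_add_distrib, h1, hs]
  rcases n with _ | n
  · have := ha 0 k
    simp only [zero_add, Finset.sum_range_one, Nat.sub_zero, Nat.cast_one, one_smul, h0] at this ⊢
    rw [this]
    module
  · have h2 := ha (n + 1) k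
    have h3 := ha n (k + 1)
    rw [Finset.sum_range_succ, Nat.sub_self] at h2 ⊢
    have h4 : ∑ j ∈ Finset.range (n + 1), δ j (y (n + 1 - j) k) =
        ∑ j ∈ Finset.range (n + 1), δ j (a (n + 1 - j) k) -
          ∑ j ∈ Finset.range (n + 1), δ j (a (n - j) (k + 1)) := by
      rw [← Finset.sum_sub_distrib]
      refine Finset.sum_congr rfl fun j hj => ?_
      have := Finset.mem_range.1 hj
      rw [show n + 1 - j = n - j + 1 by omega, hs, map_sub]
    rw [h4, h0, smul_sub, h2, Nat.cast_succ (n + 1), add_smul, h3]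
    module

/-- The same with the factor 1/(1 - v z) of the opposite shift, multiplication by which is itself
recursive. -/
theorem add_shift_recursion {δ : ℕ → Derivation ℂ R R} {a y : ℕ → ℤ → R}
    (ha : ∀ n k, ((n + 1 : ℕ) : ℂ) • a (n + 1) k =
      (1 : ℂ) • ∑ j ∈ Finset.range (n + 1), δ j (a (n - j) k))
    (h0 : ∀ k, y 0 k = a 0 k) (hs : ∀ n k, y (n + 1) k = a (n + 1) k + y n (k + 1))
    (n : ℕ) (k : ℤ) : ((n + 1 : ℕ) : ℂ) • y (n + 1) k =
      (1 : ℂ) • ∑ j ∈ Finset.range (n + 1),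
        (δ j (y (n - j) k) + y (n - j) (k + (j + 1 : ℕ))) := by
  induction n generalizing k with
  | zero =>
    have := ha 0 k
    simp only [zero_add, Finset.sum_range_one, Nat.sub_zero, Nat.cast_one, one_smul, h0, hs]
      at this ⊢
    rw [this]
  | succ n ih =>
    have h2 := ha (n + 1) k
    have h3 := ih (k + 1)
    rw [Finset.sum_add_distrib] at h3
    rw [Finset.sum_add_distrib, hs (n + 1), smul_add, h2, Nat.cast_succ (n + 1), add_smul, h3,
      Finset.sum_range_succ _ (n + 1), Finset.sum_range_succ _ (n + 1),
      Finset.sum_range_succ' (fun j => y (n + 1 - j) (k + (j + 1 : ℕ))) (n + 1), Nat.sub_self]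
    have h4 : ∑ j ∈ Finset.range (n + 1), δ j (y (n + 1 - j) k) =
        ∑ j ∈ Finset.range (n + 1), δ j (a (n + 1 - j) k) +
          ∑ j ∈ Finset.range (n + 1), δ j (y (n - j) (k + 1)) := by
      rw [← Finset.sum_add_distrib]
      refine Finset.sum_congr rfl fun j hj => ?_
      have := Finset.mem_range.1 hj
      rw [show n + 1 - j = n - j + 1 by omega, hs, map_add]
    have h5 : ∑ j ∈ Finset.range (n + 1), y (n + 1 - (j + 1)) (k + (j + 1 + 1 : ℕ)) =
        ∑ j ∈ Finset.range (n + 1), y (n - j) (k + 1 + (j + 1 : ℕ)) := by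
      refine Finset.sum_congr rfl fun j _ => ?_
      rw [Nat.add_sub_add_right, show k + ((j + 1 + 1 : ℕ) : ℤ) = k + 1 + ((j + 1 : ℕ) : ℤ) by
          push_cast; ring]
    rw [h4, h5, h0, zero_add, Nat.cast_one, Nat.sub_zero]
    module

theorem hs_one_eq_zero (e : ℂ) (n : ℕ) (δ : ℕ → Derivation ℂ R R) (hδ : CommDer δ) :
    hs δ e (n + 1) 1 = 0 := by
  have := coeff_shiftHom hδ e 1 (n + 1)
  rw [map_one, PowerSeries.coeff_one, if_neg n.succ_ne_zero] at this
  exact this.symm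

variable (D : TimeIndex → Derivation ℂ R R) (W : Fin 2 → LaurentSeries R) (ν : Fin 2)

/-- The coefficients of `v^n` in `W(t_ν - [v])`, where the exponential contributes the factor
`1 - v z`. -/
noncomputable def lowerWave : ℕ → Fin 2 → LaurentSeries R
  | 0 => W
  | n + 1 => fun μ => (W μ).map (hs (timeDer D ν) (-1) (n + 1)) -
      if ν = μ then HahnSeries.single (-1) 1 * (W μ).map (hs (timeDer D ν) (-1) n) else 0

/-- The coefficients of `v^n` in `W(t_ν + [v])`, where the exponential contributes the factor
`1 / (1 - v z)`. -/
noncomputable def upperWave : ℕ → Fin 2 → LaurentSeries R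
  | 0 => W
  | n + 1 => fun μ => (W μ).map (hs (timeDer D ν) 1 (n + 1)) +
      if ν = μ then HahnSeries.single (-1) 1 * upperWave n μ else 0

theorem coeff_lowerWave_succ (n : ℕ) (μ : Fin 2) (k : ℤ) :
    (lowerWave D W ν (n + 1) μ).coeff k = hs (timeDer D ν) (-1) (n + 1) ((W μ).coeff k) -
      if ν = μ then hs (timeDer D ν) (-1) n ((W μ).coeff (k + 1)) else 0 := by
  rw [lowerWave, HahnSeries.coeff_sub, coeff_map]
  split_ifs
  · rw [coeff_single_mul', sub_neg_eq_add, coeff_map]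
  · rw [HahnSeries.coeff_zero]

theorem coeff_upperWave_succ (n : ℕ) (μ : Fin 2) (k : ℤ) :
    (upperWave D W ν (n + 1) μ).coeff k = hs (timeDer D ν) 1 (n + 1) ((W μ).coeff k) +
      if ν = μ then (upperWave D W ν n μ).coeff (k + 1) else 0 := by
  rw [upperWave, HahnSeries.coeff_add, coeff_map]
  split_ifs
  · rw [coeff_single_mul', sub_neg_eq_add]
  · rw [HahnSeries.coeff_zero]

theorem coeff_waveD_succPNat (j : ℕ) (W : Fin 2 → LaurentSeries R) (μ : Fin 2) (k : ℤ) :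
    (waveD D (ν, j.succPNat) W μ).coeff k = timeDer D ν j ((W μ).coeff k) +
      if ν = μ then (W μ).coeff (k + (j + 1 : ℕ)) else 0 := coeff_waveD D _ W μ k

variable {D} {W}

theorem lowerWave_recursion (hδ : CommDer (timeDer D ν)) (n : ℕ) :
    ((n + 1 : ℕ) : ℂ) • lowerWave D W ν (n + 1) = (-1 : ℂ) • ∑ j ∈ Finset.range (n + 1),
      waveD D (ν, j.succPNat) (lowerWave D W ν (n - j)) := by
  ext μ k
  simp only [Pi.smul_apply, HahnSeries.coeff_smul, Finset.sum_apply, HahnSeries.coeff_sum,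
    coeff_waveD_succPNat]
  by_cases hμ : ν = μ
  · simp only [hμ, if_true]
    refine sub_shift_recursion (a := fun n k => hs (timeDer D μ) (-1) n ((W μ).coeff k))
      (y := fun n k => (lowerWave D W μ n μ).coeff k) (fun n k => hs_succ (hμ ▸ hδ) _ _ _)
      (fun k => (hs_zero _ _).symm) (fun n k => ?_) n k
    rw [coeff_lowerWave_succ, if_pos rfl]
  · simp only [hμ, if_false, add_zero]
    rw [coeff_lowerWave_succ, if_neg hμ, sub_zero, hs_succ hδ]
    congr 1
    refine Finset.sum_congr rfl fun j _ => ?_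
    congr 1
    rcases n - j with _ | m
    · rw [hs_zero]; rfl
    · rw [coeff_lowerWave_succ, if_neg hμ, sub_zero]

theorem upperWave_recursion (hδ : CommDer (timeDer D ν)) (n : ℕ) :
    ((n + 1 : ℕ) : ℂ) • upperWave D W ν (n + 1) = (1 : ℂ) • ∑ j ∈ Finset.range (n + 1),
      waveD D (ν, j.succPNat) (upperWave D W ν (n - j)) := by
  ext μ k
  simp only [Pi.smul_apply, HahnSeries.coeff_smul, Finset.sum_apply, HahnSeries.coeff_sum,
    coeff_waveD_succPNat]
  by_cases hμ : ν = μ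
  · simp only [hμ, if_true]
    refine add_shift_recursion (a := fun n k => hs (timeDer D μ) 1 n ((W μ).coeff k))
      (y := fun n k => (upperWave D W μ n μ).coeff k) (fun n k => hs_succ (hμ ▸ hδ) _ _ _)
      (fun k => (hs_zero _ _).symm) (fun n k => ?_) n k
    rw [coeff_upperWave_succ, if_pos rfl]
  · simp only [hμ, if_false, add_zero]
    rw [coeff_upperWave_succ, if_neg hμ, add_zero, hs_succ hδ]
    congr 1
    refine Finset.sum_congr rfl fun j _ => ?_
    congr 1
    rcases n - j with _ | m
    · rw [hs_zero]; rfl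
    · rw [coeff_upperWave_succ, if_neg hμ, add_zero]

variable {ν} {V : Fin 2 → LaurentSeries R} {ε ε' β' : R}

namespace WavePair

variable (h : WavePair D W V ε ε' β')
include h

theorem commDer (ν : Fin 2) : CommDer (timeDer D ν) := fun _ _ x => h.comm _ _ x

/-- Beyond the constant term, each coefficient contains at least one time derivative, so it lies in
the span of the ∂_ν^j W with j ≥ ν. For ν = 1 this excludes `W` itself, which is decisive for the
shape of the shift in t₂. -/
theorem lowerWave_mem (n : ℕ) : lowerWave D W ν (n + 1) ∈ axisModule D W ν ν := by
  induction n using Nat.strong_induction_on with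
  | _ n ih =>
    refine mem_of_smul_mem (n := n) ?_
    rw [lowerWave_recursion ν (h.commDer ν), neg_smul, one_smul]
    refine Submodule.neg_mem _ (Submodule.sum_mem _ fun j hj => ?_)
    have hj := Finset.mem_range.1 hj
    rcases hm : n - j with _ | m
    · exact h.waveD_self_mem ν _
    · exact h.waveD_mem_axisModule ν _ _ (ih m (by omega))

theorem upperWave_mem (n : ℕ) : upperWave D W ν n ∈ waveModule D W := by
  induction n using Nat.strong_induction_on with
  | _ n ih =>
    rcases n with _ | n
    · exact self_mem_waveModule
    · refine mem_of_smul_mem (n := n) ?_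
      rw [upperWave_recursion ν (h.commDer ν), one_smul]
      refine Submodule.sum_mem _ fun j hj => h.waveD_mem _ _ (ih _ ?_)
      omega

/-- The shifts of the first times. -/
theorem exists_shift_zero : ∃ c : ℕ → R, c 0 = 1 ∧ ∀ (n : ℕ) (k : ℤ),
    hs (timeDer D 0) (-1) (n + 1) ((W 0).coeff k) - hs (timeDer D 0) (-1) n ((W 0).coeff (k + 1)) =
      c (n + 1) * (W 0).coeff k -
        (if n = 0 then (W 0).coeff (k + 1) + D (0, 1) ((W 0).coeff k) else 0) ∧
    hs (timeDer D 0) (-1) (n + 1) ((W 1).coeff k) =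
      c (n + 1) * (W 1).coeff k - (if n = 0 then D (0, 1) ((W 1).coeff k) else 0) := by
  -- Adding v ∂₁W cancels the leading term -v z of the exponential factor. For n > 0 the coefficient
  -- of z is a positive-order shift coefficient of the constant 1, which is zero. So no positive
  -- power of z is left, and the sum is a multiple of `W`.
  have key : ∀ n, ∃ c : R, lowerWave D W 0 (n + 1) + (if n = 0 then waveD D (0, 1) W else 0) =
      c • W := by
    intro n
    refine h.eq_smul_of_vanish (m := 0) (ν := 0) (Submodule.add_mem _ (h.lowerWave_mem n) ?_) ?_
    · split_ifs
      · exact h.waveD_self_mem 0 1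
      · exact Submodule.zero_mem _
    · intro k hk
      rw [Nat.cast_zero, neg_zero] at hk
      rw [Pi.add_apply, HahnSeries.coeff_add, coeff_lowerWave_succ, if_pos rfl, h.vanish 0 k hk,
        map_zero, zero_sub]
      rcases n with _ | n
      · rw [if_pos rfl, coeff_waveD, if_pos rfl, h.vanish 0 k hk, map_zero, hs_zero]
        simp
      · rw [if_neg n.succ_ne_zero, Pi.zero_apply, HahnSeries.coeff_zero, add_zero, neg_eq_zero]
        rcases (show k + 1 < 0 ∨ k + 1 = 0 by omega) with hk' | hk'
        · rw [h.vanish 0 _ hk', map_zero]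
        · rw [hk', h.lead₀, hs_one_eq_zero _ _ _ (h.commDer 0)]
  choose c hc using key
  refine ⟨fun n => n.casesOn 1 c, rfl, fun n k => ⟨?_, ?_⟩⟩
  · have h1 := congrArg (fun X : Fin 2 → LaurentSeries R => (X 0).coeff k) (hc n)
    simp only [Pi.add_apply, HahnSeries.coeff_add, coeff_lowerWave_succ, if_true, Pi.smul_apply,
      HahnSeries.coeff_smul, smul_eq_mul] at h1
    rw [eq_sub_iff_add_eq, ← h1]
    congr 1
    split_ifs
    · rw [coeff_waveD, if_pos rfl, add_comm]
      simp
    · simp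
  · have h1 := congrArg (fun X : Fin 2 → LaurentSeries R => (X 1).coeff k) (hc n)
    simp only [Pi.add_apply, HahnSeries.coeff_add, coeff_lowerWave_succ, zero_ne_one, if_false,
      Pi.smul_apply, HahnSeries.coeff_smul, smul_eq_mul, sub_zero] at h1
    rw [eq_sub_iff_add_eq, ← h1]
    congr 1
    split_ifs
    · rw [coeff_waveD, if_neg (by decide), add_zero]
    · simp

/-- The shifts of the second times. -/
theorem shift_one (n : ℕ) (k : ℤ) :
    hs (timeDer D 1) (-1) (n + 1) ((W 1).coeff k) - hs (timeDer D 1) (-1) n ((W 1).coeff (k + 1)) =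
      -(ε' * hs (timeDer D 1) (-1) n ε) * ((W 1).coeff (k + 1) + D (1, 1) ((W 1).coeff k)) ∧
    hs (timeDer D 1) (-1) (n + 1) ((W 0).coeff k) =
      -(ε' * hs (timeDer D 1) (-1) n ε) * D (1, 1) ((W 0).coeff k) := by
  obtain ⟨c, hc⟩ := h.eq_smul_of_vanish (m := 1) (ν := 1) (h.lowerWave_mem n) (by
    intro k hk
    rw [Nat.cast_one] at hk
    rw [coeff_lowerWave_succ, if_pos rfl, h.vanish 1 k (by omega), h.vanish 1 _ (by omega), map_zero,
      map_zero, sub_zero])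
  rw [Function.iterate_one] at hc
  have h0 : ∀ k, hs (timeDer D 1) (-1) (n + 1) ((W 1).coeff k) -
      hs (timeDer D 1) (-1) n ((W 1).coeff (k + 1)) =
        c * ((W 1).coeff (k + 1) + D (1, 1) ((W 1).coeff k)) := by
    intro k
    have h1 := congrArg (fun X : Fin 2 → LaurentSeries R => (X 1).coeff k) hc
    simp only [coeff_lowerWave_succ, if_true, Pi.smul_apply, HahnSeries.coeff_smul, smul_eq_mul,
      coeff_waveD] at h1
    rw [h1, add_comm]
    simp
  -- The coefficient of z, at index -1, involves only the leading coefficient ε and determines `c`.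
  have hcε : c = -(ε' * hs (timeDer D 1) (-1) n ε) := by
    have h1 := h0 (-1)
    rw [h.vanish 1 _ (by decide), map_zero, map_zero, neg_add_cancel, h.lead₁, add_zero,
      zero_sub] at h1
    calc c = c * ε * ε' := by rw [mul_assoc, h.mul_inv, mul_one]
      _ = _ := by rw [← h1]; ring
  refine ⟨by rw [h0, hcε], ?_⟩
  have h1 := congrArg (fun X : Fin 2 → LaurentSeries R => (X 0).coeff k) hc
  simp only [coeff_lowerWave_succ, one_ne_zero, if_false, Pi.smul_apply, HahnSeries.coeff_smul,
    smul_eq_mul, coeff_waveD, sub_zero, add_zero] at h1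
  rw [h1, hcε]

end WavePair

end ShiftedWaves


/-! ### The shift equations of a wave pair -/

section

variable {R : Type*} [CommRing R]

/-- The coefficients with nonnegative index of a Laurent series. -/
noncomputable def toPow (A : LaurentSeries R) : PowerSeries R :=
  PowerSeries.mk fun n => A.coeff (n : ℤ)

theorem coeff_toPow (A : LaurentSeries R) (n : ℕ) :
    PowerSeries.coeff n (toPow A) = A.coeff (n : ℤ) := PowerSeries.coeff_mk _ _

theorem ofPowerSeries_toPow {A : LaurentSeries R} (hA : Vanish 0 A) :
    HahnSeries.ofPowerSeries ℤ R (toPow A) = A := by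
  ext n
  rcases lt_or_ge n 0 with hn | hn
  · rw [hA n hn]
    rw [HahnSeries.ofPowerSeries_apply]
    refine HahnSeries.embDomain_of_notMem_range ?_
    rintro ⟨m, rfl⟩
    exact absurd hn (not_lt.2 (Int.natCast_nonneg m))
  · obtain ⟨m, rfl⟩ := Int.eq_ofNat_of_zero_le hn
    rw [HahnSeries.ofPowerSeries_apply_coeff, coeff_toPow]

/-- The coefficients of `X f`. -/
theorem coeff_X_mul_of {f : PowerSeries R} {g : ℤ → R} (hg : ∀ n : ℕ, PowerSeries.coeff n f = g n)
    (h : g (-1) = 0) (n : ℕ) : PowerSeries.coeff n (PowerSeries.X * f) = g ((n : ℤ) - 1) := by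
  rcases n with _ | n
  · rw [PowerSeries.coeff_zero_X_mul, Nat.cast_zero, zero_sub, h]
  · rw [PowerSeries.coeff_succ_X_mul, hg, Nat.cast_succ, add_sub_cancel_right]

end

section

variable {R : Type*} [CommRing R] [Algebra ℂ R] {D : TimeIndex → Derivation ℂ R R}
  {W V : Fin 2 → LaurentSeries R} {ε ε' β' : R}

namespace WavePair

variable (h : WavePair D W V ε ε' β')
include h

theorem coeff_X_mul_toPow (μ : Fin 2) (n : ℕ) :
    PowerSeries.coeff n (PowerSeries.X * toPow (W μ)) = (W μ).coeff ((n : ℤ) - 1) :=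
  coeff_X_mul_of (coeff_toPow _) (h.vanish μ _ (by decide)) n

theorem coeff_X_mul_mapDer (μ : Fin 2) (i : TimeIndex) (n : ℕ) :
    PowerSeries.coeff n (PowerSeries.X * mapDer (D i) (toPow (W μ))) =
      D i ((W μ).coeff ((n : ℤ) - 1)) :=
  coeff_X_mul_of (g := fun k => D i ((W μ).coeff k))
    (fun n => by rw [coeff_mapDer, coeff_toPow])
    (by rw [h.vanish μ _ (by decide), map_zero]) n

theorem coeff_X_mul_mapDer₂ (μ : Fin 2) (i j : TimeIndex) (n : ℕ) :
    PowerSeries.coeff n (PowerSeries.X * mapDer (D i) (mapDer (D j) (toPow (W μ)))) =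
      D i (D j ((W μ).coeff ((n : ℤ) - 1))) :=
  coeff_X_mul_of (g := fun k => D i (D j ((W μ).coeff k)))
    (fun n => by rw [coeff_mapDer, coeff_mapDer, coeff_toPow])
    (by rw [h.vanish μ _ (by decide), map_zero, map_zero]) n

theorem coeff_X_mul_shiftOuter (ν μ : Fin 2) (m n : ℕ) :
    PowerSeries.coeff n (PowerSeries.X *
      PowerSeries.coeff m (shiftOuter (h.commDer ν) (toPow (W μ)))) =
        hs (timeDer D ν) (-1) m ((W μ).coeff ((n : ℤ) - 1)) :=
  coeff_X_mul_of (g := fun k => hs (timeDer D ν) (-1) m ((W μ).coeff k))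
    (fun n => by rw [coeff_shiftOuter, coeff_toPow])
    (by rw [h.vanish μ _ (by decide), map_zero]) n

/-- This is the shift equation in t₁ at v = u, where the exponential factor u - v vanishes. -/
theorem diag_zero {c : ℕ → R} (hc0 : c 0 = 1) (hc : ∀ (n : ℕ) (k : ℤ),
    hs (timeDer D 0) (-1) (n + 1) ((W 0).coeff k) - hs (timeDer D 0) (-1) n ((W 0).coeff (k + 1)) =
      c (n + 1) * (W 0).coeff k -
        (if n = 0 then (W 0).coeff (k + 1) + D (0, 1) ((W 0).coeff k) else 0)) :
    PowerSeries.mk c * toPow (W 0) =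
      toPow (W 0) + PowerSeries.X * mapDer (D (0, 1)) (toPow (W 0)) := by
  ext N
  rw [PowerSeries.coeff_mul, Finset.Nat.sum_antidiagonal_eq_sum_range_succ_mk, map_add,
    h.coeff_X_mul_mapDer, coeff_toPow]
  -- On coefficients the substitution is a telescoping sum: one shift term survives, and the
  -- derivative term enters once, at the step from `M = 0`.
  have key : ∀ M : ℕ, ∑ i ∈ Finset.range (M + 1), c i * (W 0).coeff ((N : ℤ) - i) =
      hs (timeDer D 0) (-1) M ((W 0).coeff ((N : ℤ) - M)) +
        if M = 0 then 0 else (W 0).coeff N + D (0, 1) ((W 0).coeff ((N : ℤ) - 1)) := by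
    intro M
    induction M with
    | zero => simp [hc0, hs_zero]
    | succ M ih =>
      have h1 := hc M ((N : ℤ) - (M + 1 : ℕ))
      rw [show (N : ℤ) - (M + 1 : ℕ) + 1 = N - M by push_cast; ring] at h1
      rw [Finset.sum_range_succ, ih, if_neg M.succ_ne_zero]
      by_cases hM : M = 0
      · subst hM
        simp only [if_true, Nat.cast_zero, sub_zero, zero_add, Nat.cast_one, add_zero] at h1 ⊢
        linear_combination -h1
      · simp only [if_neg hM] at h1 ⊢
        linear_combination -h1
  have h2 : ∀ i ∈ Finset.range N.succ, PowerSeries.coeff i (PowerSeries.mk c) *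
      PowerSeries.coeff (N - i) (toPow (W 0)) = c i * (W 0).coeff ((N : ℤ) - i) := by
    intro i hi
    have := Finset.mem_range.1 hi
    rw [PowerSeries.coeff_mk, coeff_toPow, Nat.cast_sub (by omega)]
  rw [Finset.sum_congr rfl h2, key N, sub_self, h.lead₀]
  rcases N with _ | N
  · rw [if_pos rfl, hs_zero, Nat.cast_zero, h.lead₀, zero_sub, h.vanish 0 _ (by decide), map_zero]
  · rw [if_neg N.succ_ne_zero, hs_one_eq_zero _ _ _ (h.commDer 0), zero_add]

/-- The same substitution v = u in the shift equation for t₂, again by telescoping. -/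
theorem diag_one : PowerSeries.C ε' * shiftHom _ (h.commDer 1) (-1) ε *
    (toPow (W 1) + PowerSeries.X * mapDer (D (1, 1)) (toPow (W 1))) = toPow (W 1) := by
  ext N
  rw [PowerSeries.coeff_mul, Finset.Nat.sum_antidiagonal_eq_sum_range_succ_mk, coeff_toPow]
  have h2 : ∀ i ∈ Finset.range N.succ,
      PowerSeries.coeff i (PowerSeries.C ε' * shiftHom _ (h.commDer 1) (-1) ε) *
        PowerSeries.coeff (N - i) (toPow (W 1) + PowerSeries.X * mapDer (D (1, 1)) (toPow (W 1))) =
      hs (timeDer D 1) (-1) i ((W 1).coeff ((N : ℤ) - i)) -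
        hs (timeDer D 1) (-1) (i + 1) ((W 1).coeff ((N : ℤ) - (i + 1 : ℕ))) := by
    intro i hi
    have := Finset.mem_range.1 hi
    have h1 := (h.shift_one i ((N : ℤ) - (i + 1 : ℕ))).1
    rw [show (N : ℤ) - (i + 1 : ℕ) + 1 = N - i by push_cast; ring] at h1
    rw [PowerSeries.coeff_C_mul, coeff_shiftHom, map_add, coeff_toPow, h.coeff_X_mul_mapDer,
      Nat.cast_sub (by omega), show (N : ℤ) - i - 1 = N - (i + 1 : ℕ) by push_cast; ring]
    linear_combination h1
  rw [Finset.sum_congr rfl h2, Finset.sum_range_sub', hs_zero, Nat.cast_zero, sub_zero,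
    h.vanish 1 ((N : ℤ) - (N.succ : ℕ)) (by push_cast; omega), map_zero, sub_zero]

/-- The coefficient identities for the shifted waves are assembled into double series, with u inside
and v outside; equations containing z are multiplied by u first. -/
theorem exists_shiftEquations : ∃ q c, ShiftEquations D (h.commDer 0) (h.commDer 1)
    (toPow (W 0)) (toPow (W 1)) ε ε' β' q c := by
  obtain ⟨c, hc0, hc⟩ := h.exists_shift_zero
  obtain ⟨q, hq⟩ := h.cross
  refine ⟨q, PowerSeries.mk c, ?_⟩
  have hmul : ∀ f : PowerSeries R, ∀ n m : ℕ, PowerSeries.coeff m (PowerSeries.coeff n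
      (outer (PowerSeries.mk c) * inner f)) = c n * PowerSeries.coeff m f := by
    intro f n m
    rw [PowerSeries.coeff_mul_C, PowerSeries.coeff_map, PowerSeries.coeff_C_mul,
      PowerSeries.coeff_mk]
  have houter_ψ : shiftOuter (h.commDer 0) (toPow (W 1)) =
      outer (PowerSeries.mk c) * inner (toPow (W 1)) -
        PowerSeries.X * inner (mapDer (D (0, 1)) (toPow (W 1))) := by
    ext n m
    rw [coeff_shiftOuter, map_sub, map_sub, hmul, coeff_toPow]
    rcases n with _ | n
    · rw [hs_zero, hc0, one_mul, PowerSeries.coeff_zero_X_mul, map_zero, sub_zero]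
    · rw [(hc n m).2, PowerSeries.coeff_succ_X_mul, PowerSeries.coeff_C]
      split_ifs
      · rw [coeff_mapDer, coeff_toPow]
      · rw [map_zero]
  refine ⟨h.comm, h.mul_inv, ?_, ?_, ?_, houter_ψ, ?_, ?_, ?_, h.diag_zero hc0 fun n k => (hc n k).1,
    h.diag_one, ?_, ?_⟩
  · rw [coeff_toPow, Nat.cast_zero, h.lead₀]
  · rw [coeff_toPow, Nat.cast_zero, h.lead₁]
  · ext n m
    rw [sub_mul, map_sub, map_sub, map_sub, map_sub, PowerSeries.coeff_C_mul, hmul,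
      h.coeff_X_mul_toPow, h.coeff_X_mul_shiftOuter]
    rcases n with _ | n
    · rw [hs_zero, hc0, one_mul, PowerSeries.coeff_zero_X_mul, PowerSeries.coeff_zero_X_mul]
    · have h1 := (hc n ((m : ℤ) - 1)).1
      rw [sub_add_cancel] at h1
      rw [PowerSeries.coeff_succ_X_mul, PowerSeries.coeff_succ_X_mul, coeff_shiftOuter, coeff_toPow,
        h1, PowerSeries.coeff_C]
      split_ifs
      · rw [map_add, coeff_toPow, h.coeff_X_mul_mapDer]
      · rw [map_zero]
  · ext n
    have h1 := congrArg (fun X => PowerSeries.coeff 0 (PowerSeries.coeff n X)) houter_ψ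
    simp only [map_sub] at h1
    rw [coeff_shiftOuter, hmul, coeff_toPow, Nat.cast_zero, h.lead₁] at h1
    rw [coeff_shiftHom, h1, map_sub, PowerSeries.coeff_mul_C n (PowerSeries.mk c) ε,
      PowerSeries.coeff_mk]
    congr 1
    rcases n with _ | n
    · rw [PowerSeries.coeff_zero_X_mul, PowerSeries.coeff_zero_X_mul, map_zero]
    · rw [PowerSeries.coeff_succ_X_mul, PowerSeries.coeff_succ_X_mul, PowerSeries.coeff_C,
        PowerSeries.coeff_C]
      split_ifs
      · rw [coeff_mapDer, coeff_toPow, Nat.cast_zero, h.lead₁, h.deriv_ε]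
      · rw [map_zero]
  · ext n m
    rw [sub_mul, map_sub, map_sub, map_sub, map_sub, PowerSeries.coeff_C_mul, mul_assoc,
      h.coeff_X_mul_shiftOuter]
    rcases n with _ | n
    · rw [hs_zero, PowerSeries.coeff_zero_X_mul, PowerSeries.coeff_zero_X_mul, PowerSeries.coeff_C,
        if_pos rfl, h.coeff_X_mul_toPow]
    · have h1 := (h.shift_one n ((m : ℤ) - 1)).1
      rw [sub_add_cancel] at h1
      rw [PowerSeries.coeff_succ_X_mul, PowerSeries.coeff_succ_X_mul, coeff_shiftOuter, coeff_toPow,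
        h1, PowerSeries.coeff_C, if_neg n.succ_ne_zero, map_zero, PowerSeries.coeff_mul_C,
        PowerSeries.coeff_map, PowerSeries.coeff_C_mul, PowerSeries.coeff_C_mul, map_add,
        coeff_shiftHom, coeff_toPow, h.coeff_X_mul_mapDer, zero_sub, neg_mul]
  · ext n m
    rw [coeff_shiftOuter, map_sub, map_sub, mul_assoc, coeff_toPow]
    rcases n with _ | n
    · rw [hs_zero, PowerSeries.coeff_zero_X_mul, PowerSeries.coeff_C,
        if_pos rfl, coeff_toPow, map_zero, sub_zero]
    · rw [(h.shift_one n m).2, PowerSeries.coeff_succ_X_mul, PowerSeries.coeff_C,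
        if_neg n.succ_ne_zero, map_zero, PowerSeries.coeff_mul_C, PowerSeries.coeff_map,
        PowerSeries.coeff_C_mul, PowerSeries.coeff_C_mul, coeff_shiftHom, coeff_mapDer, coeff_toPow,
        zero_sub, neg_mul]
  · ext n
    have h1 := congrArg (fun X : Fin 2 → LaurentSeries R => (X 0).coeff ((n : ℤ) - 1)) hq
    simp only [Pi.add_apply, Pi.smul_apply, HahnSeries.coeff_add, HahnSeries.coeff_smul,
      smul_eq_mul, coeff_waveD, if_true, one_ne_zero, if_false, add_zero, PNat.one_coe,
      Nat.cast_one, sub_add_cancel] at h1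
    rw [map_add, h.coeff_X_mul_mapDer₂, coeff_mapDer, coeff_toPow, h1, mul_add, map_add,
      mul_left_comm PowerSeries.X (PowerSeries.C β'), mul_left_comm PowerSeries.X (PowerSeries.C q),
      PowerSeries.coeff_C_mul, PowerSeries.coeff_C_mul,
      h.coeff_X_mul_mapDer, h.coeff_X_mul_toPow]
  · ext n
    have h1 := congrArg (fun X : Fin 2 → LaurentSeries R => (X 1).coeff ((n : ℤ) - 1)) hq
    simp only [Pi.add_apply, Pi.smul_apply, HahnSeries.coeff_add, HahnSeries.coeff_smul,
      smul_eq_mul, coeff_waveD, if_true, zero_ne_one, if_false, add_zero, PNat.one_coe,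
      Nat.cast_one, sub_add_cancel, map_add, h.comm (0, 1)] at h1
    rw [map_add, h.coeff_X_mul_mapDer₂, coeff_mapDer, coeff_toPow, map_add,
      mul_left_comm, PowerSeries.coeff_C_mul, PowerSeries.coeff_C_mul, map_add, coeff_toPow,
      h.coeff_X_mul_mapDer, h.coeff_X_mul_toPow]
    linear_combination h1

end WavePair

end


/-! ### The diagonal shift and the adjoint wave functions -/

theorem sum_antidiagonal_assoc {M : Type*} [AddCommMonoid M] (n : ℕ) (f : ℕ → ℕ → ℕ → M) :
    ∑ p ∈ Finset.HasAntidiagonal.antidiagonal n, ∑ q ∈ Finset.HasAntidiagonal.antidiagonal p.1,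
        f q.1 q.2 p.2 =
      ∑ p ∈ Finset.HasAntidiagonal.antidiagonal n, ∑ q ∈ Finset.HasAntidiagonal.antidiagonal p.2,
        f p.1 q.1 q.2 := by
  rw [Finset.sum_sigma', Finset.sum_sigma']
  refine Finset.sum_nbij' (fun x => ⟨(x.2.1, x.2.2 + x.1.2), (x.2.2, x.1.2)⟩)
    (fun x => ⟨(x.1.1 + x.2.1, x.2.2), (x.1.1, x.2.1)⟩) ?_ ?_ ?_ ?_ ?_
  · rintro ⟨⟨a, b⟩, ⟨c, d⟩⟩ h
    simp only [Finset.mem_sigma, Finset.HasAntidiagonal.mem_antidiagonal] at h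
    exact Finset.mem_sigma.2 ⟨Finset.HasAntidiagonal.mem_antidiagonal.2
      (show c + (d + b) = n by omega), Finset.HasAntidiagonal.mem_antidiagonal.2 rfl⟩
  · rintro ⟨⟨a, b⟩, ⟨c, d⟩⟩ h
    simp only [Finset.mem_sigma, Finset.HasAntidiagonal.mem_antidiagonal] at h
    exact Finset.mem_sigma.2 ⟨Finset.HasAntidiagonal.mem_antidiagonal.2
      (show a + c + d = n by omega), Finset.HasAntidiagonal.mem_antidiagonal.2 rfl⟩
  · rintro ⟨⟨a, b⟩, ⟨c, d⟩⟩ h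
    obtain ⟨-, h⟩ := Finset.mem_sigma.1 h
    obtain rfl : c + d = a := Finset.HasAntidiagonal.mem_antidiagonal.1 h
    rfl
  · rintro ⟨⟨a, b⟩, ⟨c, d⟩⟩ h
    obtain ⟨-, h⟩ := Finset.mem_sigma.1 h
    obtain rfl : c + d = b := Finset.HasAntidiagonal.mem_antidiagonal.1 h
    rfl
  · exact fun _ _ => rfl

section DiagShift

variable {R : Type*} [CommRing R] [Algebra ℂ R] {δ : ℕ → Derivation ℂ R R}

/-- The shift of the times in the coefficients of `f(u)` by the variable `u` itself. -/
noncomputable def diagShift (δ : ℕ → Derivation ℂ R R) (e : ℂ) (f : PowerSeries R) :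
    PowerSeries R :=
  PowerSeries.mk fun n => ∑ p ∈ Finset.HasAntidiagonal.antidiagonal n,
    hs δ e p.1 (PowerSeries.coeff p.2 f)

theorem coeff_diagShift (e : ℂ) (f : PowerSeries R) (n : ℕ) :
    PowerSeries.coeff n (diagShift δ e f) = ∑ p ∈ Finset.HasAntidiagonal.antidiagonal n,
      hs δ e p.1 (PowerSeries.coeff p.2 f) := by
  rw [diagShift, PowerSeries.coeff_mk]

theorem diagShift_C_mul (h : CommDer δ) (e : ℂ) (x : R) (f : PowerSeries R) :
    diagShift δ e (PowerSeries.C x * f) = shiftHom δ h e x * diagShift δ e f := by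
  ext n
  have h1 : ∀ p : ℕ × ℕ, hs δ e p.1 (PowerSeries.coeff p.2 (PowerSeries.C x * f)) =
      ∑ q ∈ Finset.HasAntidiagonal.antidiagonal p.1,
        hs δ e q.1 x * hs δ e q.2 (PowerSeries.coeff p.2 f) := by
    intro p
    rw [PowerSeries.coeff_C_mul, ← coeff_shiftHom h, map_mul, PowerSeries.coeff_mul]
    refine Finset.sum_congr rfl fun q _ => ?_
    rw [coeff_shiftHom, coeff_shiftHom]
  have h2 : ∀ p : ℕ × ℕ, PowerSeries.coeff p.1 (shiftHom δ h e x) *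
      PowerSeries.coeff p.2 (diagShift δ e f) =
      ∑ q ∈ Finset.HasAntidiagonal.antidiagonal p.2,
        hs δ e p.1 x * hs δ e q.1 (PowerSeries.coeff q.2 f) := by
    intro p
    rw [coeff_shiftHom, coeff_diagShift, Finset.mul_sum]
  rw [coeff_diagShift, PowerSeries.coeff_mul, Finset.sum_congr rfl fun p _ => h1 p,
    Finset.sum_congr rfl fun p _ => h2 p]
  exact sum_antidiagonal_assoc n fun i j k => hs δ e i x * hs δ e j (PowerSeries.coeff k f)

/-- The shift of the times by e[u] undoes the shift by -e[u] already present in the coefficients. -/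
theorem diagShift_shiftHom (h : CommDer δ) (e : ℂ) (x : R) :
    diagShift δ e (shiftHom δ h (-e) x) = PowerSeries.C x := by
  ext n
  rw [coeff_diagShift, PowerSeries.coeff_C, ← sum_hs_hs_neg h e n x]
  refine Finset.sum_congr rfl fun p _ => ?_
  rw [coeff_shiftHom]

end DiagShift

section

variable {R : Type*} [CommRing R] [Algebra ℂ R] {D : TimeIndex → Derivation ℂ R R}
  {W V : Fin 2 → LaurentSeries R}

theorem coeff_upperWave_self (ν : Fin 2) (n : ℕ) (k : ℕ) :
    (upperWave D W ν n ν).coeff ((k : ℤ) - n) = ∑ j ∈ Finset.range (n + 1),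
      hs (timeDer D ν) 1 j ((W ν).coeff ((k : ℤ) - j)) := by
  induction n with
  | zero => rw [Finset.sum_range_one, hs_zero, upperWave]
  | succ n ih =>
    rw [coeff_upperWave_succ, if_pos rfl, Finset.sum_range_succ, ← ih, add_comm,
      show (k : ℤ) - (n + 1 : ℕ) + 1 = k - n by push_cast; ring]

theorem vanish_upperWave_self (hW : ∀ μ, Vanish 0 (W μ)) (ν : Fin 2) (n : ℕ) :
    Vanish (-(n : ℤ)) (upperWave D W ν n ν) := by
  induction n with
  | zero => rw [Nat.cast_zero, neg_zero]; exact hW ν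
  | succ n ih =>
    intro k hk
    rw [coeff_upperWave_succ, if_pos rfl, hW ν k (by omega), map_zero, zero_add]
    exact ih _ (by push_cast at hk; omega)

/-- The residue of z⁻¹ f(z) / (1 - v z), with f a series in z⁻¹, is f at z = v⁻¹. The pairing of the
shifted wave therefore collects the coefficients of W(t_ν + [u]; u) V(u). -/
theorem coeff_upperWave_mul_self (hW : ∀ μ, Vanish 0 (W μ)) (hV : ∀ μ, Vanish 0 (V μ)) (ν : Fin 2)
    (n : ℕ) : (upperWave D W ν n ν * V ν).coeff 0 =
      PowerSeries.coeff n (diagShift (timeDer D ν) 1 (toPow (W ν)) * toPow (V ν)) := by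
  rw [coeff_mul_eq_sum (vanish_upperWave_self hW ν n) (hV ν), PowerSeries.coeff_mul,
    Finset.Nat.sum_antidiagonal_eq_sum_range_succ_mk]
  refine Finset.sum_bij' (fun i _ => (i + n).toNat) (fun k _ => (k : ℤ) - n) ?_ ?_ ?_ ?_ ?_
  · intro i hi
    have := Finset.mem_Icc.1 hi
    exact Finset.mem_range.2 (by omega)
  · intro k hk
    have := Finset.mem_range.1 hk
    exact Finset.mem_Icc.2 (by omega)
  · intro i hi
    have := Finset.mem_Icc.1 hi
    omega
  · intro k hk
    omega
  · intro i hi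
    have := Finset.mem_Icc.1 hi
    obtain ⟨k, rfl⟩ : ∃ k : ℕ, i = (k : ℤ) - n := ⟨(i + n).toNat, by omega⟩
    have hk : k ≤ n := by omega
    have hkk : ((k : ℤ) - n + n).toNat = k := by omega
    simp only [hkk]
    rw [coeff_upperWave_self, coeff_toPow, coeff_diagShift,
      Finset.Nat.sum_antidiagonal_eq_sum_range_succ_mk, Nat.cast_sub hk,
      show (0 : ℤ) - (k - n) = n - k by ring]
    congr 1
    symm
    refine Finset.sum_subset_zero_on_sdiff (Finset.range_mono (by omega)) ?_ ?_
    · intro j hj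
      have := (Finset.mem_sdiff.1 hj).2
      rw [Finset.mem_range] at this
      rw [hW ν _ (by omega), map_zero]
    · intro j hj
      have := Finset.mem_range.1 hj
      rw [coeff_toPow, Nat.cast_sub (by omega)]

theorem coeff_upperWave_of_ne {ν μ : Fin 2} (hνμ : ν ≠ μ) (n : ℕ) (k : ℤ) :
    (upperWave D W ν n μ).coeff k = hs (timeDer D ν) 1 n ((W μ).coeff k) := by
  rcases n with _ | n
  · rw [hs_zero, upperWave]
  · rw [coeff_upperWave_succ, if_neg hνμ, add_zero]

theorem coeff_upperWave_mul_of_ne (hW : ∀ μ, Vanish 0 (W μ)) (hV : ∀ μ, Vanish 0 (V μ))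
    {ν μ : Fin 2} (hνμ : ν ≠ μ) (n : ℕ) : (upperWave D W ν n μ * V μ).coeff 0 =
      hs (timeDer D ν) 1 n ((W μ).coeff 0) * (V μ).coeff 0 := by
  rw [coeff_mul_zero (fun k hk => by rw [coeff_upperWave_of_ne hνμ, hW μ k hk, map_zero]) (hV μ),
    coeff_upperWave_of_ne hνμ]

variable {ε ε' β' : R}

/-- Orthogonality applied to w(t₁ + [v]). In the second component the exponential is not shifted, so
only the product of leading coefficients ε(t₁ + [v]) ε' contributes. -/
theorem WavePair.diagShift_mul_zero (h : WavePair D W V ε ε' β') :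
    diagShift (timeDer D 0) 1 (toPow (W 0)) * toPow (V 0) =
      PowerSeries.C ε' * shiftHom _ (h.commDer 0) 1 ε := by
  ext n
  have := h.pairing_eq_zero (h.upperWave_mem (ν := 0) n)
  rw [pairing, sub_eq_zero, coeff_upperWave_mul_self h.vanish h.vanish',
    coeff_upperWave_mul_of_ne h.vanish h.vanish' (by decide), h.lead₁, h.lead₁'] at this
  rw [this, PowerSeries.coeff_C_mul, coeff_shiftHom, mul_comm]

/-- Likewise for w(t₂ + [v]), where the leading coefficients of the unshifted component are 1. -/
theorem WavePair.diagShift_mul_one (h : WavePair D W V ε ε' β') :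
    diagShift (timeDer D 1) 1 (toPow (W 1)) * toPow (V 1) = 1 := by
  ext n
  have := h.pairing_eq_zero (h.upperWave_mem (ν := 1) n)
  rw [pairing, sub_eq_zero, coeff_upperWave_mul_self h.vanish h.vanish',
    coeff_upperWave_mul_of_ne h.vanish h.vanish' (by decide), h.lead₀, h.lead₀', mul_one] at this
  rw [← this, ← map_one (shiftHom _ (h.commDer 1) 1), coeff_shiftHom]

end


/-! ### Logarithmic derivatives and closedness of `η` -/

theorem nabla_log {R : Type*} [CommRing R] [Algebra ℂ R] {δ : ℕ → Derivation ℂ R R} (c : ℂ)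
    {b E : R} (hE : ∀ j, δ j E = δ j b * E) {Y : PowerSeries R} (hY : PowerSeries.coeff 0 Y = 0) :
    nabla δ c (PowerSeries.C b + logOneAdd Y) * (PowerSeries.C E * (1 + Y)) =
      nabla δ c (PowerSeries.C E * (1 + Y)) := by
  have h1 : nabla δ c (PowerSeries.C E) = nabla δ c (PowerSeries.C b) * PowerSeries.C E := by
    ext n
    rw [PowerSeries.coeff_mul_C]
    rcases n with _ | n
    · rw [coeff_nabla_zero, coeff_nabla_zero, zero_mul]
    · rw [coeff_nabla_C_succ, coeff_nabla_C_succ, hE, smul_mul_assoc]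
  have h2 : nabla δ c (logOneAdd Y) * (1 + Y) = nabla δ c Y :=
    map_logOneAdd (T := (nabla δ c).toLinearMap) (fun f g => by
      change nabla δ c (f * g) = nabla δ c f * g + f * nabla δ c g
      rw [Derivation.leibniz, smul_eq_mul, smul_eq_mul]
      ring) (isLocal_nabla c) hY
  rw [Derivation.leibniz, map_add, h1, map_add, Derivation.map_one_eq_zero, zero_add, ← h2,
    smul_eq_mul, smul_eq_mul]
  ring

namespace Unknowns

variable {U : TimeDomain} (S : Unknowns U)

/-- The logarithmic derivative of `φ_ν` along `u d/du + ∑_k u^k ∂/∂t_{ν,k}`. -/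
noncomputable def logDeriv (ν : Fin 2) : PowerSeries (SmoothFn U) :=
  nabla (timeDer tD ν) 1 (S.logPhi ν)

theorem coeff_Nop (ν : Fin 2) (f : PowerSeries (SmoothFn U)) (n : ℕ) :
    PowerSeries.coeff (n + 1) (Nop ν f) = PowerSeries.coeff n (nabla (timeDer tD ν) 1 f) := by
  rw [Nop, PowerSeries.coeff_succ_X_mul, PowerSeries.coeff_mk, coeff_nabla, one_smul]
  rfl

theorem η_eq (ν : Fin 2) (n : ℕ) :
    S.η (ν, n.succPNat) = -PowerSeries.coeff (n + 1) (S.logDeriv ν) := by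
  rw [logDeriv, ← coeff_Nop]
  rfl

theorem toPow_W (ν : Fin 2) : toPow (S.W ν) = PowerSeries.C (S.lead ν) *
    (1 + PowerSeries.mk fun n => if h : 0 < n then S.a ν ⟨n, h⟩ else 0) := by
  refine PowerSeries.ext fun n => ?_
  rw [coeff_toPow, coeff_W, PowerSeries.coeff_C_mul, map_add, PowerSeries.coeff_one,
    PowerSeries.coeff_mk, a']
  by_cases hn : 0 < n
  · rw [dif_pos hn, if_neg hn.ne', dif_pos hn, zero_add]
  · rw [dif_neg hn, if_pos (by omega), dif_neg hn, add_zero]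

theorem nabla_toPow_W (ν : Fin 2) :
    nabla (timeDer tD ν) 1 (toPow (S.W ν)) = S.logDeriv ν * toPow (S.W ν) := by
  rw [toPow_W, logDeriv, logPhi]
  refine (nabla_log 1 (fun j => ?_) ?_).symm
  · fin_cases ν
    · change tD _ 1 = tD _ 0 * 1
      rw [Derivation.map_one_eq_zero, map_zero, mul_one]
    · exact pd_expFn _ _
  · rw [PowerSeries.coeff_mk, dif_neg (lt_irrefl 0)]

/-- Up to sign, the η_{ν,k} are the coefficients of ∇ log φ_ν, for which the shift equations give
the symmetry within each set of times and between the two. -/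
theorem η_closed {S : Unknowns U} (hS : S.IsSolution) (i j : TimeIndex) :
    pd i (S.η j) = pd j (S.η i) := by
  obtain ⟨q, c, h⟩ := (wavePair hS).exists_shiftEquations
  have e0 := S.nabla_toPow_W 0
  have e1 := S.nabla_toPow_W 1
  obtain ⟨μ, k⟩ := i
  obtain ⟨ν, l⟩ := j
  obtain ⟨m, rfl⟩ : ∃ m : ℕ, k = m.succPNat := ⟨k.natPred, (PNat.succPNat_natPred k).symm⟩
  obtain ⟨n, rfl⟩ : ∃ n : ℕ, l = n.succPNat := ⟨l.natPred, (PNat.succPNat_natPred l).symm⟩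
  rw [η_eq, η_eq, map_neg, map_neg, neg_inj]
  fin_cases μ <;> fin_cases ν
  · exact h.closed_φ e0 n m
  · exact (h.closed_mixed e0 e1 m n).symm
  · exact h.closed_mixed e0 e1 n m
  · exact h.closed_ψ e1 n m

end Unknowns


/-! ### The Poincaré lemma on star-shaped domains of times -/

section Poincare

/-- The inclusion of the space of times with coordinates in a finite set. -/
noncomputable def incl (F : Finset TimeIndex) : (F → ℝ) →ₗ[ℝ] Times :=
  ∑ j : F, (LinearMap.proj j).smulRight (dir j.1)

theorem incl_apply (F : Finset TimeIndex) (c : F → ℝ) : incl F c = ∑ j : F, c j • dir j.1 := by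
  simp [incl]

theorem incl_single {F : Finset TimeIndex} (j : F) : incl F (Pi.single j 1) = dir j.1 := by
  rw [incl_apply, Finset.sum_eq_single_of_mem j (Finset.mem_univ _)]
  · simp
  · intro k _ hk
    rw [Pi.single_eq_of_ne hk, zero_smul]

theorem incl_coe {F : Finset TimeIndex} {x : Times} (h : x.support ⊆ F) :
    incl F (fun j => x j.1) = x := by
  have h1 : (∑ j ∈ F, x j • dir j) = x := by
    conv_rhs => rw [← Finsupp.sum_single x, Finsupp.sum_of_support_subset x h _ (by simp)]
    exact Finset.sum_congr rfl fun j _ => by simp [dir]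
  rw [incl_apply, ← Finset.sum_coe_sort F (fun j => x j • dir j)] at *
  exact h1

theorem incl_eval {F : Finset TimeIndex} (c : F → ℝ) (j : F) : incl F c j.1 = c j := by
  rw [incl_apply, Finsupp.finsetSum_apply, Finset.sum_eq_single_of_mem j (Finset.mem_univ _)]
  · simp [dir]
  · intro k _ hk
    simp [dir, Subtype.coe_injective.ne hk]

theorem support_incl (F : Finset TimeIndex) (c : F → ℝ) : (incl F c).support ⊆ F := by
  intro i hi
  by_contra h
  refine Finsupp.mem_support_iff.1 hi ?_
  rw [incl_apply, Finsupp.finsetSum_apply]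
  refine Finset.sum_eq_zero fun k _ => ?_
  have : k.1 ≠ i := fun hk => h (hk ▸ k.2)
  simp [dir, this]

variable {V : TimeDomain} (g : TimeIndex → SmoothFn V) (p : Times)

/-- The integral of the 1-form `∑ g_i dt_i` along the segment from `p` to `x`. -/
noncomputable def segmentIntegral (x : Times) : ℂ :=
  ∫ t in (0 : ℝ)..1, (x - p).sum fun i a => a • extendZero (g i).1 (p + t • (x - p))

/-- The 1-form `∑ g_i dt_i` on a finite-dimensional slice through `p`. -/
noncomputable def sliceForm (F : Finset TimeIndex) (c : F → ℝ) : (F → ℝ) →L[ℝ] ℂ :=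
  ∑ j : F, ContinuousLinearMap.smulRightL ℝ (F → ℝ) ℂ (ContinuousLinearMap.proj j)
    (extendZero (g j.1).1 (p + incl F c))

theorem sliceForm_apply (F : Finset TimeIndex) (c a : F → ℝ) :
    sliceForm g p F c a = ∑ j : F, a j • extendZero (g j.1).1 (p + incl F c) := by
  simp [sliceForm]

theorem contDiffOn_sliceForm (F : Finset TimeIndex) :
    ContDiffOn ℝ ∞ (sliceForm g p F) {c | p + incl F c ∈ V.carrier} := by
  refine ContDiffOn.sum fun j _ => ?_
  exact (ContinuousLinearMap.contDiff _).comp_contDiffOn ((g j.1).2 (F → ℝ) (incl F) p)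

/-- The derivative of `sliceForm`. -/
noncomputable def sliceFormDeriv (F : Finset TimeIndex) (c : F → ℝ) :
    (F → ℝ) →L[ℝ] (F → ℝ) →L[ℝ] ℂ :=
  ∑ j : F, (ContinuousLinearMap.smulRightL ℝ (F → ℝ) ℂ (ContinuousLinearMap.proj j)).comp
    (fderiv ℝ (fun c => extendZero (g j.1).1 (p + incl F c)) c)

theorem hasFDerivAt_sliceForm (F : Finset TimeIndex) {c : F → ℝ} (hc : p + incl F c ∈ V.carrier) :
    HasFDerivAt (sliceForm g p F) (sliceFormDeriv g p F c) c := by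
  refine HasFDerivAt.fun_sum fun j _ => ?_
  exact (ContinuousLinearMap.hasFDerivAt _).comp c (hasFDerivAt_slice (g j.1) (incl F) p hc)

theorem sliceFormDeriv_apply (F : Finset TimeIndex) {c : F → ℝ} (hc : p + incl F c ∈ V.carrier)
    (a b : F → ℝ) : sliceFormDeriv g p F c a b =
      ∑ j : F, ∑ i : F, (b j * a i) • extendZero (pd i.1 (g j.1)).1 (p + incl F c) := by
  simp only [sliceFormDeriv, _root_.sum_apply, ContinuousLinearMap.comp_apply,
    ContinuousLinearMap.smulRightL_apply_apply, ContinuousLinearMap.smulRight_apply,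
    ContinuousLinearMap.proj_apply]
  refine Finset.sum_congr rfl fun j _ => ?_
  have ha : a = ∑ i : F, a i • (Pi.single i 1 : F → ℝ) := by
    ext k
    simp [Pi.single_apply]
  conv_lhs => rw [ha, map_sum, Finset.smul_sum]
  refine Finset.sum_congr rfl fun i _ => ?_
  rw [map_smul, smul_smul, ← extendZero_partialDeriv (g j.1) (incl F) p hc (incl_single i)]
  rfl

theorem sliceFormDeriv_symm (hg : ∀ i j, pd i (g j) = pd j (g i)) (F : Finset TimeIndex)
    {c : F → ℝ} (hc : p + incl F c ∈ V.carrier) (a b : F → ℝ) :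
    sliceFormDeriv g p F c a b = sliceFormDeriv g p F c b a := by
  rw [sliceFormDeriv_apply g p F hc, sliceFormDeriv_apply g p F hc, Finset.sum_comm]
  refine Finset.sum_congr rfl fun j _ => Finset.sum_congr rfl fun i _ => ?_
  rw [hg, mul_comm]

theorem curveIntegral_sliceForm (F : Finset TimeIndex) (c : F → ℝ) :
    curveIntegral (sliceForm g p F) (Path.segment 0 c) = segmentIntegral g p (p + incl F c) := by
  rw [curveIntegral_segment, segmentIntegral]
  refine intervalIntegral.integral_congr fun t _ => ?_
  simp only [sub_zero, add_sub_cancel_left]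
  rw [sliceForm_apply, Finsupp.sum_of_support_subset _ (support_incl F c) _ (by simp),
    ← Finset.sum_coe_sort F]
  refine Finset.sum_congr rfl fun j _ => ?_
  rw [incl_eval, AffineMap.lineMap_apply]
  simp

variable {g p}

/-- A slice is star-shaped but not necessarily convex. The segment to a given point is compact and
convex, so it has a convex open neighbourhood inside the slice, and the Poincaré lemma for convex
sets applies there. -/
theorem hasFDerivAt_segmentIntegral (hg : ∀ i j, pd i (g j) = pd j (g i))
    (hp : StarConvex ℝ p V.carrier) (F : Finset TimeIndex) {c : F → ℝ}
    (hc : p + incl F c ∈ V.carrier) :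
    HasFDerivAt (fun c => segmentIntegral g p (p + incl F c)) (sliceForm g p F c) c := by
  have hopen := isOpen_slice V (incl F) p
  have hseg : segment ℝ 0 c ⊆ {c | p + incl F c ∈ V.carrier} := by
    rintro _ ⟨a, b, ha, hb, hab, rfl⟩
    have := hp hc ha hb hab
    rw [smul_add, ← add_assoc, ← add_smul, hab, one_smul] at this
    simpa using this
  have hcomp : IsCompact (segment ℝ 0 c) := by
    rw [segment_eq_image_lineMap]
    exact isCompact_Icc.image (by fun_prop)
  obtain ⟨r, hr, hrs⟩ := hcomp.exists_thickening_subset_open hopen hseg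
  have hsub := Metric.self_subset_thickening hr (segment ℝ 0 c)
  have hω : ∀ x ∈ Metric.thickening r (segment ℝ 0 c), HasFDerivWithinAt (sliceForm g p F)
      (sliceFormDeriv g p F x) (Metric.thickening r (segment ℝ 0 c)) x := fun x hx =>
    (hasFDerivAt_sliceForm g p F (hrs hx)).hasFDerivWithinAt
  have h := ((convex_segment (𝕜 := ℝ) 0 c).thickening
    r).hasFDerivWithinAt_curveIntegral_segment_of_hasFDerivWithinAt_symmetric hω
      (fun x hx a _ b _ => sliceFormDeriv_symm g p hg F (hrs hx) a b)
      (hsub (left_mem_segment ℝ _ _)) (hsub (right_mem_segment ℝ _ _))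
  have h' := h.hasFDerivAt (Metric.isOpen_thickening.mem_nhds (hsub (right_mem_segment ℝ _ _)))
  simpa only [curveIntegral_sliceForm] using h'

/-- The derivative of the integral is the 1-form itself, which is smooth. -/
theorem contDiffOn_segmentIntegral (hg : ∀ i j, pd i (g j) = pd j (g i))
    (hp : StarConvex ℝ p V.carrier) (F : Finset TimeIndex) :
    ContDiffOn ℝ ∞ (fun c => segmentIntegral g p (p + incl F c))
      {c | p + incl F c ∈ V.carrier} := by
  rw [contDiffOn_infty_iff_fderiv_of_isOpen (isOpen_slice V (incl F) p)]
  refine ⟨fun c hc => (hasFDerivAt_segmentIntegral hg hp F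
    hc).differentiableAt.differentiableWithinAt, ?_⟩
  exact (contDiffOn_sliceForm g p F).congr fun c hc => (hasFDerivAt_segmentIntegral hg hp F hc).fderiv

theorem exists_finset_support {W : Type} [AddCommGroup W] [Module ℝ W] [FiniteDimensional ℝ W]
    (L : W →ₗ[ℝ] Times) : ∃ F : Finset TimeIndex, ∀ v, (L v).support ⊆ F := by
  let b := Module.finBasis ℝ W
  refine ⟨Finset.univ.biUnion fun j => (L (b j)).support, fun v i hi => ?_⟩
  by_contra h
  refine Finsupp.mem_support_iff.1 hi ?_
  rw [← b.sum_repr v]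
  simp only [map_sum, map_smul, Finsupp.coe_finsetSum, Finset.sum_apply, Finsupp.smul_apply]
  refine Finset.sum_eq_zero fun j _ => ?_
  have : i ∉ (L (b j)).support := fun hj => h (Finset.mem_biUnion.2 ⟨j, Finset.mem_univ _, hj⟩)
  rw [Finsupp.notMem_support_iff.1 this, smul_zero]

/-- An arbitrary finite-dimensional slice involves finitely many coordinates, so it maps affinely
into a coordinate slice through `p`. The support of `q - p` is added because the slice need not
contain `p`. -/
theorem contDiffOn_segmentIntegral_comp (hg : ∀ i j, pd i (g j) = pd j (g i))
    (hp : StarConvex ℝ p V.carrier) (W : Type) [NormedAddCommGroup W] [NormedSpace ℝ W]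
    [FiniteDimensional ℝ W] (L : W →ₗ[ℝ] Times) (q : Times) :
    ContDiffOn ℝ ∞ (fun v => segmentIntegral g p (q + L v)) {v | q + L v ∈ V.carrier} := by
  obtain ⟨F₀, hF₀⟩ := exists_finset_support L
  let F := F₀ ∪ (q - p).support
  have hF : ∀ v, p + incl F (fun j => (q - p + L v) j.1) = q + L v := by
    intro v
    rw [incl_coe]
    · abel
    · refine Finsupp.support_add.trans (Finset.union_subset Finset.subset_union_right ?_)
      exact (hF₀ v).trans Finset.subset_union_left
  have hcd : ContDiff ℝ ∞ fun v : W => (fun j : F => (q - p + L v) j.1) := by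
    rw [contDiff_pi]
    intro j
    have : ContDiff ℝ ∞ fun v : W => L v j.1 :=
      (LinearMap.toContinuousLinearMap ((Finsupp.lapply j.1 : Times →ₗ[ℝ] ℝ).comp L)).contDiff
    exact contDiff_const.add this
  refine ((contDiffOn_segmentIntegral hg hp F).comp hcd.contDiffOn fun v hv => ?_).congr
    fun v _ => ?_
  · change p + incl F _ ∈ V.carrier
    rw [hF]
    exact hv
  · change _ = segmentIntegral g p (p + incl F _)
    rw [hF]

/-- The Poincaré lemma on star-shaped domains of times. -/
theorem exists_primitive (hg : ∀ i j, pd i (g j) = pd j (g i)) (hp : StarConvex ℝ p V.carrier) :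
    ∃ f : SmoothFn V, ∀ i, pd i f = g i := by
  refine ⟨⟨fun x => segmentIntegral g p x.1, isSmooth_congr (F := segmentIntegral g p)
    (fun _ _ => rfl) (contDiffOn_segmentIntegral_comp hg hp)⟩, fun i => ?_⟩
  refine Subtype.ext (funext fun x => ?_)
  -- The slice has to contain both the point `x` and the direction of differentiation.
  let F := (x.1 - p).support ∪ {i}
  have hiF : i ∈ F := Finset.mem_union_right _ (Finset.mem_singleton_self i)
  obtain ⟨c, hx⟩ : ∃ c, p + incl F c = x.1 :=
    ⟨_, by rw [incl_coe Finset.subset_union_left, add_sub_cancel]⟩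
  have h1 := hasFDerivAt_segmentIntegral hg hp F (c := c) (by rw [hx]; exact x.2)
  have hl : HasDerivAt (fun s : ℝ => c + s • (Pi.single (⟨i, hiF⟩ : F) (1 : ℝ) : F → ℝ))
      (Pi.single ⟨i, hiF⟩ 1) 0 := by
    simpa using ((hasDerivAt_id (0 : ℝ)).smul_const
      (Pi.single (⟨i, hiF⟩ : F) (1 : ℝ) : F → ℝ)).const_add c
  have h2 := HasFDerivAt.comp_hasDerivAt (0 : ℝ) (by rwa [zero_smul, add_zero]) hl
  have h3 : sliceForm g p F c (Pi.single ⟨i, hiF⟩ 1) = (g i).1 x := by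
    rw [sliceForm_apply, Finset.sum_eq_single_of_mem ⟨i, hiF⟩ (Finset.mem_univ _), hx,
      extendZero_of_mem _ x.2]
    · simp
    · intro k _ hk
      rw [Pi.single_eq_of_ne hk, zero_smul]
  rw [h3] at h2
  refine (h2.congr_of_eventuallyEq ?_).deriv
  filter_upwards [eventually_mem i x] with s hs
  rw [extendZero_of_mem _ hs]
  simp only [Function.comp_apply, map_add, map_smul, incl_single, ← add_assoc, hx]

end Poincare


/-! ### Existence of tau functions -/

theorem extendZero_restrict {U V : TimeDomain} (h : V.Sub U) (f : SmoothFn U) {x : Times}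
    (hx : x ∈ V.carrier) : extendZero (restrict h f).1 x = extendZero f.1 x := by
  rw [extendZero_of_mem _ hx, extendZero_of_mem _ (h hx)]
  rfl

theorem restrict_pd {U V : TimeDomain} (h : V.Sub U) (i : TimeIndex) (f : SmoothFn U) :
    restrict h (pd i f) = pd i (restrict h f) := by
  refine Subtype.ext (funext fun p => ?_)
  refine (((hasDerivAt_partialDeriv i f ⟨p.1, h p.2⟩).congr_of_eventuallyEq ?_).deriv).symm
  filter_upwards [eventually_mem i p] with s hs
  exact extendZero_restrict h f hs

namespace Unknowns

variable {U : TimeDomain} {S : Unknowns U}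

theorem exists_tau_of_starConvex (hS : S.IsSolution) {V : TimeDomain} (h : V.Sub U) {p : Times}
    (hp : StarConvex ℝ p V.carrier) : ∃ τ₁ : (SmoothFn V)ˣ, S.IsTau₁ h τ₁ := by
  obtain ⟨f, hf⟩ := exists_primitive (g := fun i => restrict h (S.η i))
    (fun i j => by rw [← restrict_pd, ← restrict_pd, η_closed hS]) hp
  refine ⟨expUnit f, fun i => ?_⟩
  change pd i (expFn f) = restrict h (S.η i) * expFn f
  rw [pd_expFn, hf]

end Unknowns

/-- An open box in the space of times. -/
def boxDomain (p : Times) (ε : TimeIndex → ℝ) : TimeDomain where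
  carrier := {q | ∀ i, |q i - p i| < ε i}
  exists_box q hq := by
    refine ⟨fun i => ε i - |q i - p i|, fun i => sub_pos.2 (hq i), fun r hr i => ?_⟩
    have h1 := abs_add_le (r i - q i) (q i - p i)
    rw [sub_add_sub_cancel] at h1
    linarith [hr i]

theorem starConvex_boxDomain (p : Times) (ε : TimeIndex → ℝ) :
    StarConvex ℝ p (boxDomain p ε).carrier := by
  intro q hq a b ha hb hab i
  have h1 : (a • p + b • q) i - p i = b * (q i - p i) := by
    rw [Finsupp.add_apply, Finsupp.smul_apply, Finsupp.smul_apply, smul_eq_mul, smul_eq_mul,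
      eq_sub_of_add_eq hab]
    ring
  rw [h1, abs_mul, abs_of_nonneg hb]
  have h2 : b ≤ 1 := by linarith
  have h3 := abs_nonneg (q i - p i)
  nlinarith [hq i, mul_le_mul_of_nonneg_right h2 h3]

theorem Unknowns.exists_tau_near {U : TimeDomain} {S : Unknowns U} (hS : S.IsSolution) {p : Times}
    (hp : p ∈ U.carrier) : ∃ (V : TimeDomain) (h : V.Sub U), p ∈ V.carrier ∧
      ∃ τ₁ : (SmoothFn V)ˣ, S.IsTau₁ h τ₁ := by
  obtain ⟨ε, hε, hbox⟩ := U.exists_box p hp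
  have h : (boxDomain p ε).Sub U := fun q hq => hbox q hq
  refine ⟨boxDomain p ε, h, fun i => ?_, exists_tau_of_starConvex hS h (starConvex_boxDomain p ε)⟩
  rw [sub_self, abs_zero]
  exact hε i


/-! ### Taylor expansions and the weight grading -/

section Residue

theorem weight_zero : weight 0 = 0 := Finsupp.sum_zero_index

theorem weight_add (m n : TimeIndex →₀ ℕ) : weight (m + n) = weight m + weight n :=
  Finsupp.sum_add_index' (fun _ => mul_zero _) fun _ _ _ => mul_add _ _ _

theorem weight_single (i : TimeIndex) : weight (Finsupp.single i 1) = i.2 := by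
  rw [weight, Finsupp.sum_single_index (mul_zero _), mul_one]

variable {R : Type*} [CommRing R]

/-- The coefficients of `z^k` have no terms of weight less than `k`. -/
def WeightBound (f : PowerSeries (MvPowerSeries TimeIndex R)) : Prop :=
  ∀ k m, weight m < k → MvPowerSeries.coeff m (PowerSeries.coeff k f) = 0

theorem WeightBound.mul {f g : PowerSeries (MvPowerSeries TimeIndex R)} (hf : WeightBound f)
    (hg : WeightBound g) : WeightBound (f * g) := by
  classical
  intro k m hm
  rw [PowerSeries.coeff_mul, map_sum]
  refine Finset.sum_eq_zero fun p hp => ?_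
  rw [MvPowerSeries.coeff_mul]
  refine Finset.sum_eq_zero fun q hq => ?_
  rw [← Finset.HasAntidiagonal.mem_antidiagonal.1 hp, ← Finset.HasAntidiagonal.mem_antidiagonal.1 hq,
    weight_add] at hm
  rcases lt_or_ge (weight q.1) p.1 with h | h
  · rw [hf _ _ h, zero_mul]
  · rw [hg _ _ (by omega), mul_zero]

theorem weightBound_one : WeightBound (1 : PowerSeries (MvPowerSeries TimeIndex R)) := by
  intro k m hm
  rw [PowerSeries.coeff_one, if_neg (by omega), map_zero]

variable [Algebra ℂ R]

theorem coeff_smul_complex (m : TimeIndex →₀ ℕ) (c : ℂ) (F : MvPowerSeries TimeIndex R) :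
    MvPowerSeries.coeff m (c • F) = c • MvPowerSeries.coeff m F := rfl

/-- A set of power series without constant term that is closed under differentiation
contains zero only. -/
theorem eq_zero_of_pderiv_mem (s : Set (MvPowerSeries TimeIndex R))
    (h0 : ∀ F ∈ s, MvPowerSeries.coeff 0 F = 0)
    (hd : ∀ F ∈ s, ∀ i, MvPowerSeries.pderiv R i F ∈ s) {F : MvPowerSeries TimeIndex R}
    (hF : F ∈ s) : F = 0 := by
  ext m
  rw [map_zero]
  -- The coefficient at n + e_i is, up to the invertible factor n_i + 1, the coefficient at n of a
  -- derivative, and n has smaller weight.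
  induction hw : weight m using Nat.strong_induction_on generalizing m F with
  | _ w ih =>
    by_cases hm : m = 0
    · rw [hm, h0 F hF]
    obtain ⟨i, hi⟩ := Finsupp.ne_iff.1 hm
    obtain ⟨n, rfl⟩ : ∃ n, m = n + Finsupp.single i 1 :=
      ⟨m - Finsupp.single i 1, (tsub_add_cancel_of_le (Finsupp.single_le_iff.2
        (Nat.one_le_iff_ne_zero.2 hi))).symm⟩
    rw [weight_add, weight_single] at hw
    have h1 := ih _ (by have := i.2.pos; omega) (hd F hF i) n rfl
    rw [MvPowerSeries.coeff_pderiv] at h1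
    refine smul_cancel (n := n i) ?_
    rw [smul_zero, ← h1, Algebra.smul_def, mul_comm]
    simp

/-- A Taylor expansion for a family of derivations. -/
structure IsTaylor (D : TimeIndex → Derivation ℂ R R) (T : R →ₗ[ℂ] MvPowerSeries TimeIndex R) :
    Prop where
  coeff_zero : ∀ x, MvPowerSeries.coeff 0 (T x) = x
  pderiv : ∀ i x, MvPowerSeries.pderiv R i (T x) = T (D i x)

/-- The defects T(xy) - T(x) T(y) have no constant term, and by the Leibniz rule a derivative of a
defect is a sum of two defects. The additive group they generate is therefore zero. -/
theorem IsTaylor.map_mul {D : TimeIndex → Derivation ℂ R R} {T : R →ₗ[ℂ] MvPowerSeries TimeIndex R}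
    (hT : IsTaylor D T) (x y : R) : T (x * y) = T x * T y := by
  rw [← sub_eq_zero]
  refine eq_zero_of_pderiv_mem (AddSubgroup.closure {F | ∃ x y, F = T (x * y) - T x * T y} :
    Set (MvPowerSeries TimeIndex R))
    (fun F hF => ?_) (fun F hF i => ?_) (AddSubgroup.subset_closure ⟨x, y, rfl⟩)
  · induction hF using AddSubgroup.closure_induction with
    | mem F hF =>
      obtain ⟨x, y, rfl⟩ := hF
      rw [map_sub, hT.coeff_zero, MvPowerSeries.coeff_zero_eq_constantCoeff_apply (T x * T y),
        _root_.map_mul, ← MvPowerSeries.coeff_zero_eq_constantCoeff_apply,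
        ← MvPowerSeries.coeff_zero_eq_constantCoeff_apply, hT.coeff_zero, hT.coeff_zero, sub_self]
    | zero => rw [map_zero]
    | add F G _ _ hF hG => rw [map_add, hF, hG, add_zero]
    | neg F _ hF => rw [map_neg, hF, neg_zero]
  · rw [SetLike.mem_coe] at hF ⊢
    induction hF using AddSubgroup.closure_induction with
    | mem F hF =>
      obtain ⟨x, y, rfl⟩ := hF
      have : MvPowerSeries.pderiv R i (T (x * y) - T x * T y) =
          (T (x * D i y) - T x * T (D i y)) + (T (y * D i x) - T y * T (D i x)) := by
        rw [map_sub, hT.pderiv, Derivation.leibniz, Derivation.leibniz, hT.pderiv, hT.pderiv, map_add,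
          smul_eq_mul, smul_eq_mul, smul_eq_mul, smul_eq_mul]
        ring
      rw [this]
      exact add_mem (AddSubgroup.subset_closure ⟨x, D i y, rfl⟩)
        (AddSubgroup.subset_closure ⟨y, D i x, rfl⟩)
    | zero => rw [map_zero]; exact zero_mem _
    | add F G _ _ hF hG => rw [map_add]; exact add_mem hF hG
    | neg F _ hF => rw [map_neg]; exact neg_mem hF

variable (R) in
/-- The series `exp (∑ s_{ν,k} z^k)`. -/
noncomputable def expTimes (ν : Fin 2) : PowerSeries (MvPowerSeries TimeIndex R) :=
  expSeries (PowerSeries.mk fun k => if h : 0 < k then MvPowerSeries.X (ν, ⟨k, h⟩) else 0)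

/-- The variable s_{ν,k} has weight k and is attached to z^k, and the bound is multiplicative. -/
theorem weightBound_expTimes (ν : Fin 2) : WeightBound (expTimes R ν) := by
  classical
  have hX : WeightBound (PowerSeries.mk fun k => if h : 0 < k then
      (MvPowerSeries.X (ν, ⟨k, h⟩) : MvPowerSeries TimeIndex R) else 0) := by
    intro k m hm
    rw [PowerSeries.coeff_mk]
    split_ifs with h
    · rw [MvPowerSeries.coeff_X, if_neg]
      rintro rfl
      rw [weight_single] at hm
      exact lt_irrefl _ hm
    · rw [map_zero]
  intro k m hm
  rw [expTimes, expSeries, PowerSeries.coeff_mk, map_sum]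
  refine Finset.sum_eq_zero fun j _ => ?_
  have hp : ∀ j, WeightBound ((PowerSeries.mk fun k => if h : 0 < k then
      (MvPowerSeries.X (ν, ⟨k, h⟩) : MvPowerSeries TimeIndex R) else 0) ^ j) := by
    intro j
    induction j with
    | zero => rw [pow_zero]; exact weightBound_one
    | succ j ih => rw [pow_succ]; exact ih.mul hX
  rw [coeff_smul_complex, hp j k m hm, smul_zero]

theorem coeff_zero_expTimes (ν : Fin 2) : PowerSeries.coeff 0 (expTimes R ν) = 1 :=
  coeff_zero_expSeries _

/-- The formal partial derivative, over the complex numbers. -/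
noncomputable def pderivC (i : TimeIndex) :
    Derivation ℂ (MvPowerSeries TimeIndex R) (MvPowerSeries TimeIndex R) :=
  (MvPowerSeries.pderiv R i).restrictScalars ℂ

theorem pderivC_apply (i : TimeIndex) (F : MvPowerSeries TimeIndex R) :
    pderivC i F = MvPowerSeries.pderiv R i F := rfl

theorem isLocal_mapDer {A : Type*} [CommRing A] [Algebra ℂ A] (d : Derivation ℂ A A) :
    IsLocal (mapDer d).toLinearMap := fun n f h => by
  change PowerSeries.coeff n (mapDer d f) = 0
  rw [coeff_mapDer, h n le_rfl, map_zero]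

theorem mapDer_expTimes (i : TimeIndex) (ν : Fin 2) : mapDer (pderivC i) (expTimes R ν) =
    if i.1 = ν then PowerSeries.X ^ (i.2 : ℕ) * expTimes R ν else 0 := by
  have h := map_expSeries (T := (mapDer (pderivC (R := R) i)).toLinearMap)
    (X := PowerSeries.mk fun k => if h : 0 < k then
      (MvPowerSeries.X (ν, ⟨k, h⟩) : MvPowerSeries TimeIndex R) else 0) (fun f g => by
      change mapDer _ (f * g) = mapDer _ f * g + f * mapDer _ g
      rw [Derivation.leibniz, smul_eq_mul, smul_eq_mul]
      ring) (isLocal_mapDer _) (by rw [PowerSeries.coeff_mk, dif_neg (lt_irrefl 0)])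
      (Commute.all _ _)
  refine Eq.trans h ?_
  have h2 : mapDer (pderivC (R := R) i) (PowerSeries.mk fun k => if h : 0 < k then
      (MvPowerSeries.X (ν, ⟨k, h⟩) : MvPowerSeries TimeIndex R) else 0) =
      if i.1 = ν then PowerSeries.X ^ (i.2 : ℕ) else 0 := by
    ext1 n
    rw [coeff_mapDer, PowerSeries.coeff_mk, pderivC_apply]
    obtain ⟨μ, k⟩ := i
    by_cases hn : 0 < n
    · rw [dif_pos hn]
      by_cases hμ : μ = ν
      · subst hμ
        rw [if_pos rfl, PowerSeries.coeff_X_pow]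
        by_cases hk : n = k
        · subst hk
          rw [if_pos rfl]
          exact MvPowerSeries.pderiv_X_self
        · rw [if_neg hk, MvPowerSeries.pderiv_X_of_ne]
          intro h
          exact hk (congrArg (fun x => ((Prod.snd x : ℕ+) : ℕ)) h)
      · rw [if_neg hμ, map_zero, MvPowerSeries.pderiv_X_of_ne]
        intro h
        exact hμ (congrArg Prod.fst h).symm
    · rw [dif_neg hn, map_zero]
      split_ifs
      · rw [PowerSeries.coeff_X_pow, if_neg]
        exact fun h => hn (h ▸ k.pos)
      · rw [map_zero]
  change mapDer (pderivC (R := R) i) _ * _ = _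
  rw [h2]
  split_ifs
  · rfl
  · rw [zero_mul]

end Residue


/-! ### Residues with two sets of times and the bilinear identity -/

section ExpResidue

variable {R : Type*} [CommRing R] [Algebra ℂ R]

/-- The series `A(𝐭' + s; z) B(𝐭'; z)`. -/
noncomputable def expandMul (T : R →ₗ[ℂ] MvPowerSeries TimeIndex R) (A B : LaurentSeries R) :
    LaurentSeries (MvPowerSeries TimeIndex R) :=
  A.map T * B.map (MvPowerSeries.C : R →+* MvPowerSeries TimeIndex R)

/-- The residue of `z⁻¹ A(𝐭' + s; z) B(𝐭'; z) e^{ξ(s_ν; z)}`. -/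
noncomputable def expResidue (T : R →ₗ[ℂ] MvPowerSeries TimeIndex R) (ν : Fin 2)
    (A B : LaurentSeries R) : MvPowerSeries TimeIndex R :=
  fun m => ∑ j ∈ Finset.range (weight m + 1), MvPowerSeries.coeff m
    (PowerSeries.coeff j (expTimes R ν) * (expandMul T A B).coeff (j : ℤ))

variable (D : TimeIndex → Derivation ℂ R R) {T : R →ₗ[ℂ] MvPowerSeries TimeIndex R}

theorem coeff_expTimes_mul {ν : Fin 2} {j : ℕ} {m : TimeIndex →₀ ℕ} (h : weight m < j)
    (F : MvPowerSeries TimeIndex R) :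
    MvPowerSeries.coeff m (PowerSeries.coeff j (expTimes R ν) * F) = 0 := by
  classical
  rw [MvPowerSeries.coeff_mul]
  refine Finset.sum_eq_zero fun q hq => ?_
  rw [← Finset.HasAntidiagonal.mem_antidiagonal.1 hq, weight_add] at h
  rw [weightBound_expTimes ν j q.1 (by omega), zero_mul]

/-- The weight bound makes all further terms vanish, so coefficients at different multi-indices can
be computed with a common range. -/
theorem coeff_expResidue {ν : Fin 2} (A B : LaurentSeries R) {m : TimeIndex →₀ ℕ} {N : ℕ}
    (h : weight m < N) : MvPowerSeries.coeff m (expResidue T ν A B) =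
      ∑ j ∈ Finset.range N, MvPowerSeries.coeff m
        (PowerSeries.coeff j (expTimes R ν) * (expandMul T A B).coeff (j : ℤ)) := by
  refine Finset.sum_subset (Finset.range_mono h) fun j _ hj => ?_
  rw [Finset.mem_range, not_lt] at hj
  exact coeff_expTimes_mul hj _

theorem vanish_map {S F : Type*} [CommRing S] [FunLike F R S] [ZeroHomClass F R S] (f : F) {a : ℤ}
    {A : LaurentSeries R} (hA : Vanish a A) : Vanish a (A.map f) := fun n hn => by
  rw [coeff_map, hA n hn, map_zero]

variable {D}

theorem pderiv_expandMul (hT : IsTaylor D T) (i : TimeIndex) (A B : LaurentSeries R) (n : ℤ) :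
    MvPowerSeries.pderiv R i ((expandMul T A B).coeff n) = (expandMul T (A.map (D i)) B).coeff n := by
  obtain ⟨a, hA⟩ := exists_vanish A
  obtain ⟨b, hB⟩ := exists_vanish B
  have hB' := vanish_map (MvPowerSeries.C : R →+* MvPowerSeries TimeIndex R) hB
  rw [expandMul, expandMul, coeff_mul_eq_sum (vanish_map T hA) hB',
    coeff_mul_eq_sum (vanish_map T (vanish_map (D i) hA)) hB', map_sum]
  refine Finset.sum_congr rfl fun k _ => ?_
  rw [Derivation.leibniz, coeff_map, coeff_map, coeff_map, coeff_map, MvPowerSeries.pderiv_C, smul_zero,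
    zero_add, hT.pderiv, smul_eq_mul, mul_comm]

theorem coeff_expandMul_single (A B : LaurentSeries R) (k n : ℤ) :
    (expandMul T (HahnSeries.single (-k) 1 * A) B).coeff n = (expandMul T A B).coeff (n + k) := by
  have h : (HahnSeries.single (-k) (1 : R) * A).map T = HahnSeries.single (-k) 1 * A.map T := by
    ext n : 2
    rw [coeff_map, coeff_single_mul', coeff_single_mul', coeff_map]
  rw [expandMul, h, mul_assoc, coeff_single_mul', sub_neg_eq_add, expandMul]

theorem expandMul_add (A A' B : LaurentSeries R) (n : ℤ) : (expandMul T (A + A') B).coeff n =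
    (expandMul T A B).coeff n + (expandMul T A' B).coeff n := by
  have h : (A + A').map T = A.map T + A'.map T := by
    ext n : 2
    rw [coeff_map, HahnSeries.coeff_add, map_add, HahnSeries.coeff_add, coeff_map, coeff_map]
  rw [expandMul, h, add_mul, HahnSeries.coeff_add, expandMul, expandMul]

theorem expandMul_zero (B : LaurentSeries R) (n : ℤ) : (expandMul T 0 B).coeff n = 0 := by
  have h : (0 : LaurentSeries R).map T = 0 := by
    ext n : 2
    rw [coeff_map, HahnSeries.coeff_zero, HahnSeries.coeff_zero, map_zero]
  rw [expandMul, h, zero_mul, HahnSeries.coeff_zero]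

theorem coeff_zero_expResidue (hT : IsTaylor D T) (ν : Fin 2) (A B : LaurentSeries R) :
    MvPowerSeries.coeff 0 (expResidue T ν A B) = (A * B).coeff 0 := by
  obtain ⟨a, hA⟩ := exists_vanish A
  obtain ⟨b, hB⟩ := exists_vanish B
  rw [coeff_expResidue A B (N := 1) (by rw [weight_zero]; exact one_pos), Finset.sum_range_one,
    coeff_zero_expTimes, one_mul, Nat.cast_zero, expandMul, coeff_mul_eq_sum (vanish_map T hA)
      (vanish_map (MvPowerSeries.C : R →+* MvPowerSeries TimeIndex R) hB), coeff_mul_eq_sum hA hB,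
    map_sum]
  refine Finset.sum_congr rfl fun k _ => ?_
  rw [coeff_map, coeff_map, MvPowerSeries.coeff_zero_eq_constantCoeff_apply, map_mul,
    MvPowerSeries.constantCoeff_C, ← MvPowerSeries.coeff_zero_eq_constantCoeff_apply, hT.coeff_zero]

theorem pderiv_coeff_expTimes (i : TimeIndex) (ν : Fin 2) (j : ℕ) :
    MvPowerSeries.pderiv R i (PowerSeries.coeff j (expTimes R ν)) =
      if i.1 = ν ∧ (i.2 : ℕ) ≤ j then PowerSeries.coeff (j - i.2) (expTimes R ν) else 0 := by
  have h := congrArg (PowerSeries.coeff j) (mapDer_expTimes (R := R) i ν)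
  rw [coeff_mapDer, pderivC_apply] at h
  rw [h]
  by_cases hi : i.1 = ν
  · rw [if_pos hi, PowerSeries.coeff_X_pow_mul']
    by_cases hj : (i.2 : ℕ) ≤ j
    · rw [if_pos hj, if_pos ⟨hi, hj⟩]
    · rw [if_neg hj, if_neg fun h => hj h.2]
  · rw [if_neg hi, if_neg fun h => hi h.1, map_zero]

/-- By the product rule, s-differentiation acts on the Taylor-expanded amplitude as `D i` and on the
exponential as multiplication by z^k; together these form `waveD`. -/
theorem pderiv_expResidue (hT : IsTaylor D T) (i : TimeIndex) (ν : Fin 2) (x : Fin 2 → LaurentSeries R)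
    (B : LaurentSeries R) : MvPowerSeries.pderiv R i (expResidue T ν (x ν) B) =
      expResidue T ν (waveD D i x ν) B := by
  ext m
  have hX : ∀ j : ℕ, (expandMul T (waveD D i x ν) B).coeff j =
      MvPowerSeries.pderiv R i ((expandMul T (x ν) B).coeff j) +
        if i.1 = ν then (expandMul T (x ν) B).coeff (j + (i.2 : ℕ) : ℕ) else 0 := by
    intro j
    rw [waveD, expandMul_add, pderiv_expandMul hT]
    split_ifs
    · rw [coeff_expandMul_single, Nat.cast_add]
    · rw [expandMul_zero]
  -- The derivative of the exponential has no terms below z^k with k = `i.2`. Summing over k more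
  -- indices makes the range match after the substitution j ↦ k + j.
  have h1 : ∑ j ∈ Finset.range (i.2 + (weight m + 1)), MvPowerSeries.coeff m
      (MvPowerSeries.pderiv R i (PowerSeries.coeff j (expTimes R ν)) *
        (expandMul T (x ν) B).coeff (j : ℤ)) =
      ∑ j ∈ Finset.range (weight m + 1), MvPowerSeries.coeff m (PowerSeries.coeff j (expTimes R ν) *
        if i.1 = ν then (expandMul T (x ν) B).coeff (j + (i.2 : ℕ) : ℕ) else 0) := by
    rw [Finset.sum_range_add, Finset.sum_eq_zero, zero_add]
    · refine Finset.sum_congr rfl fun j _ => ?_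
      rw [pderiv_coeff_expTimes]
      by_cases hi : i.1 = ν
      · rw [if_pos ⟨hi, Nat.le_add_right _ _⟩, if_pos hi, Nat.add_sub_cancel_left, add_comm j]
      · rw [if_neg hi, if_neg fun h => hi h.1, zero_mul, mul_zero]
    · intro j hj
      have := Finset.mem_range.1 hj
      rw [pderiv_coeff_expTimes, if_neg fun h => by omega, zero_mul, map_zero]
  rw [coeff_expResidue _ _ (N := weight m + 1) (Nat.lt_succ_self _), MvPowerSeries.coeff_pderiv,
    coeff_expResidue _ _ (N := i.2 + (weight m + 1))
      (by rw [weight_add, weight_single]; omega), Finset.sum_mul]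
  have h2 : ∀ j ∈ Finset.range (i.2 + (weight m + 1)), MvPowerSeries.coeff (m + Finsupp.single i 1)
      (PowerSeries.coeff j (expTimes R ν) * (expandMul T (x ν) B).coeff (j : ℤ)) * ((m i : R) + 1) =
      MvPowerSeries.coeff m (PowerSeries.coeff j (expTimes R ν) *
        MvPowerSeries.pderiv R i ((expandMul T (x ν) B).coeff (j : ℤ))) + MvPowerSeries.coeff m
      (MvPowerSeries.pderiv R i (PowerSeries.coeff j (expTimes R ν)) *
        (expandMul T (x ν) B).coeff (j : ℤ)) := by
    intro j _
    rw [← MvPowerSeries.coeff_pderiv, Derivation.leibniz, smul_eq_mul, smul_eq_mul, map_add,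
      mul_comm ((expandMul T (x ν) B).coeff (j : ℤ))]
  rw [Finset.sum_congr rfl h2, Finset.sum_add_distrib, h1]
  have h3 : ∑ j ∈ Finset.range (i.2 + (weight m + 1)), MvPowerSeries.coeff m
      (PowerSeries.coeff j (expTimes R ν) *
        MvPowerSeries.pderiv R i ((expandMul T (x ν) B).coeff (j : ℤ))) =
      ∑ j ∈ Finset.range (weight m + 1), MvPowerSeries.coeff m (PowerSeries.coeff j (expTimes R ν) *
        MvPowerSeries.pderiv R i ((expandMul T (x ν) B).coeff (j : ℤ))) := by
    symm
    refine Finset.sum_subset (Finset.range_mono (by omega)) fun j _ hj => ?_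
    rw [Finset.mem_range, not_lt] at hj
    exact coeff_expTimes_mul hj _
  rw [h3, ← Finset.sum_add_distrib]
  refine Finset.sum_congr rfl fun j _ => ?_
  rw [hX, mul_add, map_add]

theorem expResidue_C_mul (hT : ∀ x y, T (x * y) = T x * T y) (ν : Fin 2) (f g : R)
    (A B : LaurentSeries R) : expResidue T ν (HahnSeries.C f * A) (HahnSeries.C g * B) =
      T f * MvPowerSeries.C g * expResidue T ν A B := by
  classical
  have hX : ∀ n, (expandMul T (HahnSeries.C f * A) (HahnSeries.C g * B)).coeff n =
      T f * MvPowerSeries.C g * (expandMul T A B).coeff n := by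
    intro n
    have h1 : (HahnSeries.C f * A).map T = HahnSeries.C (T f) * A.map T := by
      ext n : 2
      rw [coeff_map, HahnSeries.C_mul_eq_smul, HahnSeries.C_mul_eq_smul, HahnSeries.coeff_smul,
        HahnSeries.coeff_smul, smul_eq_mul, smul_eq_mul, hT, coeff_map]
    have h2 : (HahnSeries.C g * B).map (MvPowerSeries.C : R →+* MvPowerSeries TimeIndex R) =
        HahnSeries.C (MvPowerSeries.C g) *
          B.map (MvPowerSeries.C : R →+* MvPowerSeries TimeIndex R) := by
      ext n : 2
      rw [coeff_map, HahnSeries.C_mul_eq_smul, HahnSeries.C_mul_eq_smul, HahnSeries.coeff_smul,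
        HahnSeries.coeff_smul, smul_eq_mul, smul_eq_mul, map_mul, coeff_map]
    rw [expandMul, h1, h2, mul_mul_mul_comm, ← map_mul, HahnSeries.C_mul_eq_smul,
      HahnSeries.coeff_smul, smul_eq_mul, expandMul]
  ext m
  rw [coeff_expResidue _ _ (N := weight m + 1) (Nat.lt_succ_self _), MvPowerSeries.coeff_mul]
  have h3 : ∀ q ∈ Finset.HasAntidiagonal.antidiagonal m,
      MvPowerSeries.coeff q.1 (T f * MvPowerSeries.C g) *
        MvPowerSeries.coeff q.2 (expResidue T ν A B) =
      ∑ j ∈ Finset.range (weight m + 1), MvPowerSeries.coeff q.1 (T f * MvPowerSeries.C g) *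
        MvPowerSeries.coeff q.2 (PowerSeries.coeff j (expTimes R ν) *
          (expandMul T A B).coeff (j : ℤ)) := by
    intro q hq
    have hq' := Finset.HasAntidiagonal.mem_antidiagonal.1 hq
    rw [coeff_expResidue A B (N := weight m + 1) (by rw [← hq', weight_add]; omega), Finset.mul_sum]
  rw [Finset.sum_congr rfl h3, Finset.sum_comm]
  refine Finset.sum_congr rfl fun j _ => ?_
  rw [hX, mul_left_comm, MvPowerSeries.coeff_mul]

/-- The bilinear identity of wave functions and adjoint wave functions, after a change of rings
that is compatible with the derivations. -/
theorem WavePair.expResidue_eq {W V : Fin 2 → LaurentSeries R} {ε ε' β' : R}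
    (h : WavePair D W V ε ε' β') {R' : Type*} [CommRing R'] [Algebra ℂ R']
    {D' : TimeIndex → Derivation ℂ R' R'} {T' : R' →ₗ[ℂ] MvPowerSeries TimeIndex R'}
    (hT : IsTaylor D' T') (ρ : R →+* R') (hρ : ∀ i x, ρ (D i x) = D' i (ρ x)) :
    expResidue T' 0 ((W 0).map ρ) ((V 0).map ρ) = expResidue T' 1 ((W 1).map ρ) ((V 1).map ρ) := by
  rw [← sub_eq_zero]
  -- The identity is proved for all elements of the module at once: the resulting set of differences
  -- is closed under differentiation because the module is, and its constant terms are images of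
  -- pairings.
  refine eq_zero_of_pderiv_mem {F | ∃ x ∈ waveModule D W,
    F = expResidue T' 0 ((x 0).map ρ) ((V 0).map ρ) - expResidue T' 1 ((x 1).map ρ) ((V 1).map ρ)}
    ?_ ?_ ⟨W, self_mem_waveModule, rfl⟩
  · rintro _ ⟨x, hx, rfl⟩
    have h1 := congrArg ρ (h.pairing_eq_zero hx)
    have h2 : ∀ A B : LaurentSeries R, (A.map ρ * B.map ρ).coeff 0 = ρ ((A * B).coeff 0) := by
      intro A B
      obtain ⟨a, hA⟩ := exists_vanish A
      obtain ⟨b, hB⟩ := exists_vanish B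
      rw [coeff_mul_eq_sum (vanish_map ρ hA) (vanish_map ρ hB), coeff_mul_eq_sum hA hB, map_sum]
      exact Finset.sum_congr rfl fun k _ => (map_mul ρ _ _).symm
    rw [map_sub, coeff_zero_expResidue hT, coeff_zero_expResidue hT, h2, h2, ← map_sub]
    rw [pairing, map_zero] at h1
    exact h1
  · rintro _ ⟨x, hx, rfl⟩ i
    refine ⟨waveD D i x, h.waveD_mem i x hx, ?_⟩
    have h3 : ∀ ν, (waveD D i x ν).map ρ = waveD D' i (fun ν => (x ν).map ρ) ν := by
      intro ν
      ext n
      rw [coeff_map, coeff_waveD, coeff_waveD, map_add, hρ, coeff_map]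
      split_ifs
      · rw [coeff_map]
      · rw [map_zero]
    rw [h3, h3, map_sub, ← pderiv_expResidue hT, ← pderiv_expResidue hT]

end ExpResidue


/-! ### The Taylor expansion of smooth functions and the bilinear equation -/

section Taylor

variable {U : TimeDomain}

open Classical in
theorem pdMulti_eq_erase (m : TimeIndex →₀ ℕ) (i : TimeIndex) :
    pdMulti (U := U) m = (m.support.erase i).noncommProd (fun j => pdEnd U j ^ m j)
      (fun j _ k _ _ => Commute.pow_pow (LinearMap.ext fun f => pd_comm (U := U) j k f) _ _) *
        pdEnd U i ^ m i := by
  by_cases hi : i ∈ m.support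
  · exact (Finset.noncommProd_erase_mul _ hi _ _).symm
  · rw [Finsupp.notMem_support_iff.1 hi, pow_zero, mul_one]
    exact (Finset.noncommProd_congr (Finset.erase_eq_of_notMem hi) (fun _ _ => rfl) _).symm

theorem pdMulti_add_single (m : TimeIndex →₀ ℕ) (i : TimeIndex) :
    pdMulti (U := U) (m + Finsupp.single i 1) = pdMulti m * pdEnd U i := by
  classical
  rw [pdMulti_eq_erase m i, pdMulti_eq_erase (m + Finsupp.single i 1) i, mul_assoc, ← pow_succ,
    Finsupp.add_apply, Finsupp.single_eq_same]
  congr 1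
  refine Finset.noncommProd_congr ?_ (fun j hj => ?_) _
  · ext j
    simp only [Finset.mem_erase, Finsupp.mem_support_iff, Finsupp.add_apply]
    refine and_congr_right fun hj => ?_
    rw [Finsupp.single_eq_of_ne hj, add_zero]
  · rw [Finsupp.add_apply, Finsupp.single_eq_of_ne (Finset.ne_of_mem_erase hj), add_zero]

theorem prod_factorial_add_single (m : TimeIndex →₀ ℕ) (i : TimeIndex) :
    ((m + Finsupp.single i 1).prod fun _ n => (n.factorial : ℂ)) =
      ((m i + 1 : ℕ) : ℂ) * m.prod fun _ n => (n.factorial : ℂ) := by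
  classical
  rw [← Finsupp.mul_prod_erase' m i _ (by simp),
    ← Finsupp.mul_prod_erase' (m + Finsupp.single i 1) i _ (by simp)]
  have h : (m + Finsupp.single i 1).erase i = m.erase i := by
    rw [Finsupp.erase_add, Finsupp.erase_single, add_zero]
  rw [h, Finsupp.add_apply, Finsupp.single_eq_same, Nat.factorial_succ, Nat.cast_mul, mul_assoc]

theorem coeff_taylor (m : TimeIndex →₀ ℕ) (f : SmoothFn U) : MvPowerSeries.coeff m (taylor f) =
    ((m.prod fun _ n => (n.factorial : ℂ))⁻¹) • pdMulti m f := rfl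

theorem natCast_mul_eq_smul {R : Type*} [CommRing R] [Algebra ℂ R] (x : R) (n : ℕ) :
    x * ((n : R) + 1) = ((n + 1 : ℕ) : ℂ) • x := by
  rw [Algebra.smul_def, mul_comm]
  simp

theorem isTaylor_taylor : IsTaylor (tD (U := U)) taylor where
  coeff_zero f := by
    rw [coeff_taylor, Finsupp.prod_zero_index, inv_one, one_smul]
    have : pdMulti (U := U) 0 = 1 := Finset.noncommProd_empty _ _
    rw [this]
    rfl
  pderiv i f := by
    refine MvPowerSeries.ext fun m => ?_
    have hm : ((m i + 1 : ℕ) : ℂ) ≠ 0 := Nat.cast_ne_zero.2 (Nat.succ_ne_zero _)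
    rw [MvPowerSeries.coeff_pderiv, natCast_mul_eq_smul, coeff_taylor, coeff_taylor, smul_smul,
      prod_factorial_add_single, mul_inv, ← mul_assoc, mul_inv_cancel₀ hm, one_mul,
      pdMulti_add_single]
    rfl

end Taylor

namespace Unknowns

variable {U : TimeDomain} {S : Unknowns U}

theorem amp_w₁ : S.w₁.amp = S.W 0 := by
  rw [← col_Phi, ← PsiDO.amp_onExp]
  rfl

theorem amp_w₂ : S.w₂.amp = S.W 1 := by
  rw [← col_Phi, ← PsiDO.amp_onExp]
  rfl

theorem amp_w₁dag : S.w₁dag.amp = S.V 0 := rfl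

theorem amp_w₂dag : S.w₂dag.amp = S.V 1 := rfl

/-- Restriction commutes with the time derivatives, so it is an admissible change of rings, and the
Taylor expansion is taken over the smaller domain. -/
theorem waveResidue_restrict_eq (hS : S.IsSolution) {V : TimeDomain} (h : V.Sub U) :
    waveResidue (S.w₁.restrict h) (S.w₁dag.restrict h) =
      waveResidue (S.w₂.restrict h) (S.w₂dag.restrict h) := by
  have := (wavePair hS).expResidue_eq (isTaylor_taylor (U := V)) (restrict h) (restrict_pd h)
  rw [← amp_w₁, ← amp_w₂, ← amp_w₁dag, ← amp_w₂dag] at this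
  exact this

theorem waveResidue_eq (hS : S.IsSolution) :
    waveResidue S.w₁ S.w₁dag = waveResidue S.w₂ S.w₂dag := by
  have := (wavePair hS).expResidue_eq (isTaylor_taylor (U := U)) (RingHom.id _) (fun _ _ => rfl)
  rw [← amp_w₁, ← amp_w₂, ← amp_w₁dag, ← amp_w₂dag] at this
  exact this

end Unknowns


/-! ### Wave functions in terms of tau functions -/

section TauFormulas

variable {R R' : Type*} [CommRing R] [Algebra ℂ R] [CommRing R'] [Algebra ℂ R']

theorem map_nabla {δ : ℕ → Derivation ℂ R R} {δ' : ℕ → Derivation ℂ R' R'} (ρ : R →ₐ[ℂ] R')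
    (hρ : ∀ j x, ρ (δ j x) = δ' j (ρ x)) (c : ℂ) (f : PowerSeries R) :
    PowerSeries.map (ρ : R →+* R') (nabla δ c f) = nabla δ' c (PowerSeries.map (ρ : R →+* R') f) := by
  ext n
  rw [PowerSeries.coeff_map, coeff_nabla, coeff_nabla, PowerSeries.coeff_map, RingHom.coe_coe, map_add,
    map_smul, map_smul, map_sum]
  congr 2
  refine Finset.sum_congr rfl fun j _ => ?_
  rw [hρ, PowerSeries.coeff_map, RingHom.coe_coe]

theorem map_diagShift {δ : ℕ → Derivation ℂ R R} {δ' : ℕ → Derivation ℂ R' R'} (h : CommDer δ)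
    (h' : CommDer δ') (ρ : R →ₐ[ℂ] R') (hρ : ∀ j x, ρ (δ j x) = δ' j (ρ x)) (e : ℂ)
    (f : PowerSeries R) : PowerSeries.map (ρ : R →+* R') (diagShift δ e f) =
      diagShift δ' e (PowerSeries.map (ρ : R →+* R') f) := by
  ext n
  rw [PowerSeries.coeff_map, coeff_diagShift, coeff_diagShift, map_sum]
  refine Finset.sum_congr rfl fun p _ => ?_
  rw [PowerSeries.coeff_map]
  exact map_hs h h' ρ.toLinearMap hρ e p.1 _

theorem map_shiftHom {δ : ℕ → Derivation ℂ R R} {δ' : ℕ → Derivation ℂ R' R'} (h : CommDer δ)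
    (h' : CommDer δ') (ρ : R →ₐ[ℂ] R') (hρ : ∀ j x, ρ (δ j x) = δ' j (ρ x)) (e : ℂ) (x : R) :
    PowerSeries.map (ρ : R →+* R') (shiftHom δ h e x) = shiftHom δ' h' e (ρ x) := by
  ext n
  rw [PowerSeries.coeff_map, coeff_shiftHom, coeff_shiftHom]
  exact map_hs h h' ρ.toLinearMap hρ e n x

/-- A solution `τ` of the equation for the logarithmic derivatives determines `φ`. -/
theorem mul_C_eq_shiftHom {δ : ℕ → Derivation ℂ R R} (h : CommDer δ) {φ e : PowerSeries R}
    (he : nabla δ 1 φ = e * φ) (he0 : PowerSeries.coeff 0 e = 0) {τ : R}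
    (hτ : ∀ n, δ n τ = -PowerSeries.coeff (n + 1) e * τ) :
    φ * PowerSeries.C τ = shiftHom δ h (-1) (PowerSeries.coeff 0 φ * τ) := by
  -- The logarithmic derivatives of φ and τ are opposite, so φ τ is annihilated by ∇ just as a shift
  -- is, and comparing constant terms suffices.
  refine eq_of_nabla_eq_zero (δ := δ) 1 ?_ (nabla_shiftHom h _) ?_
  · have h1 : nabla δ 1 (PowerSeries.C τ) = -e * PowerSeries.C τ := by
      ext n
      rw [PowerSeries.coeff_mul_C]
      rcases n with _ | n
      · rw [coeff_nabla_zero, map_neg, he0, neg_zero, zero_mul]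
      · rw [coeff_nabla_C_succ, one_smul, hτ, map_neg]
    rw [Derivation.leibniz, h1, he, smul_eq_mul, smul_eq_mul]
    ring
  · rw [PowerSeries.coeff_mul_C, coeff_shiftHom, hs_zero]

theorem toPow_map (ρ : R →+* R') (A : LaurentSeries R) :
    toPow (A.map ρ) = PowerSeries.map ρ (toPow A) := by
  ext n
  rw [coeff_toPow, PowerSeries.coeff_map, coeff_toPow, coeff_map]

variable {D : TimeIndex → Derivation ℂ R R} {D' : TimeIndex → Derivation ℂ R' R'}
  {W V : Fin 2 → LaurentSeries R} {ε ε' β' : R}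

namespace WavePair

variable (h : WavePair D W V ε ε' β') (h' : ∀ ν, CommDer (timeDer D' ν)) (ρ : R →ₐ[ℂ] R')
  (hρ : ∀ i x, ρ (D i x) = D' i (ρ x)) {e : Fin 2 → PowerSeries R}
  (he : ∀ ν, nabla (timeDer D ν) 1 (toPow (W ν)) = e ν * toPow (W ν))
  (he0 : ∀ ν, PowerSeries.coeff 0 (e ν) = 0) {τ₁ τ₂ : R'ˣ}
  (hτ : ∀ ν n, timeDer D' ν n τ₁ = -ρ (PowerSeries.coeff (n + 1) (e ν)) * τ₁)
  (hτ₂ : (τ₂ : R') = ρ ε * τ₁)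

include hρ he he0 hτ in
theorem map_wave_mul (ν : Fin 2) : PowerSeries.map (ρ : R →+* R') (toPow (W ν)) *
    PowerSeries.C (τ₁ : R') = shiftHom _ (h' ν) (-1) (ρ ((W ν).coeff 0) * τ₁) := by
  rw [mul_C_eq_shiftHom (h' ν) (e := PowerSeries.map (ρ : R →+* R') (e ν))]
  · rw [PowerSeries.coeff_map, coeff_toPow, Nat.cast_zero, RingHom.coe_coe]
  · rw [← map_nabla (δ := timeDer D ν) (δ' := timeDer D' ν) ρ (fun j x => hρ _ x), he, map_mul]
  · rw [PowerSeries.coeff_map, he0, map_zero]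
  · intro n
    rw [hτ, PowerSeries.coeff_map, RingHom.coe_coe]

include h hρ he he0 hτ in
theorem map_wave_zero : PowerSeries.map (ρ : R →+* R') (toPow (W 0)) =
    PowerSeries.C ((τ₁⁻¹ : R'ˣ) : R') * shiftHom _ (h' 0) (-1) (τ₁ : R') := by
  have h1 := map_wave_mul h' ρ hρ he he0 hτ 0
  rw [h.lead₀, map_one, one_mul] at h1
  rw [← h1, mul_left_comm, ← map_mul, Units.inv_mul, map_one, mul_one]

include h hρ he he0 hτ hτ₂ in
theorem map_wave_one : PowerSeries.map (ρ : R →+* R') (toPow (W 1)) =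
    PowerSeries.C ((τ₁⁻¹ : R'ˣ) : R') * shiftHom _ (h' 1) (-1) (τ₂ : R') := by
  have h1 := map_wave_mul h' ρ hρ he he0 hτ 1
  rw [h.lead₁, ← hτ₂] at h1
  rw [← h1, mul_left_comm, ← map_mul, Units.inv_mul, map_one, mul_one]

/-- For φ(u) = x(t - [u]) / τ one has φ(t + [u]; u) = x / τ(t + [u]). This inverts the diagonal
shift for the adjoint functions. -/
theorem diagShift_C_inv_mul {δ : ℕ → Derivation ℂ R' R'} (hδ : CommDer δ) (τ : R'ˣ) (x : R') :
    shiftHom δ hδ 1 (τ : R') * diagShift δ 1 (PowerSeries.C ((τ⁻¹ : R'ˣ) : R') *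
      shiftHom δ hδ (-1) x) = PowerSeries.C x := by
  rw [diagShift_C_mul hδ, diagShift_shiftHom, ← mul_assoc, ← map_mul, Units.mul_inv, map_one, one_mul]

-- Since φ₁(t₁ + [u]; u) = τ₁ / τ₁(t₁ + [u]), the orthogonality relation gives ε(t₁ + [u]) τ₁(t₁ +
-- [u]) / (ε τ₁) for the adjoint amplitude, and ε τ₁ = τ₂.
include h hρ he he0 hτ hτ₂ in
theorem map_dual_zero : PowerSeries.map (ρ : R →+* R') (toPow (V 0)) =
    PowerSeries.C ((τ₂⁻¹ : R'ˣ) : R') * shiftHom _ (h' 0) 1 (τ₂ : R') := by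
  have h1 := congrArg (PowerSeries.map (ρ : R →+* R')) h.diagShift_mul_zero
  rw [map_mul, map_mul, map_diagShift (h.commDer 0) (h' 0) ρ (fun j x => hρ _ x),
    map_shiftHom (h.commDer 0) (h' 0) ρ (fun j x => hρ _ x), PowerSeries.map_C, RingHom.coe_coe,
    map_wave_zero h h' ρ hρ he he0 hτ] at h1
  have h2 := diagShift_C_inv_mul (h' 0) τ₁ (τ₁ : R')
  have h3 : ρ ε * ρ ε' = 1 := by rw [← map_mul, h.mul_inv, map_one]
  have h4 : PowerSeries.C (τ₁ : R') * PowerSeries.map (ρ : R →+* R') (toPow (V 0)) =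
      PowerSeries.C (ρ ε') * shiftHom _ (h' 0) 1 (τ₂ : R') := by
    rw [← h2, mul_assoc, h1, hτ₂, map_mul]
    ring
  have h5 : PowerSeries.C (τ₂ : R') * PowerSeries.map (ρ : R →+* R') (toPow (V 0)) =
      shiftHom _ (h' 0) 1 (τ₂ : R') := by
    conv_lhs => rw [hτ₂, map_mul, mul_assoc, h4, ← mul_assoc, ← map_mul, h3, map_one, one_mul]
  rw [← h5, ← mul_assoc, ← map_mul, Units.inv_mul, map_one, one_mul]

include h hρ he he0 hτ hτ₂ in
theorem map_dual_one : PowerSeries.map (ρ : R →+* R') (toPow (V 1)) =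
    PowerSeries.C ((τ₂⁻¹ : R'ˣ) : R') * shiftHom _ (h' 1) 1 (τ₁ : R') := by
  have h1 := congrArg (PowerSeries.map (ρ : R →+* R')) h.diagShift_mul_one
  rw [map_mul, map_one, map_diagShift (h.commDer 1) (h' 1) ρ (fun j x => hρ _ x),
    map_wave_one h h' ρ hρ he he0 hτ hτ₂] at h1
  have h2 := diagShift_C_inv_mul (h' 1) τ₁ (τ₂ : R')
  have h3 : PowerSeries.C (τ₂ : R') * PowerSeries.map (ρ : R →+* R') (toPow (V 1)) =
      shiftHom _ (h' 1) 1 (τ₁ : R') := by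
    rw [← h2, mul_assoc, h1, mul_one]
  rw [← h3, ← mul_assoc, ← map_mul, Units.inv_mul, map_one, one_mul]

end WavePair

end TauFormulas

section

variable {U : TimeDomain}

theorem commDer_tD (ν : Fin 2) : CommDer (timeDer (tD (U := U)) ν) := fun _ _ x => tD_comm _ _ x

theorem shift_eq (ν : Fin 2) (ε : ℤˣ) (f : SmoothFn U) : shift ν ε f =
    HahnSeries.ofPowerSeries ℤ (SmoothFn U) (shiftHom _ (commDer_tD ν) ((ε : ℤ) : ℂ) f) := by
  have h : (PowerSeries.mk fun k => if h : 0 < k then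
      (((ε : ℤ) : ℂ) / (k : ℂ)) • pdEnd U (ν, ⟨k, h⟩) else 0) =
      shiftExponent (timeDer tD ν) ((ε : ℤ) : ℂ) := by
    refine PowerSeries.ext fun k => ?_
    rw [shiftExponent, PowerSeries.coeff_mk, PowerSeries.coeff_mk]
    by_cases hk : 0 < k
    · rw [dif_pos hk, if_pos hk]
      obtain ⟨k, rfl⟩ := Nat.exists_eq_succ_of_ne_zero hk.ne'
      rfl
    · rw [dif_neg hk, if_neg hk]
  rw [shift, shiftOp, h]
  congr 1
  refine PowerSeries.ext fun n => ?_
  rw [PowerSeries.coeff_mk, coeff_shiftHom, hs_eq]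

/-- Restriction of smooth functions as a homomorphism of algebras. -/
noncomputable def restrictAlg {V : TimeDomain} (h : V.Sub U) : SmoothFn U →ₐ[ℂ] SmoothFn V :=
  { restrict h with commutes' := fun _ => rfl }

namespace Unknowns

variable {S : Unknowns U}

theorem restrict_amp_eq {V : TimeDomain} (h : V.Sub U) {A : LaurentSeries (SmoothFn U)}
    (hA : Vanish 0 A) {x : SmoothFn V} {f : PowerSeries (SmoothFn V)}
    (hf : PowerSeries.map (restrictAlg h : SmoothFn U →+* SmoothFn V) (toPow A) =
      PowerSeries.C x * f) :
    A.map (restrict h) = HahnSeries.C x * HahnSeries.ofPowerSeries ℤ _ f := by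
  rw [← HahnSeries.ofPowerSeries_C, ← map_mul, ← hf, ← toPow_map, ofPowerSeries_toPow]
  · rfl
  · exact vanish_map (restrictAlg h : SmoothFn U →+* SmoothFn V) hA

/-- The representation of the wave functions through tau functions. -/
theorem wave_eq_tau (hS : S.IsSolution) {V : TimeDomain} (h : V.Sub U) {τ₁ τ₂ : (SmoothFn V)ˣ}
    (hτ : S.IsTau₁ h τ₁) (hτ₂ : τ₂ = S.tau₂ h τ₁) :
    (S.W 0).map (restrict h) = HahnSeries.C ((τ₁⁻¹ : (SmoothFn V)ˣ) : SmoothFn V) *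
      shift 0 (-1) (τ₁ : SmoothFn V) ∧
    (S.V 0).map (restrict h) = HahnSeries.C ((τ₂⁻¹ : (SmoothFn V)ˣ) : SmoothFn V) *
      shift 0 1 (τ₂ : SmoothFn V) ∧
    (S.W 1).map (restrict h) = HahnSeries.C ((τ₁⁻¹ : (SmoothFn V)ˣ) : SmoothFn V) *
      shift 1 (-1) (τ₂ : SmoothFn V) ∧
    (S.V 1).map (restrict h) = HahnSeries.C ((τ₂⁻¹ : (SmoothFn V)ˣ) : SmoothFn V) *
      shift 1 1 (τ₁ : SmoothFn V) := by
  have hp := wavePair hS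
  have hρ : ∀ i x, restrictAlg h (tD i x) = tD i (restrictAlg h x) := restrict_pd h
  have he0 : ∀ ν, PowerSeries.coeff 0 (S.logDeriv ν) = 0 := fun ν => coeff_nabla_zero _ _
  have hτ' : ∀ ν n, timeDer tD ν n (τ₁ : SmoothFn V) =
      -restrictAlg h (PowerSeries.coeff (n + 1) (S.logDeriv ν)) * τ₁ := by
    intro ν n
    rw [← map_neg, ← η_eq]
    exact hτ _
  have hτ₂' : (τ₂ : SmoothFn V) = restrictAlg h (expFn S.β) * τ₁ := by
    rw [hτ₂]
    rfl
  have h1 : (((1 : ℤˣ) : ℤ) : ℂ) = 1 := by simp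
  have h2 : (((-1 : ℤˣ) : ℤ) : ℂ) = -1 := by simp
  simp only [shift_eq, h1, h2]
  exact ⟨restrict_amp_eq h (hp.vanish 0) (hp.map_wave_zero _ _ hρ S.nabla_toPow_W he0 hτ'),
    restrict_amp_eq h (hp.vanish' 0) (hp.map_dual_zero _ _ hρ S.nabla_toPow_W he0 hτ' hτ₂'),
    restrict_amp_eq h (hp.vanish 1) (hp.map_wave_one _ _ hρ S.nabla_toPow_W he0 hτ' hτ₂'),
    restrict_amp_eq h (hp.vanish' 1) (hp.map_dual_one _ _ hρ S.nabla_toPow_W he0 hτ' hτ₂')⟩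

end Unknowns

end


/-- The prefactors do not depend on z, so they leave the residue: the unprimed one through its
Taylor expansion, which is multiplicative, and the primed one as a constant in s. -/
theorem mul_residue_inv {U : TimeDomain} (f g : (SmoothFn U)ˣ) (ν : Fin 2)
    (A B : LaurentSeries (SmoothFn U)) :
    taylor (f : SmoothFn U) * MvPowerSeries.C (g : SmoothFn U) *
      residue ν (HahnSeries.C ((f⁻¹ : (SmoothFn U)ˣ) : SmoothFn U) * A)
        (HahnSeries.C ((g⁻¹ : (SmoothFn U)ˣ) : SmoothFn U) * B) = residue ν A B := by
  have h := expResidue_C_mul (isTaylor_taylor (U := U)).map_mul ν (f : SmoothFn U) (g : SmoothFn U)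
    (HahnSeries.C ((f⁻¹ : (SmoothFn U)ˣ) : SmoothFn U) * A)
    (HahnSeries.C ((g⁻¹ : (SmoothFn U)ˣ) : SmoothFn U) * B)
  rw [← mul_assoc, ← mul_assoc, ← map_mul, ← map_mul, Units.mul_inv, Units.mul_inv, map_one,
    one_mul, one_mul] at h
  exact h.symm

end KPmKP

/-- Tau functions of the KP-mKP hierarchy. -/
theorem theorem6p5 (U : TimeDomain) (S : Unknowns U) (hS : S.IsSolution) :
    -- the 1-form `η` is closed
    (∀ i j : TimeIndex, pd i (S.η j) = pd j (S.η i)) ∧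
    -- local existence of tau functions
    (∀ p ∈ U.carrier, ∃ (V : TimeDomain) (h : V.Sub U), p ∈ V.carrier ∧
      ∃ τ₁ : (SmoothFn V)ˣ, S.IsTau₁ h τ₁) ∧
    -- existence of tau functions on every star-shaped subdomain
    (∀ (V : TimeDomain) (h : V.Sub U) (p : Times), StarConvex ℝ p V.carrier →
      ∃ τ₁ : (SmoothFn V)ˣ, S.IsTau₁ h τ₁) ∧
    -- the bilinear equation of the (adjoint) Baker-Akhiezer functions
    waveResidue S.w₁ S.w₁dag = waveResidue S.w₂ S.w₂dag ∧
    ∀ (V : TimeDomain) (h : V.Sub U) (τ₁ τ₂ : (SmoothFn V)ˣ),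
      S.IsTau₁ h τ₁ → τ₂ = S.tau₂ h τ₁ →
      -- the representation through tau functions
      S.w₁.restrict h =
        ⟨HahnSeries.C ((τ₁⁻¹ : (SmoothFn V)ˣ) : SmoothFn V) *
          shift 0 (-1) (τ₁ : SmoothFn V)⟩ ∧
      S.w₁dag.restrict h =
        ⟨HahnSeries.C ((τ₂⁻¹ : (SmoothFn V)ˣ) : SmoothFn V) *
          shift 0 1 (τ₂ : SmoothFn V)⟩ ∧
      S.w₂.restrict h =
        ⟨HahnSeries.C ((τ₁⁻¹ : (SmoothFn V)ˣ) : SmoothFn V) *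
          shift 1 (-1) (τ₂ : SmoothFn V)⟩ ∧
      S.w₂dag.restrict h =
        ⟨HahnSeries.C ((τ₂⁻¹ : (SmoothFn V)ˣ) : SmoothFn V) *
          shift 1 1 (τ₁ : SmoothFn V)⟩ ∧
      -- multiplied by `τ₁(𝐭) τ₂(𝐭')`, the two sides of the bilinear equation become residues
      -- in `τ₁` and `τ₂` alone
      taylor (τ₁ : SmoothFn V) * MvPowerSeries.C (τ₂ : SmoothFn V) *
          waveResidue (S.w₁.restrict h) (S.w₁dag.restrict h) =
        residue 0 (shift 0 (-1) (τ₁ : SmoothFn V))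
          (shift 0 1 (τ₂ : SmoothFn V)) ∧
      taylor (τ₁ : SmoothFn V) * MvPowerSeries.C (τ₂ : SmoothFn V) *
          waveResidue (S.w₂.restrict h) (S.w₂dag.restrict h) =
        residue 1 (shift 1 (-1) (τ₂ : SmoothFn V))
          (shift 1 1 (τ₁ : SmoothFn V)) ∧
      -- the bilinear equation of the tau functions
      residue 0 (shift 0 (-1) (τ₁ : SmoothFn V))
          (shift 0 1 (τ₂ : SmoothFn V)) =
        residue 1 (shift 1 (-1) (τ₂ : SmoothFn V))
          (shift 1 1 (τ₁ : SmoothFn V)) := by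
  refine ⟨Unknowns.η_closed hS, fun p hp => Unknowns.exists_tau_near hS hp,
    fun V h p hp => Unknowns.exists_tau_of_starConvex hS h hp, Unknowns.waveResidue_eq hS,
    fun V h τ₁ τ₂ hτ hτ₂ => ?_⟩
  obtain ⟨h1, h2, h3, h4⟩ := Unknowns.wave_eq_tau hS h hτ hτ₂
  have e1 : S.w₁.restrict h = ⟨HahnSeries.C ((τ₁⁻¹ : (SmoothFn V)ˣ) : SmoothFn V) *
      shift 0 (-1) (τ₁ : SmoothFn V)⟩ :=
    Wave.ext ((congrArg (HahnSeries.map · (restrict h)) Unknowns.amp_w₁).trans h1)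
  have e2 : S.w₁dag.restrict h = ⟨HahnSeries.C ((τ₂⁻¹ : (SmoothFn V)ˣ) : SmoothFn V) *
      shift 0 1 (τ₂ : SmoothFn V)⟩ :=
    Wave.ext ((congrArg (HahnSeries.map · (restrict h)) Unknowns.amp_w₁dag).trans h2)
  have e3 : S.w₂.restrict h = ⟨HahnSeries.C ((τ₁⁻¹ : (SmoothFn V)ˣ) : SmoothFn V) *
      shift 1 (-1) (τ₂ : SmoothFn V)⟩ :=
    Wave.ext ((congrArg (HahnSeries.map · (restrict h)) Unknowns.amp_w₂).trans h3)
  have e4 : S.w₂dag.restrict h = ⟨HahnSeries.C ((τ₂⁻¹ : (SmoothFn V)ˣ) : SmoothFn V) *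
      shift 1 1 (τ₁ : SmoothFn V)⟩ :=
    Wave.ext ((congrArg (HahnSeries.map · (restrict h)) Unknowns.amp_w₂dag).trans h4)
  have r1 : taylor (τ₁ : SmoothFn V) * MvPowerSeries.C (τ₂ : SmoothFn V) *
      waveResidue (S.w₁.restrict h) (S.w₁dag.restrict h) =
        residue 0 (shift 0 (-1) (τ₁ : SmoothFn V)) (shift 0 1 (τ₂ : SmoothFn V)) := by
    rw [e1, e2]
    exact mul_residue_inv τ₁ τ₂ 0 _ _
  have r2 : taylor (τ₁ : SmoothFn V) * MvPowerSeries.C (τ₂ : SmoothFn V) *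
      waveResidue (S.w₂.restrict h) (S.w₂dag.restrict h) =
        residue 1 (shift 1 (-1) (τ₂ : SmoothFn V)) (shift 1 1 (τ₁ : SmoothFn V)) := by
    rw [e3, e4]
    exact mul_residue_inv τ₁ τ₂ 1 _ _
  exact ⟨e1, e2, e3, e4, r1, r2, by rw [← r1, ← r2, Unknowns.waveResidue_restrict_eq hS]⟩
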